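/- **Setting.** Let $n\ge 1$, $\Omega=(0,X_1)\times\dots\times(0,X_n)$, $Q_T=\Omega\times(0,T)$, $a_1,\dots,a_n>0$ constants, $0<\underline\rho\le\rho(x)$ on $\bar\Omega$, and let $u$ solve $$\rho\,\partial_t^2u-(a_1^2\partial_1^2+\dots+a_n^2\partial_n^2)u=f\ \text{ in }Q_T,\qquad u=g\ \text{ on }\partial\Omega\times[0,T],\qquad u|_{t=0}=u_0,\ \ \partial_tu|_{t=0}=u_1 \text{ on }\bar\Omega,$$ with $f$ continuous on $\bar Q_T$. Take $h_i=X_i/N_i$ with integers $N_i\ge1$, $h_t=T/M$ with an integer $M\ge2$, $t_m=mh_t$, $\mathbf h=(h_1,\dots,h_n,h_t)$, $|\mathbf h|=(h_1^2+\dots+h_n^2+h_t^2)^{1/2}$. Let $\bar\omega_h$ be the mesh of the nodes $x_{\mathbf k}=(k_1h_1,\dots,k_nh_n)$, $0\le k_i\le N_i$, $\omega_h$ the set of its nodes with all $1\le k_i\le N_i-1$, and $\partial\omega_h=\bar\omega_h\setminus\omega_h$. Let $H_h$ be the space of mesh functions on $\bar\omega_h$ vanishing on $\partial\omega_h$, with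 $(v,w)_h=h_1\cdots h_n\sum_{x_{\mathbf k}\in\omega_h}v_{\mathbf k}w_{\mathbf k}$, $\|w\|_h=(w,w)_h^{1/2}$ and $\|w\|_C=(Cw,w)_h^{1/2}$ for an operator $C$; inequalities between operators are meant in $H_h$ in the sense of quadratic forms. Put $$(\Lambda_lw)_{\mathbf k}=\frac{w_{\mathbf k+\mathbf e_l}-2w_{\mathbf k}+w_{\mathbf k-\mathbf e_l}}{h_l^2},\quad \Delta_h=\Lambda_1+\dots+\Lambda_n,\quad \bar\delta_ty^m=\frac{y^m-y^{m-1}}{h_t},\quad \delta_ty^m=\frac{y^{m+1}-y^m}{h_t},$$ $$\bar s_ty^m=\frac{y^{m-1}+y^m}2,\quad \Lambda_ty^m=\frac{y^{m+1}-2y^m+y^{m-1}}{h_t^2},$$ $$s_N=I+\tfrac1{12}\sum_ih_i^2\Lambda_i,\qquad A_N=-\sum_ia_i^2\Big(I+\tfrac1{12}\sum_{j\ne i}h_j^2\Lambda_j\Big)\Lambda_i,$$ $$\bar s_N=\prod_k\big(I+\tfrac1{12}h_k^2\Lambda_k\big),\qquad \bar A_N=-\sum_ia_i^2\prod_{k\ne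 i}\big(I+\tfrac1{12}h_k^2\Lambda_k\big)\Lambda_i .$$ Consider the following three schemes, with real parameters $\beta,\gamma,\theta$ independent of the mesh: 1. $n=2$, $B_h=s_N+\beta\frac{h_1^2}{12}\frac{h_2^2}{12}\Lambda_1\Lambda_2$, $A_h=A_N$; 2. $n=3$, $B_h=s_N+\frac{\beta}{12^2}\sum_{i<j}h_i^2h_j^2\Lambda_i\Lambda_j+\frac{\gamma}{12^3}h_1^2h_2^2h_3^2\Lambda_1\Lambda_2\Lambda_3$, $A_h=A_N-\frac{\theta}{12^2}(a_1^2h_2^2h_3^2+a_2^2h_1^2h_3^2+a_3^2h_1^2h_2^2)\Lambda_1\Lambda_2\Lambda_3$; 3. $n\ge1$ arbitrary, $B_h=\bar s_N$, $A_h=\bar A_N$. In each case $v$ is a solution to the scheme $$B_h(\rho\Lambda_tv)+\tfrac1{12}h_t^2A_h\Lambda_tv+A_hv=s_Nf+\tfrac1{12}h_t^2\Lambda_tf\quad\text{on }\omega_h\times\{t_m\}_{m=1}^{M-1},$$ $$B_h(\rho\,\delta_tv^0)+\tfrac1{12}h_t^2A_h\delta_tv^0+\tfrac12h_tA_hv^0=u_{1N}+\tfrac12h_tf_N^0\quad\text{on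 }\omega_h,$$ $$v=g\ \text{ on }\partial\omega_h\times\{t_m\}_{m=1}^M,\qquad v^0=u_0\ \text{ on }\bar\omega_h,$$ where $u_{1N}=s_N(\rho u_1)+\frac1{12}h_t^2\sum_ia_i^2\Lambda_iu_1$ and $f_N^0=f_{dh_t}^{(0)}+\frac1{12}\sum_ih_i^2\Lambda_if|_{t=0}$, with any mesh function $f_{dh_t}^{(0)}$ such that $\big|f_{dh_t}^{(0)}-\big(f+\tfrac13h_t\partial_tf+\tfrac1{12}h_t^2\partial_t^2f\big)\big|_{t=0}\big|\le C_dh_t^3$ on $\omega_h$, $C_d$ being independent of the mesh. **Theorem.** (a) Let $\rho$ and $u$ be sufficiently smooth on $\bar\Omega$ and $\bar Q_T$ respectively, i.e. of class $C^K$ up to the boundary for a suitable absolute order $K$. Let $0<\varepsilon_0<1$ and $0<\nu_0\le\nu$ be independent of the mesh. Then there is a constant $C$, independent of the mesh, such that for every mesh on which $\nu_0I\le B_h\le\nu I$ and * for schemes 1 and 2: $B_h>0$, $A_h>0$, and $A_h\le\alpha_h^2B_h$ for some $\alpha_h$ with $\frac16h_t^2\alpha_h^2\le(1-\varepsilon_0^2)\underline\rho$,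 * for scheme 3: $h_t^2\big(\frac{a_1^2}{h_1^2}+\dots+\frac{a_n^2}{h_n^2}\big)\le(1-\varepsilon_0^2)\underline\rho$, one has $$\max_{1\le m\le M}\Big[\varepsilon_0\|\sqrt\rho\,\bar\delta_t(u-v)^m\|_h+\|\bar s_t(u-v)^m\|_{A_h}\Big]\le C\,|\mathbf h|^4 .$$ (b) Let $a_{\min}=\min_ia_i$, and let $\varepsilon_2=1$ for schemes 1 and 3, or $0<\varepsilon_2\le\theta\le1$ for scheme 2. Then $$\sqrt{\varepsilon_2}\,a_{\min}\big(\tfrac23\big)^{(n-1)/2}\|w\|_{-\Delta_h}\le\|w\|_{A_h}\qquad\forall\,w\in H_h.$$ -/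

import Mathlib

namespace CompactWave

noncomputable section

/-- Mesh functions, indexed by the integer multi-index of the node. Only the values at the nodes of
the closed mesh (indices `0 ≤ k i ≤ N i`) are ever used: the stencils below, taken at inner nodes,
do not reach beyond the closed mesh. -/
abbrev MeshFn (n : ℕ) : Type := (Fin n → ℤ) → ℝ

/-- Linear operators on mesh functions. -/
abbrev MeshOp (n : ℕ) : Type := Module.End ℝ (MeshFn n)

/-! ### The mesh and the space `H_h` -/

/-- The node with multi-index `k` for the steps `h`. -/
def node {n : ℕ} (h : Fin n → ℝ) (k : Fin n → ℤ) : Fin n → ℝ := fun i => (k i : ℝ) * h i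

/-- Restriction of a function of `x` to the mesh. -/
def sample {n : ℕ} (h : Fin n → ℝ) (φ : (Fin n → ℝ) → ℝ) : MeshFn n := fun k => φ (node h k)

/-- Indices of the inner nodes: `1 ≤ k i ≤ N i - 1`. -/
def innerNodes {n : ℕ} (N : Fin n → ℕ) : Finset (Fin n → ℤ) :=
  Fintype.piFinset fun i => Finset.Icc (1 : ℤ) ((N i : ℤ) - 1)

/-- Indices of all the nodes: `0 ≤ k i ≤ N i`. -/
def closedNodes {n : ℕ} (N : Fin n → ℕ) : Finset (Fin n → ℤ) :=
  Fintype.piFinset fun i => Finset.Icc (0 : ℤ) (N i : ℤ)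

/-- Indices of the boundary nodes. -/
def boundaryNodes {n : ℕ} (N : Fin n → ℕ) : Finset (Fin n → ℤ) := closedNodes N \ innerNodes N

/-- The space `H_h` of mesh functions that vanish at all the nodes that are not inner. -/
def Hh {n : ℕ} (N : Fin n → ℕ) : Submodule ℝ (MeshFn n) where
  carrier := {w | ∀ k, k ∉ innerNodes N → w k = 0}
  add_mem' := by
    intro v w hv hw k hk
    simp [hv k hk, hw k hk]
  zero_mem' := by
    intro k _
    rfl
  smul_mem' := by
    intro c w hw k hk
    simp [hw k hk]

/-- The inner product `(v, w)_h = h_1 ⋯ h_n ∑ v_k w_k`, the sum being over the inner nodes. -/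
def innerH {n : ℕ} (h : Fin n → ℝ) (N : Fin n → ℕ) (v w : MeshFn n) : ℝ :=
  (∏ i, h i) * ∑ k ∈ innerNodes N, v k * w k

/-- The norm of `H_h`. -/
def normH {n : ℕ} (h : Fin n → ℝ) (N : Fin n → ℕ) (w : MeshFn n) : ℝ :=
  Real.sqrt (innerH h N w w)

/-- The norm `‖w‖_C = (C w, w)_h ^ (1/2)` generated by an operator `C`. -/
def normOp {n : ℕ} (h : Fin n → ℝ) (N : Fin n → ℕ) (C : MeshOp n) (w : MeshFn n) : ℝ :=
  Real.sqrt (innerH h N (C w) w)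

/-- `C > 0` in `H_h`. -/
def PosOp {n : ℕ} (h : Fin n → ℝ) (N : Fin n → ℕ) (C : MeshOp n) : Prop :=
  ∀ w ∈ Hh N, w ≠ 0 → 0 < innerH h N (C w) w

/-- `C ≤ D` in `H_h`. -/
def LeOp {n : ℕ} (h : Fin n → ℝ) (N : Fin n → ℕ) (C D : MeshOp n) : Prop :=
  ∀ w ∈ Hh N, innerH h N (C w) w ≤ innerH h N (D w) w

/-! ### Difference operators in space -/

/-- The second difference `Λ_l`. -/
def lam {n : ℕ} (h : Fin n → ℝ) (l : Fin n) : MeshOp n where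
  toFun w := fun k => (w (k + Pi.single l 1) - 2 * w k + w (k - Pi.single l 1)) / h l ^ 2
  map_add' v w := by
    funext k
    simp only [Pi.add_apply]
    ring
  map_smul' c w := by
    funext k
    simp only [Pi.smul_apply, smul_eq_mul, RingHom.id_apply]
    ring

/-- The mesh Laplacian `Δ_h = Λ_1 + ⋯ + Λ_n`. -/
def lapH {n : ℕ} (h : Fin n → ℝ) : MeshOp n := ∑ i, lam h i

/-- `s_N = I + (1/12) (h_1² Λ_1 + ⋯ + h_n² Λ_n)`. -/
def sN {n : ℕ} (h : Fin n → ℝ) : MeshOp n :=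
  1 + (1 / 12 : ℝ) • ∑ i, h i ^ 2 • lam h i

/-- `s_N` without the direction `j`. -/
def sNhat {n : ℕ} (h : Fin n → ℝ) (j : Fin n) : MeshOp n :=
  1 + (1 / 12 : ℝ) • ∑ i ∈ Finset.univ.erase j, h i ^ 2 • lam h i

/-- `A_N = -(a_1² s_{N,1^} Λ_1 + ⋯ + a_n² s_{N,n^} Λ_n)`. -/
def AN {n : ℕ} (a h : Fin n → ℝ) : MeshOp n :=
  -∑ i, a i ^ 2 • (sNhat h i * lam h i)

/-- `s_{kN} = I + (1/12) h_k² Λ_k`. -/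
def skN {n : ℕ} (h : Fin n → ℝ) (k : Fin n) : MeshOp n :=
  1 + (1 / 12 * h k ^ 2 : ℝ) • lam h k

/-- `s̄_N`, the product (composition) of all the `s_{kN}`. -/
def sbarN {n : ℕ} (h : Fin n → ℝ) : MeshOp n :=
  ((List.finRange n).map (skN h)).prod

/-- `s̄_N` without the direction `l`. -/
def sbarNhat {n : ℕ} (h : Fin n → ℝ) (l : Fin n) : MeshOp n :=
  (((List.finRange n).filter (fun k => k ≠ l)).map (skN h)).prod

/-- `Ā_N = -(a_1² s̄_{N,1^} Λ_1 + ⋯ + a_n² s̄_{N,n^} Λ_n)`. -/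
def AbarN {n : ℕ} (a h : Fin n → ℝ) : MeshOp n :=
  -∑ i, a i ^ 2 • (sbarNhat h i * lam h i)

/-- `s_{Nβ}` for `n = 2`. -/
def sNbeta (h : Fin 2 → ℝ) (β : ℝ) : MeshOp 2 :=
  sN h + (β * (h 0 ^ 2 / 12) * (h 1 ^ 2 / 12)) • (lam h 0 * lam h 1)

/-- `s̄_N^{(2)}` for `n = 3`. -/
def sbarN2 (h : Fin 3 → ℝ) : MeshOp 3 :=
  (1 / 12 ^ 2 : ℝ) • ((h 0 ^ 2 * h 1 ^ 2) • (lam h 0 * lam h 1)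
    + (h 0 ^ 2 * h 2 ^ 2) • (lam h 0 * lam h 2) + (h 1 ^ 2 * h 2 ^ 2) • (lam h 1 * lam h 2))

/-- `s̄_N^{(3)}` for `n = 3`. -/
def sbarN3 (h : Fin 3 → ℝ) : MeshOp 3 :=
  (1 / 12 ^ 3 * (h 0 ^ 2 * h 1 ^ 2 * h 2 ^ 2) : ℝ) • (lam h 0 * lam h 1 * lam h 2)

/-- `s_{Nβγ} = s_N + β s̄_N^{(2)} + γ s̄_N^{(3)}` for `n = 3`. -/
def sNbetagamma (h : Fin 3 → ℝ) (β γ : ℝ) : MeshOp 3 :=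
  sN h + β • sbarN2 h + γ • sbarN3 h

/-- `Ā_N^{(3)}` for `n = 3`. -/
def AbarN3 (a h : Fin 3 → ℝ) : MeshOp 3 :=
  -((1 / 12 ^ 2 * (a 0 ^ 2 * h 1 ^ 2 * h 2 ^ 2 + a 1 ^ 2 * h 0 ^ 2 * h 2 ^ 2
    + a 2 ^ 2 * h 0 ^ 2 * h 1 ^ 2) : ℝ) • (lam h 0 * lam h 1 * lam h 2))

/-- `A_{Nθ} = A_N + θ Ā_N^{(3)}` for `n = 3`. -/
def ANtheta (a h : Fin 3 → ℝ) (θ : ℝ) : MeshOp 3 := AN a h + θ • AbarN3 a h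

/-! ### Difference operators in time; `y m` is the value at the time level `m` -/

/-- The backward difference quotient at the level `m ≥ 1`. -/
def deltaBar {n : ℕ} (ht : ℝ) (y : ℕ → MeshFn n) (m : ℕ) : MeshFn n :=
  fun k => (y m k - y (m - 1) k) / ht

/-- The forward difference quotient. -/
def deltaFwd {n : ℕ} (ht : ℝ) (y : ℕ → MeshFn n) (m : ℕ) : MeshFn n :=
  fun k => (y (m + 1) k - y m k) / ht

/-- The backward average at the level `m ≥ 1`. -/
def sBar {n : ℕ} (y : ℕ → MeshFn n) (m : ℕ) : MeshFn n :=
  fun k => (y (m - 1) k + y m k) / 2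

/-- The second difference `Λ_t` at the level `m ≥ 1`. -/
def lamT {n : ℕ} (ht : ℝ) (y : ℕ → MeshFn n) (m : ℕ) : MeshFn n :=
  fun k => (y (m + 1) k - 2 * y m k + y (m - 1) k) / ht ^ 2

/-! ### The initial-boundary value problem -/

/-- The open box `Ω = (0, X_1) × ⋯ × (0, X_n)`. -/
def openBox {n : ℕ} (X : Fin n → ℝ) : Set (Fin n → ℝ) := Set.univ.pi fun i => Set.Ioo 0 (X i)

/-- The closed box. -/
def closedBox {n : ℕ} (X : Fin n → ℝ) : Set (Fin n → ℝ) := Set.univ.pi fun i => Set.Icc 0 (X i)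

/-- `u` solves
`ρ ∂_t² u - (a_1² ∂_1² + ⋯ + a_n² ∂_n²) u = f` in `Ω × (0,T)`, `u = g` on the lateral boundary,
`u = u0` and `∂_t u = u1` at `t = 0`. -/
structure IsSolution {n : ℕ} (X a : Fin n → ℝ) (T : ℝ) (ρ : (Fin n → ℝ) → ℝ)
    (f g : (Fin n → ℝ) → ℝ → ℝ) (u0 u1 : (Fin n → ℝ) → ℝ) (u : (Fin n → ℝ) → ℝ → ℝ) : Prop where
  pde : ∀ x ∈ openBox X, ∀ t ∈ Set.Ioo 0 T,
    ρ x * iteratedDeriv 2 (fun s => u x s) t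
      - ∑ i, a i ^ 2 * iteratedDeriv 2 (fun s => u (Function.update x i s) t) (x i) = f x t
  boundary : ∀ x ∈ closedBox X \ openBox X, ∀ t ∈ Set.Icc 0 T, u x t = g x t
  initial : ∀ x ∈ closedBox X, u x 0 = u0 x
  initial_deriv : ∀ x ∈ closedBox X, derivWithin (fun s => u x s) (Set.Icc 0 T) 0 = u1 x

/-- `u` and its derivatives of order at most `K` are continuous up to the boundary of
`Ω × (0,T)`. -/
def SmoothInTimeSpace {n : ℕ} (K : ℕ) (X : Fin n → ℝ) (T : ℝ) (u : (Fin n → ℝ) → ℝ → ℝ) : Prop :=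
  ContDiffOn ℝ (K : WithTop ℕ∞) (fun p : (Fin n → ℝ) × ℝ => u p.1 p.2)
    (closedBox X ×ˢ Set.Icc 0 T)

/-! ### The right-hand sides of the schemes -/

/-- A function of `(x,t)` on the time levels `t_m = m h_t`, restricted to the spatial mesh. -/
def sampleT {n : ℕ} (h : Fin n → ℝ) (ht : ℝ) (φ : (Fin n → ℝ) → ℝ → ℝ) (m : ℕ) : MeshFn n :=
  sample h fun x => φ x ((m : ℝ) * ht)

/-- `f_N = s_N f + (1/12) h_t² Λ_t f` at the level `m ≥ 1`. -/
def fN {n : ℕ} (h : Fin n → ℝ) (ht : ℝ) (f : (Fin n → ℝ) → ℝ → ℝ) (m : ℕ) : MeshFn n :=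
  sN h (sampleT h ht f m) + (1 / 12 * ht ^ 2 : ℝ) • lamT ht (sampleT h ht f) m

/-- `u_{1N} = s_N (ρ u_1) + (1/12) h_t² (a_1² Λ_1 + ⋯ + a_n² Λ_n) u_1`. -/
def u1N {n : ℕ} (a h : Fin n → ℝ) (ht : ℝ) (ρ u1 : (Fin n → ℝ) → ℝ) : MeshFn n :=
  sN h (sample h ρ * sample h u1)
    + (1 / 12 * ht ^ 2 : ℝ) • (∑ i, a i ^ 2 • lam h i) (sample h u1)

/-- `f_d^{(0)} = f_0 + (1/3) h_t (∂_t f)_0 + (1/12) h_t² (∂_t² f)_0` (one-sided derivatives at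
`t = 0`). -/
def fd0 {n : ℕ} (T ht : ℝ) (f : (Fin n → ℝ) → ℝ → ℝ) (x : Fin n → ℝ) : ℝ :=
  f x 0 + 1 / 3 * ht * derivWithin (f x) (Set.Icc 0 T) 0
    + 1 / 12 * ht ^ 2 * iteratedDerivWithin 2 (f x) (Set.Icc 0 T) 0

/-- `f_N^0 = fd + (1/12) (h_1² Λ_1 + ⋯ + h_n² Λ_n) f_0`, where `fd` approximates `f_d^{(0)}`. -/
def fN0 {n : ℕ} (h : Fin n → ℝ) (f : (Fin n → ℝ) → ℝ → ℝ) (fd : MeshFn n) : MeshFn n :=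
  fd + (1 / 12 : ℝ) • (∑ i, h i ^ 2 • lam h i) (sample h fun x => f x 0)

/-! ### The schemes -/

/-- The three compact schemes (with the parameters `β`, `γ`, `θ`) and the dimensions in which they
are considered. -/
inductive CompactScheme : ℕ → Type
  | first (β : ℝ) : CompactScheme 2
  | second (β γ θ : ℝ) : CompactScheme 3
  | third (n : ℕ) : CompactScheme n

/-- The operator `B_h` of the scheme. -/
def CompactScheme.B : {n : ℕ} → CompactScheme n → (Fin n → ℝ) → MeshOp n
  | _, .first β, h => sNbeta h β
  | _, .second β γ _, h => sNbetagamma h β γ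
  | _, .third _, h => sbarN h

/-- The operator `A_h` of the scheme. -/
def CompactScheme.A : {n : ℕ} → CompactScheme n → (a h : Fin n → ℝ) → MeshOp n
  | _, .first _, a, h => AN a h
  | _, .second _ _ θ, a, h => ANtheta a h θ
  | _, .third _, a, h => AbarN a h

/-- The positivity and stability conditions. First and second schemes: `B_h > 0`, `A_h > 0` and
`A_h ≤ α² B_h` in `H_h` with some `α` such that `(1/6) h_t² α² ≤ (1 - ε0²) ρlow`.
Third scheme: `h_t² (a_1²/h_1² + ⋯ + a_n²/h_n²) ≤ (1 - ε0²) ρlow`. -/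
def CompactScheme.Stable : {n : ℕ} → CompactScheme n → (a h : Fin n → ℝ) → (N : Fin n → ℕ) →
    (ht ε0 ρlow : ℝ) → Prop
  | _, .first β, a, h, N, ht, ε0, ρlow =>
      PosOp h N (sNbeta h β) ∧ PosOp h N (AN a h) ∧
      ∃ α : ℝ, LeOp h N (AN a h) (α ^ 2 • sNbeta h β) ∧
        1 / 6 * ht ^ 2 * α ^ 2 ≤ (1 - ε0 ^ 2) * ρlow
  | _, .second β γ θ, a, h, N, ht, ε0, ρlow =>
      PosOp h N (sNbetagamma h β γ) ∧ PosOp h N (ANtheta a h θ) ∧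
      ∃ α : ℝ, LeOp h N (ANtheta a h θ) (α ^ 2 • sNbetagamma h β γ) ∧
        1 / 6 * ht ^ 2 * α ^ 2 ≤ (1 - ε0 ^ 2) * ρlow
  | _, .third _, a, h, _, ht, ε0, ρlow =>
      ht ^ 2 * ∑ i, a i ^ 2 / h i ^ 2 ≤ (1 - ε0 ^ 2) * ρlow

/-- The admissible values of `ε2`: `ε2 = 1` for the first and third schemes and
`0 < ε2 ≤ θ ≤ 1` for the second one. -/
def CompactScheme.AdmissibleEps : {n : ℕ} → CompactScheme n → ℝ → Prop
  | _, .first _, ε2 => ε2 = 1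
  | _, .second _ _ θ, ε2 => 0 < ε2 ∧ ε2 ≤ θ ∧ θ ≤ 1
  | _, .third _, ε2 => ε2 = 1

/-- `v` solves the scheme with the operators `B`, `A` on the mesh with the steps `h`, `ht`, with the
data `f`, `g`, `u0`, `u1` and the approximation `fd` of `f_d^{(0)}`. -/
structure SolvesScheme {n : ℕ} (B A : MeshOp n) (a h : Fin n → ℝ) (N : Fin n → ℕ) (ht : ℝ) (M : ℕ)
    (ρ : (Fin n → ℝ) → ℝ) (f g : (Fin n → ℝ) → ℝ → ℝ) (u0 u1 : (Fin n → ℝ) → ℝ) (fd : MeshFn n)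
    (v : ℕ → MeshFn n) : Prop where
  main : ∀ m, 1 ≤ m → m ≤ M - 1 → ∀ k ∈ innerNodes N,
    B (sample h ρ * lamT ht v m) k + 1 / 12 * ht ^ 2 * A (lamT ht v m) k + A (v m) k
      = fN h ht f m k
  boundary : ∀ m, 1 ≤ m → m ≤ M → ∀ k ∈ boundaryNodes N, v m k = sampleT h ht g m k
  first_step : ∀ k ∈ innerNodes N,
    B (sample h ρ * deltaFwd ht v 0) k + 1 / 12 * ht ^ 2 * A (deltaFwd ht v 0) k
        + 1 / 2 * ht * A (v 0) k
      = u1N a h ht ρ u1 k + 1 / 2 * ht * fN0 h f fd k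
  initial : ∀ k ∈ closedNodes N, v 0 k = sample h u0 k

/-- The Euclidean length of the vector `(h_1, …, h_n, h_t)` of all the steps. -/
def stepSize {n : ℕ} (h : Fin n → ℝ) (ht : ℝ) : ℝ := Real.sqrt (∑ i, h i ^ 2 + ht ^ 2)

end

end CompactWave

open CompactWave

namespace CompactWave

/-! ### Taylor's formula along a segment -/

/-! The error `e = u - v` vanishes at `t = 0` and on the boundary and satisfies the equations of the
scheme with the truncation error of `u` on the right. So (a) is stability plus fourth order
consistency.

Stability. Once their values at non-inner nodes are dropped (`projLam`), the second differences act
in `H_h`, are symmetric there and commute. Hence they have a common orthonormal eigenbasis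
(`exists_mesh_eigenbasis`), in which `A_h` and `B_h` act as the polynomials `polyA` and `polyB` of
eigenvalues `x_l ∈ [-4/h_l², 0]` (`CompactScheme.exists_diagonalization`). Multiplication `R` by `ρ`
is not diagonal in this basis and `B R` need not be symmetric. But `B ≥ ν0` can be inverted, and `Q
= B⁻¹ A` is again symmetric and nonnegative. In `R Λ_t y + (h_t²/12) Q Λ_t y + Q y = φ` write `y^m`
as `(y^{m+1} + 2 y^m + y^{m-1})/4 - (h_t²/4) Λ_t y` and test with `y^{m+1} - y^{m-1}`. The energy
`⟨(R - (h_t²/6) Q) δ̄_t y, δ̄_t y⟩ + ⟨Q s̄_t y, s̄_t y⟩` then changes through `φ` only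
(`energy_step`). The stability condition is `(h_t²/6) Q ≤ (1 - ε0²) R`, so this energy dominates
`ε0² ‖√ρ δ̄_t y‖²`, and its square root grows by at most a constant times `h_t max ‖φ‖` per step
(`energy_bound`). Finally `A ≤ ν Q` returns to the norm of `A_h` (`stability_of_common_eigenbasis`,
`mesh_stability`).

Consistency. `B_h - s_N` and `A_h - A_N` consist of terms with at least two factors `h_i² Λ_i / 12`,
hence are of fourth order on smooth functions. For `s_N` and `A_N` the mechanism is Numerov's: `Λ_l
u = ∂_l² u + (h_l²/12) Λ_l ∂_l² u + O(h_l⁴)`, and the same in time. The correction terms are exactly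
those produced on the right by `s_N f + (h_t²/12) Λ_t f` after `f` is replaced by `∂_t²(ρ u) - ∑
a_l² ∂_l² u`. Both `u` and `ρ u` are treated as smooth functions of `(x, t)` on one closed box.
Every mixed estimate iterates one-dimensional Taylor bounds, because differences commute with
derivatives (`Tower.secondDiff`, `Tower.forwardDiff`). This gives `exists_main_error_le` and
`exists_first_error_le`. At most three second differences are taken, so six derivatives suffice.

For (b), the eigenvalue of `A_h` is `∑ a_i² p_i (-x_i)` with weights `p_i` built from the factors `1
+ h_k² x_k / 12 ∈ [2/3, 1]`, `k ≠ i`. In each scheme `p_i ≥ ε2 (2/3)^(n-1)`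
(`CompactScheme.le_polyA`). -/

theorem abs_sub_taylor_le {h C : ℝ} (m : ℕ) (hC : 0 ≤ C) (G : ℕ → ℝ → ℝ)
    (hG : ∀ j < m, ∀ s ∈ Set.Icc 0 h, HasDerivWithinAt (G j) (G (j + 1) s) (Set.Icc 0 h) s)
    (hb : ∀ s ∈ Set.Icc 0 h, |G m s| ≤ C) :
    ∀ s ∈ Set.Icc 0 h,
      |G 0 s - ∑ j ∈ Finset.range m, s ^ j / (j.factorial : ℝ) * G j 0| ≤ C * s ^ m := by
  induction m generalizing G with
  | zero => intro s hs; simpa using hb s hs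
  | succ m ih =>
    intro S hS
    have ih' := ih (fun j => G (j + 1)) (fun j hj => hG (j + 1) (by omega)) hb
    have hsub : Set.Icc 0 S ⊆ Set.Icc 0 h := Set.Icc_subset_Icc_right hS.2
    have hpoly : ∀ s : ℝ, HasDerivAt
        (fun s => ∑ j ∈ Finset.range (m + 1), s ^ j / (j.factorial : ℝ) * G j 0)
        (∑ j ∈ Finset.range m, s ^ j / (j.factorial : ℝ) * G (j + 1) 0) s := by
      intro s
      have : (fun s : ℝ => ∑ j ∈ Finset.range (m + 1), s ^ j / (j.factorial : ℝ) * G j 0)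
          = fun s => (∑ j ∈ Finset.range m,
            s ^ (j + 1) / ((j + 1).factorial : ℝ) * G (j + 1) 0) + G 0 0 := by
        funext s
        rw [Finset.sum_range_succ']
        simp
      rw [this]
      refine HasDerivAt.add_const _ (HasDerivAt.fun_sum fun j _ => ?_)
      have h1 := ((hasDerivAt_pow (j + 1) s).div_const ((j + 1).factorial : ℝ)).mul_const
        (G (j + 1) 0)
      refine h1.congr_deriv ?_
      rw [Nat.factorial_succ]
      have : (j.factorial : ℝ) ≠ 0 := by positivity
      push_cast
      field_simp
    -- The derivative of the remainder is the remainder of order `m` of the shifted family, at most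
    -- `C * S ^ m` on the whole segment. The factorial of the classical remainder is given away,
    -- since only the order matters.
    have key := norm_image_sub_le_of_norm_deriv_le_segment' (a := 0) (b := S) (C := C * S ^ m)
      (f := fun s => G 0 s - ∑ j ∈ Finset.range (m + 1), s ^ j / (j.factorial : ℝ) * G j 0)
      (f' := fun s => G 1 s - ∑ j ∈ Finset.range m, s ^ j / (j.factorial : ℝ) * G (j + 1) 0)
      (fun s hs => ((hG 0 (by omega) s (hsub hs)).mono hsub).sub (hpoly s).hasDerivWithinAt)
      (fun s hs => (ih' s (hsub (Set.Ico_subset_Icc_self hs))).trans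
        (mul_le_mul_of_nonneg_left (pow_le_pow_left₀ hs.1 hs.2.le m) hC)) S ⟨hS.1, le_rfl⟩
    have h0 : G 0 0 - ∑ j ∈ Finset.range (m + 1), (0 : ℝ) ^ j / (j.factorial : ℝ) * G j 0 = 0 := by
      rw [Finset.sum_range_succ']
      simp
    simp only [h0, sub_zero, Real.norm_eq_abs] at key
    calc _ ≤ C * S ^ m * S := key
      _ = C * S ^ (m + 1) := by ring

/-! ### Functions with successive derivatives along the coordinate lines of a box -/

section Tower

variable {ι : Type*} [DecidableEq ι]

/-- On the box `[lo, hi]`, `G (j + 1)` is the derivative of `G j` in the direction `d`, for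
`j < m`. -/
def Tower (d : ι) (m : ℕ) (lo hi : ι → ℝ) (G : ℕ → (ι → ℝ) → ℝ) : Prop :=
  ∀ j < m, ∀ p ∈ Set.Icc lo hi,
    HasDerivWithinAt (fun s : ℝ => G j (p + Pi.single d s)) (G (j + 1) p)
      {s | p + Pi.single d s ∈ Set.Icc lo hi} 0

/-- Undivided second difference in the direction `d` with the step `r`. -/
def secondDiff (d : ι) (r : ℝ) (w : (ι → ℝ) → ℝ) : (ι → ℝ) → ℝ :=
  fun p => w (p + Pi.single d r) - 2 * w p + w (p - Pi.single d r)

/-- Undivided forward difference in the direction `d` with the step `r`. -/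
def forwardDiff (d : ι) (r : ℝ) (w : (ι → ℝ) → ℝ) : (ι → ℝ) → ℝ :=
  fun p => w (p + Pi.single d r) - w p

theorem add_single_mem {d : ι} {r s : ℝ} {lo hi p : ι → ℝ} (hp : p ∈ Set.Icc lo hi)
    (hr : p + Pi.single d r ∈ Set.Icc lo hi) (h0 : 0 ≤ s) (hs : s ≤ r) :
    p + Pi.single d s ∈ Set.Icc lo hi := by
  refine ⟨fun i => ?_, fun i => ?_⟩
  · refine (hp.1 i).trans ?_
    simp only [Pi.add_apply, Pi.single_apply]
    split_ifs <;> linarith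
  · refine le_trans ?_ (hr.2 i)
    simp only [Pi.add_apply, Pi.single_apply]
    split_ifs <;> linarith

theorem sub_single_eq (p : ι → ℝ) (d : ι) (r : ℝ) :
    p - Pi.single d r = p + Pi.single d (-r) := by
  rw [Pi.single_neg, sub_eq_add_neg]

theorem mem_of_shrink {d : ι} {r : ℝ} (hr : 0 ≤ r) {lo hi p : ι → ℝ}
    (hp : p ∈ Set.Icc (lo + Pi.single d r) (hi - Pi.single d r)) :
    p ∈ Set.Icc lo hi ∧ p + Pi.single d r ∈ Set.Icc lo hi ∧ p - Pi.single d r ∈ Set.Icc lo hi := by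
  have h1 : ∀ i, 0 ≤ (Pi.single d r : ι → ℝ) i := fun i => by
    simp only [Pi.single_apply]; split_ifs <;> simp [hr]
  have h2 := hp.1
  have h3 := hp.2
  refine ⟨⟨fun i => ?_, fun i => ?_⟩, ⟨fun i => ?_, fun i => ?_⟩, ⟨fun i => ?_, fun i => ?_⟩⟩ <;>
  · have a1 := h1 i
    have a2 := h2 i
    have a3 := h3 i
    simp only [Pi.add_apply, Pi.sub_apply] at a2 a3 ⊢
    linarith

theorem mem_of_shrink_right {d : ι} {r : ℝ} (hr : 0 ≤ r) {lo hi p : ι → ℝ}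
    (hp : p ∈ Set.Icc lo (hi - Pi.single d r)) :
    p ∈ Set.Icc lo hi ∧ p + Pi.single d r ∈ Set.Icc lo hi := by
  have h1 : ∀ i, 0 ≤ (Pi.single d r : ι → ℝ) i := fun i => by
    simp only [Pi.single_apply]; split_ifs <;> simp [hr]
  have h2 := hp.1
  have h3 := hp.2
  refine ⟨⟨fun i => ?_, fun i => ?_⟩, ⟨fun i => ?_, fun i => ?_⟩⟩ <;>
  · have a1 := h1 i
    have a2 := h2 i
    have a3 := h3 i
    simp only [Pi.add_apply, Pi.sub_apply] at a2 a3 ⊢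
    linarith

theorem Tower.shift {d : ι} {m : ℕ} {lo hi : ι → ℝ} {G : ℕ → (ι → ℝ) → ℝ} (c : ℕ)
    (hG : Tower d (m + c) lo hi G) : Tower d m lo hi fun j => G (j + c) := by
  intro j hj p hp
  have := hG (j + c) (by omega) p hp
  rwa [show j + c + 1 = j + 1 + c by ring] at this

/-- Chain rule along `s ↦ p + σ s` in the direction `d`. The values `σ = 1` and `σ = -1` serve the
forward and the backward neighbour, so one Taylor estimate covers both. -/
theorem Tower.neg_dir_segment {d : ι} {m : ℕ} {lo hi : ι → ℝ} {G : ℕ → (ι → ℝ) → ℝ}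
    (hG : Tower d m lo hi G) {σ r : ℝ} {p : ι → ℝ}
    (hp : ∀ s ∈ Set.Icc 0 r, p + Pi.single d (σ * s) ∈ Set.Icc lo hi) :
    ∀ j < m, ∀ s ∈ Set.Icc 0 r, HasDerivWithinAt
      (fun s => σ ^ j * G j (p + Pi.single d (σ * s)))
      (σ ^ (j + 1) * G (j + 1) (p + Pi.single d (σ * s))) (Set.Icc 0 r) s := by
  intro j hj s hs
  have h1 := hG j hj _ (hp s hs)
  have h2 : HasDerivWithinAt (fun t : ℝ => σ * (t - s)) σ (Set.Icc 0 r) s := by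
    simpa using (((hasDerivAt_id s).sub_const s).const_mul σ).hasDerivWithinAt (s := Set.Icc 0 r)
  have h3 := HasDerivWithinAt.comp (h := fun t : ℝ => σ * (t - s)) s
    (by simpa using h1) h2 (by
      intro t ht
      change p + Pi.single d (σ * s) + Pi.single d (σ * (t - s)) ∈ Set.Icc lo hi
      rw [add_assoc, ← Pi.single_add, show σ * s + σ * (t - s) = σ * t by ring]
      exact hp t ht)
  refine ((h3.const_mul (σ ^ j)).congr_deriv (by ring)).congr_of_mem (fun t _ => ?_) hs
  simp only [Function.comp]
  rw [add_assoc, ← Pi.single_add, show σ * s + σ * (t - s) = σ * t by ring]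

theorem Tower.abs_taylor_le {d : ι} {m : ℕ} {lo hi : ι → ℝ} {G : ℕ → (ι → ℝ) → ℝ}
    (hG : Tower d m lo hi G) {C σ r : ℝ} (hσ : |σ| ≤ 1) (hr : 0 ≤ r)
    (hb : ∀ p ∈ Set.Icc lo hi, |G m p| ≤ C) {p : ι → ℝ}
    (hp : ∀ s ∈ Set.Icc 0 r, p + Pi.single d (σ * s) ∈ Set.Icc lo hi) :
    |G 0 (p + Pi.single d (σ * r)) - ∑ j ∈ Finset.range m,
      (σ * r) ^ j / (j.factorial : ℝ) * G j p| ≤ C * r ^ m := by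
  have hC : 0 ≤ C := (abs_nonneg _).trans (hb _ (hp 0 ⟨le_rfl, hr⟩))
  have := abs_sub_taylor_le m hC _ (hG.neg_dir_segment hp) (fun s hs => by
    rw [abs_mul, abs_pow]
    exact (mul_le_of_le_one_left (abs_nonneg _) (pow_le_one₀ (abs_nonneg _) hσ)).trans
      (hb _ (hp s hs))) r ⟨hr, le_rfl⟩
  convert this using 3
  · simp
  · refine Finset.sum_congr rfl fun j _ => ?_
    simp only [mul_zero, Pi.single_zero, add_zero, mul_pow]
    ring

theorem Tower.abs_forward_le {d : ι} {m : ℕ} {lo hi : ι → ℝ} {G : ℕ → (ι → ℝ) → ℝ}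
    (hG : Tower d m lo hi G) {C r : ℝ} (hr : 0 ≤ r) (hb : ∀ p ∈ Set.Icc lo hi, |G m p| ≤ C)
    {p : ι → ℝ} (hp : p ∈ Set.Icc lo (hi - Pi.single d r)) :
    |G 0 (p + Pi.single d r) - ∑ j ∈ Finset.range m, r ^ j / (j.factorial : ℝ) * G j p|
      ≤ C * r ^ m := by
  obtain ⟨h0, h1⟩ := mem_of_shrink_right hr hp
  simpa using hG.abs_taylor_le (σ := 1) (by simp) hr hb (p := p) (fun s hs => by
    simpa using add_single_mem h0 h1 hs.1 hs.2)

theorem Tower.abs_backward_le {d : ι} {m : ℕ} {lo hi : ι → ℝ} {G : ℕ → (ι → ℝ) → ℝ}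
    (hG : Tower d m lo hi G) {C r : ℝ} (hr : 0 ≤ r) (hb : ∀ p ∈ Set.Icc lo hi, |G m p| ≤ C)
    {p : ι → ℝ} (hp : p ∈ Set.Icc (lo + Pi.single d r) (hi - Pi.single d r)) :
    |G 0 (p - Pi.single d r) - ∑ j ∈ Finset.range m, (-r) ^ j / (j.factorial : ℝ) * G j p|
      ≤ C * r ^ m := by
  obtain ⟨h0, h1, h2⟩ := mem_of_shrink hr hp
  have := hG.abs_taylor_le (σ := -1) (by simp) hr hb (p := p) (fun s hs => by
    have h3 := add_single_mem (d := d) (p := p - Pi.single d r) (r := r) (s := r - s)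
      h2 (by simpa using h0) (by linarith [hs.2]) (by linarith [hs.1])
    rw [sub_single_eq, add_assoc, ← Pi.single_add] at h3
    rwa [show -r + (r - s) = -1 * s by ring] at h3)
  rw [sub_single_eq]
  simpa using this

theorem Tower.secondDiff_le {d : ι} {lo hi : ι → ℝ} {G : ℕ → (ι → ℝ) → ℝ}
    (hG : Tower d 2 lo hi G) {C r : ℝ} (hr : 0 ≤ r) (hb : ∀ p ∈ Set.Icc lo hi, |G 2 p| ≤ C)
    {p : ι → ℝ} (hp : p ∈ Set.Icc (lo + Pi.single d r) (hi - Pi.single d r)) :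
    |secondDiff d r (G 0) p| ≤ 2 * C * r ^ 2 := by
  have hp' : p ∈ Set.Icc lo (hi - Pi.single d r) := ⟨(mem_of_shrink hr hp).1.1, hp.2⟩
  have h1 := hG.abs_forward_le hr hb hp'
  have h2 := hG.abs_backward_le hr hb hp
  simp only [Finset.sum_range_succ, Finset.range_zero, Finset.sum_empty] at h1 h2
  norm_num [Nat.factorial] at h1 h2
  unfold secondDiff
  rw [abs_le] at *
  constructor <;> linarith [h1.1, h1.2, h2.1, h2.2]

theorem Tower.secondDiff_sub_le {d : ι} {lo hi : ι → ℝ} {G : ℕ → (ι → ℝ) → ℝ}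
    (hG : Tower d 4 lo hi G) {C r : ℝ} (hr : 0 ≤ r) (hb : ∀ p ∈ Set.Icc lo hi, |G 4 p| ≤ C)
    {p : ι → ℝ} (hp : p ∈ Set.Icc (lo + Pi.single d r) (hi - Pi.single d r)) :
    |secondDiff d r (G 0) p - r ^ 2 * G 2 p| ≤ 2 * C * r ^ 4 := by
  have hp' : p ∈ Set.Icc lo (hi - Pi.single d r) := ⟨(mem_of_shrink hr hp).1.1, hp.2⟩
  have h1 := hG.abs_forward_le hr hb hp'
  have h2 := hG.abs_backward_le hr hb hp
  simp only [Finset.sum_range_succ, Finset.range_zero, Finset.sum_empty] at h1 h2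
  norm_num [Nat.factorial] at h1 h2
  unfold secondDiff
  rw [abs_le] at *
  constructor <;> linarith [h1.1, h1.2, h2.1, h2.2]

/-- The term `r⁴/12 · G 4` of the Taylor expansion is traded for `r²/12` times a second difference
of `G 2`, at a cost of order `r⁶`. This is the source of the fourth order of compact schemes. Of the
constant 3, the two Taylor remainders take 2 and the trade takes less than 1. -/
theorem Tower.secondDiff_sub_sub_le {d : ι} {lo hi : ι → ℝ} {G : ℕ → (ι → ℝ) → ℝ}
    (hG : Tower d 6 lo hi G) {C r : ℝ} (hr : 0 ≤ r) (hb : ∀ p ∈ Set.Icc lo hi, |G 6 p| ≤ C)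
    {p : ι → ℝ} (hp : p ∈ Set.Icc (lo + Pi.single d r) (hi - Pi.single d r)) :
    |secondDiff d r (G 0) p - r ^ 2 * G 2 p - r ^ 2 / 12 * secondDiff d r (G 2) p|
      ≤ 3 * C * r ^ 6 := by
  have hp' : p ∈ Set.Icc lo (hi - Pi.single d r) := ⟨(mem_of_shrink hr hp).1.1, hp.2⟩
  have h1 := hG.abs_forward_le hr hb hp'
  have h2 := hG.abs_backward_le hr hb hp
  have h3 := (hG.shift (m := 4) 2).secondDiff_sub_le hr hb hp
  simp only [Nat.zero_add, Nat.reduceAdd] at h3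
  have h4 : |r ^ 2 / 12 * (secondDiff d r (G 2) p - r ^ 2 * G 4 p)| ≤ C * r ^ 6 := by
    rw [abs_mul, abs_of_nonneg (by positivity)]
    calc _ ≤ r ^ 2 / 12 * (2 * C * r ^ 4) := by gcongr
      _ ≤ C * r ^ 6 := by
        have hC : 0 ≤ C := (abs_nonneg _).trans (hb p (mem_of_shrink hr hp).1)
        have : 0 ≤ C * r ^ 6 := by positivity
        nlinarith
  simp only [Finset.sum_range_succ, Finset.range_zero, Finset.sum_empty] at h1 h2
  norm_num [Nat.factorial] at h1 h2
  unfold secondDiff at *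
  rw [abs_le] at *
  constructor <;> linarith [h1.1, h1.2, h2.1, h2.2, h4.1, h4.2]

theorem Tower.of_le {d : ι} {m m' : ℕ} {lo hi : ι → ℝ} {G : ℕ → (ι → ℝ) → ℝ}
    (hG : Tower d m lo hi G) (hm : m' ≤ m) : Tower d m' lo hi G :=
  fun j hj => hG j (hj.trans_le hm)

/-- Translations commute with derivatives. The box shrinks by `r` at both ends so that all three
points of the stencil remain in the original one. Estimates in one direction thus apply to functions
already differenced in another, and no multivariate Taylor formula is needed. -/
theorem Tower.secondDiff {d b : ι} {m : ℕ} {lo hi : ι → ℝ} {G : ℕ → (ι → ℝ) → ℝ} {r : ℝ}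
    (hr : 0 ≤ r) (hG : Tower d m lo hi G) :
    Tower d m (lo + Pi.single b r) (hi - Pi.single b r) fun j => secondDiff b r (G j) := by
  intro j hj p hp
  obtain ⟨h0, h1, h2⟩ := mem_of_shrink hr hp
  have e0 := (hG j hj _ h0).mono (s := {s | p + Pi.single d s
    ∈ Set.Icc (lo + Pi.single b r) (hi - Pi.single b r)}) fun s hs => (mem_of_shrink hr hs).1
  have e1 := (hG j hj _ h1).mono (s := {s | p + Pi.single d s
    ∈ Set.Icc (lo + Pi.single b r) (hi - Pi.single b r)}) fun s hs => by
      have := (mem_of_shrink hr hs).2.1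
      change _ ∈ Set.Icc lo hi
      rwa [add_right_comm]
  have e2 := (hG j hj _ h2).mono (s := {s | p + Pi.single d s
    ∈ Set.Icc (lo + Pi.single b r) (hi - Pi.single b r)}) fun s hs => by
      have := (mem_of_shrink hr hs).2.2
      change _ ∈ Set.Icc lo hi
      rwa [sub_add_eq_add_sub]
  refine ((e1.sub (e0.const_mul 2)).add e2).congr_of_mem (fun s _ => ?_) (by simpa using hp)
  simp only [CompactWave.secondDiff, Pi.add_apply, Pi.sub_apply]
  rw [add_right_comm, sub_add_eq_add_sub p]

theorem Tower.forwardDiff {d b : ι} {m : ℕ} {lo hi : ι → ℝ} {G : ℕ → (ι → ℝ) → ℝ} {r : ℝ}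
    (hr : 0 ≤ r) (hG : Tower d m lo hi G) :
    Tower d m lo (hi - Pi.single b r) fun j => forwardDiff b r (G j) := by
  intro j hj p hp
  obtain ⟨h0, h1⟩ := mem_of_shrink_right hr hp
  have e0 := (hG j hj _ h0).mono (s := {s | p + Pi.single d s
    ∈ Set.Icc lo (hi - Pi.single b r)}) fun s hs => (mem_of_shrink_right hr hs).1
  have e1 := (hG j hj _ h1).mono (s := {s | p + Pi.single d s
    ∈ Set.Icc lo (hi - Pi.single b r)}) fun s hs => by
      have := (mem_of_shrink_right hr hs).2
      change _ ∈ Set.Icc lo hi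
      rwa [add_right_comm]
  refine (e1.sub e0).congr_of_mem (fun s _ => ?_) (by simpa using hp)
  simp only [CompactWave.forwardDiff, Pi.sub_apply]
  rw [add_right_comm]

end Tower

/-! ### Partial derivatives up to the boundary of a box -/

section Partial

variable {ι : Type*}

theorem uniqueDiffOn_box {L : ι → ℝ} (hL : ∀ i, 0 < L i) : UniqueDiffOn ℝ (Set.Icc 0 L) := by
  rw [← Set.pi_univ_Icc]
  exact UniqueDiffOn.univ_pi fun i => uniqueDiffOn_Icc (hL i)

variable [DecidableEq ι]

/-- Partial derivative within the box `[0, L]`. -/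
noncomputable def boxDeriv (L : ι → ℝ) (d : ι) (w : (ι → ℝ) → ℝ) : (ι → ℝ) → ℝ :=
  fun p => fderivWithin ℝ w (Set.Icc 0 L) p (Pi.single d 1)

theorem boxDeriv_congr {L : ι → ℝ} {d : ι} {v w : (ι → ℝ) → ℝ} (h : Set.EqOn v w (Set.Icc 0 L)) :
    Set.EqOn (boxDeriv L d v) (boxDeriv L d w) (Set.Icc 0 L) := by
  intro p hp
  simp only [boxDeriv]
  rw [fderivWithin_congr h (h hp)]

variable [Fintype ι]

theorem ContDiffOn.boxDeriv {L : ι → ℝ} (hL : ∀ i, 0 < L i) (d : ι) {m : ℕ} {w : (ι → ℝ) → ℝ}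
    (hw : ContDiffOn ℝ ((m + 1 : ℕ) : WithTop ℕ∞) w (Set.Icc 0 L)) :
    ContDiffOn ℝ (m : WithTop ℕ∞) (boxDeriv L d w) (Set.Icc 0 L) :=
  (hw.fderivWithin (uniqueDiffOn_box hL) (by push_cast; rfl)).clm_apply contDiffOn_const

theorem ContDiffOn.boxDeriv_iterate {L : ι → ℝ} (hL : ∀ i, 0 < L i) (d : ι) {m : ℕ} (j : ℕ)
    {w : (ι → ℝ) → ℝ} (hw : ContDiffOn ℝ ((m + j : ℕ) : WithTop ℕ∞) w (Set.Icc 0 L)) :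
    ContDiffOn ℝ (m : WithTop ℕ∞) ((CompactWave.boxDeriv L d)^[j] w) (Set.Icc 0 L) := by
  induction j generalizing w with
  | zero => simpa using hw
  | succ j ih =>
    rw [Function.iterate_succ_apply]
    exact ih (ContDiffOn.boxDeriv hL d (by rwa [add_assoc]))

theorem tower_boxDeriv {L : ι → ℝ} (hL : ∀ i, 0 < L i) (d : ι) {m : ℕ} {w : (ι → ℝ) → ℝ}
    (hw : ContDiffOn ℝ (m : WithTop ℕ∞) w (Set.Icc 0 L)) :
    Tower d m 0 L fun j => (boxDeriv L d)^[j] w := by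
  intro j hj p hp
  have h1 : ContDiffOn ℝ ((1 : ℕ) : WithTop ℕ∞) ((boxDeriv L d)^[j] w) (Set.Icc 0 L) :=
    ContDiffOn.boxDeriv_iterate hL d j (hw.of_le (by exact_mod_cast (by omega : 1 + j ≤ m)))
  have h2 := (h1.differentiableOn (by simp) p hp).hasFDerivWithinAt
  have h3 : HasDerivWithinAt (fun s : ℝ => p + Pi.single d s) (Pi.single d (1 : ℝ))
      {s | p + Pi.single d s ∈ Set.Icc 0 L} 0 := by
    have : HasDerivAt (fun s : ℝ => p + Pi.single d s) (Pi.single d (1 : ℝ)) 0 := by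
      refine HasDerivAt.const_add _ ?_
      rw [hasDerivAt_pi]
      intro i
      by_cases h : i = d
      · subst h; simpa using hasDerivAt_id' (0 : ℝ)
      · simpa [Pi.single_apply, h] using hasDerivAt_const (0 : ℝ) (0 : ℝ)
    exact this.hasDerivWithinAt
  simp only [Function.iterate_succ_apply']
  exact HasFDerivWithinAt.comp_hasDerivWithinAt (t := Set.Icc 0 L) (0 : ℝ) (by simpa using h2) h3
    (fun s hs => hs)

/-- Symmetry of the second derivative persists at boundary points, because each point of the box is
a limit of interior points. -/
theorem boxDeriv_comm {L : ι → ℝ} (hL : ∀ i, 0 < L i) (d e : ι) {w : (ι → ℝ) → ℝ}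
    (hw : ContDiffOn ℝ ((2 : ℕ) : WithTop ℕ∞) w (Set.Icc 0 L)) :
    Set.EqOn (boxDeriv L d (boxDeriv L e w)) (boxDeriv L e (boxDeriv L d w)) (Set.Icc 0 L) := by
  intro p hp
  have hcl : p ∈ closure (interior (Set.Icc 0 L)) := by
    have hne : (interior (Set.Icc (0 : ι → ℝ) L)).Nonempty := by
      rw [← Set.pi_univ_Icc, interior_pi_set Set.finite_univ]
      exact ⟨fun i => L i / 2, fun i _ => by
        simp only [Pi.zero_apply, interior_Icc]
        exact ⟨by linarith [hL i], by linarith [hL i]⟩⟩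
    rw [(convex_Icc (𝕜 := ℝ) (0 : ι → ℝ) L).closure_interior_eq_closure_of_nonempty_interior hne]
    exact subset_closure hp
  have hs := (hw p hp).isSymmSndFDerivWithinAt (by simp) (uniqueDiffOn_box hL)
    hcl hp
  have hd : DifferentiableWithinAt ℝ (fderivWithin ℝ w (Set.Icc 0 L)) (Set.Icc 0 L) p :=
    ((hw.fderivWithin (m := 1) (uniqueDiffOn_box hL) (by norm_num)).differentiableOn (by simp)) p hp
  have key : ∀ d e : ι, boxDeriv L d (boxDeriv L e w) p
      = fderivWithin ℝ (fderivWithin ℝ w (Set.Icc 0 L)) (Set.Icc 0 L) p (Pi.single d 1)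
        (Pi.single e 1) := by
    intro d e
    have h1 : boxDeriv L e w = fun y => fderivWithin ℝ w (Set.Icc 0 L) y (Pi.single e 1) := rfl
    rw [h1]
    simp only [boxDeriv]
    rw [fderivWithin_clm_apply (uniqueDiffOn_box hL p hp) hd (differentiableWithinAt_const _)]
    simp
  rw [key, key]
  exact hs _ _

/-- All the partial derivatives of order at most `m` of a function of class `C^m` on the box have a
common bound. -/
theorem exists_bound_boxDeriv {L : ι → ℝ} (hL : ∀ i, 0 < L i) (m : ℕ) {w : (ι → ℝ) → ℝ}
    (hw : ContDiffOn ℝ (m : WithTop ℕ∞) w (Set.Icc 0 L)) :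
    ∃ M : ℝ, ∀ l : List ι, l.length ≤ m → ∀ p ∈ Set.Icc 0 L,
      |l.foldl (fun φ d => boxDeriv L d φ) w p| ≤ M := by
  induction m generalizing w with
  | zero =>
    obtain ⟨M, hM⟩ := isCompact_Icc.exists_bound_of_continuousOn hw.continuousOn
    refine ⟨M, fun l hl p hp => ?_⟩
    rw [List.length_eq_zero_iff.mp (Nat.le_zero.mp hl)]
    exact hM p hp
  | succ m ih =>
    obtain ⟨M, hM⟩ := isCompact_Icc.exists_bound_of_continuousOn hw.continuousOn
    choose B hB using fun d => ih (ContDiffOn.boxDeriv hL d hw)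
    refine ⟨|M| + ∑ d, |B d|, fun l hl p hp => ?_⟩
    have hs : ∀ d, |B d| ≤ ∑ d, |B d| := fun d =>
      Finset.single_le_sum (f := fun d => |B d|) (fun _ _ => abs_nonneg _) (Finset.mem_univ d)
    have hs0 : 0 ≤ ∑ d, |B d| := Finset.sum_nonneg fun _ _ => abs_nonneg _
    cases l with
    | nil =>
      have := hM p hp
      simp only [List.foldl_nil, Real.norm_eq_abs] at this ⊢
      linarith [le_abs_self M]
    | cons d l =>
      have := hB d l (by simpa using hl) p hp
      simp only [List.foldl_cons]
      linarith [le_abs_self (B d), hs d, abs_nonneg M]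

end Partial

open scoped InnerProductSpace

/-! ### Operators diagonal in an orthonormal basis -/

section Diagonal

variable {E κ : Type*} [NormedAddCommGroup E] [InnerProductSpace ℝ E] [Fintype κ]
  (b : OrthonormalBasis κ ℝ E)

theorem basis_inner_apply_of_diag {T : E →ₗ[ℝ] E} {c : κ → ℝ} (hT : ∀ j, T (b j) = c j • b j)
    (j : κ) (w : E) : ⟪b j, T w⟫_ℝ = c j * ⟪b j, w⟫_ℝ := by
  classical
  conv_lhs => rw [← b.sum_repr' w]
  rw [map_sum, inner_sum]
  simp only [map_smul, hT, inner_smul_right, b.inner_eq_ite]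
  simp [mul_comm]

theorem inner_apply_of_diag {T : E →ₗ[ℝ] E} {c : κ → ℝ} (hT : ∀ j, T (b j) = c j • b j)
    (v w : E) : ⟪T v, w⟫_ℝ = ∑ j, c j * (⟪b j, v⟫_ℝ * ⟪b j, w⟫_ℝ) := by
  rw [← b.sum_inner_mul_inner (T v) w]
  refine Finset.sum_congr rfl fun j _ => ?_
  rw [real_inner_comm, basis_inner_apply_of_diag b hT, mul_assoc]

theorem sum_sq_inner_basis (w : E) : ∑ j, ⟪b j, w⟫_ℝ * ⟪b j, w⟫_ℝ = ‖w‖ ^ 2 := by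
  rw [← real_inner_self_eq_norm_sq, ← b.sum_inner_mul_inner w w]
  exact Finset.sum_congr rfl fun j _ => by rw [real_inner_comm w]

theorem isSymmetric_of_diag {T : E →ₗ[ℝ] E} {c : κ → ℝ} (hT : ∀ j, T (b j) = c j • b j) :
    T.IsSymmetric := by
  intro v w
  rw [inner_apply_of_diag b hT, real_inner_comm, inner_apply_of_diag b hT]
  exact Finset.sum_congr rfl fun j _ => by ring

theorem norm_apply_le_of_diag {T : E →ₗ[ℝ] E} {c : κ → ℝ} (hT : ∀ j, T (b j) = c j • b j) {K : ℝ}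
    (hK : 0 ≤ K) (h : ∀ j, |c j| ≤ K) (w : E) : ‖T w‖ ≤ K * ‖w‖ := by
  refine le_of_sq_le_sq ?_ (by positivity)
  rw [mul_pow, ← sum_sq_inner_basis b, ← sum_sq_inner_basis b, Finset.mul_sum]
  refine Finset.sum_le_sum fun j _ => ?_
  rw [basis_inner_apply_of_diag b hT]
  have : c j ^ 2 ≤ K ^ 2 := sq_le_sq' (abs_le.mp (h j)).1 (abs_le.mp (h j)).2
  nlinarith [mul_self_nonneg ⟪b j, w⟫_ℝ]

end Diagonal

/-! ### The energy estimate -/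

section Energy

variable {E : Type*} [NormedAddCommGroup E] [InnerProductSpace ℝ E]

/-- Test the equation with `z - x`. Since `y = (z + 2y + x)/4 - (τ²/4) Λ_t y`, the coefficient of `A
Λ_t y` becomes `1/12 - 1/4 = -1/6`, which explains `D`. The `D` part and the averaged `A` part then
telescope by symmetry. The proof checks this by expanding all products. -/
theorem energy_step {D A R : E →ₗ[ℝ] E} (hA : A.IsSymmetric) (hR : R.IsSymmetric) {τ : ℝ}
    (hD : ∀ w, D w = R w - (τ ^ 2 / 6) • A w) (hτ : 0 < τ) {x y z φ : E}
    (h : R ((1 / τ ^ 2) • (z - (2 : ℝ) • y + x))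
      + (1 / 12 * τ ^ 2) • A ((1 / τ ^ 2) • (z - (2 : ℝ) • y + x)) + A y = φ) :
    ⟪D ((1 / τ) • (z - y)), (1 / τ) • (z - y)⟫_ℝ
        + ⟪A ((1 / 2 : ℝ) • (y + z)), (1 / 2 : ℝ) • (y + z)⟫_ℝ
      = ⟪D ((1 / τ) • (y - x)), (1 / τ) • (y - x)⟫_ℝ
        + ⟪A ((1 / 2 : ℝ) • (x + y)), (1 / 2 : ℝ) • (x + y)⟫_ℝ
        + τ * (⟪φ, (1 / τ) • (z - y)⟫_ℝ + ⟪φ, (1 / τ) • (y - x)⟫_ℝ) := by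
  subst h
  have a1 : ⟪A y, x⟫_ℝ = ⟪A x, y⟫_ℝ := by rw [hA y x, real_inner_comm]
  have a2 : ⟪A z, x⟫_ℝ = ⟪A x, z⟫_ℝ := by rw [hA z x, real_inner_comm]
  have a3 : ⟪A z, y⟫_ℝ = ⟪A y, z⟫_ℝ := by rw [hA z y, real_inner_comm]
  have r1 : ⟪R y, x⟫_ℝ = ⟪R x, y⟫_ℝ := by rw [hR y x, real_inner_comm]
  have r2 : ⟪R z, x⟫_ℝ = ⟪R x, z⟫_ℝ := by rw [hR z x, real_inner_comm]
  have r3 : ⟪R z, y⟫_ℝ = ⟪R y, z⟫_ℝ := by rw [hR z y, real_inner_comm]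
  simp only [hD, map_add, map_sub, map_smul, inner_add_left, inner_add_right, inner_sub_left,
    inner_sub_right, inner_smul_left, inner_smul_right, RCLike.conj_to_real, a1, a2, a3, r1, r2,
    r3]
  field_simp
  ring

/-- Coercivity gives `ε √r ‖d m‖ ≤ √(e m)`, so the work of `φ` over a step is at most `τ Φ / (ε √r)`
times the sum of the roots of the two energies. The roots therefore grow linearly in time. -/
theorem energy_bound {A R : E →ₗ[ℝ] E} (hA : A.IsSymmetric) (hR : R.IsSymmetric)
    {τ ε r Φ : ℝ} (hτ : 0 < τ) (hε : 0 < ε) (hr : 0 < r) (hA0 : ∀ w, 0 ≤ ⟪A w, w⟫_ℝ)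
    (hco : ∀ w, ε ^ 2 * ⟪R w, w⟫_ℝ ≤ ⟪R w, w⟫_ℝ - τ ^ 2 / 6 * ⟪A w, w⟫_ℝ)
    (hRr : ∀ w, r * ‖w‖ ^ 2 ≤ ⟪R w, w⟫_ℝ) {M : ℕ} {y φ : ℕ → E} (hy0 : y 0 = 0)
    (hmain : ∀ m, 1 ≤ m → m < M → R ((1 / τ ^ 2) • (y (m + 1) - (2 : ℝ) • y m + y (m - 1)))
      + (1 / 12 * τ ^ 2) • A ((1 / τ ^ 2) • (y (m + 1) - (2 : ℝ) • y m + y (m - 1))) + A (y m)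
        = φ m)
    (hfirst : R ((1 / τ) • (y 1 - y 0)) + (1 / 12 * τ ^ 2) • A ((1 / τ) • (y 1 - y 0)) = φ 0)
    (hφ : ∀ m < M, ‖φ m‖ ≤ Φ) :
    ∀ m, 1 ≤ m → m ≤ M →
      ε * √⟪R ((1 / τ) • (y m - y (m - 1))), (1 / τ) • (y m - y (m - 1))⟫_ℝ
          ≤ Φ / (ε * √r) * (1 + m * τ) ∧
        √⟪A ((1 / 2 : ℝ) • (y (m - 1) + y m)), (1 / 2 : ℝ) • (y (m - 1) + y m)⟫_ℝ
          ≤ Φ / (ε * √r) * (1 + m * τ) := by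
  set D : E →ₗ[ℝ] E := R - (τ ^ 2 / 6) • A with hDdef
  have hD : ∀ w, D w = R w - (τ ^ 2 / 6) • A w := fun w => by simp [hDdef]
  have hDin : ∀ w, ⟪D w, w⟫_ℝ = ⟪R w, w⟫_ℝ - τ ^ 2 / 6 * ⟪A w, w⟫_ℝ := fun w => by
    rw [hD, inner_sub_left, inner_smul_left]; rfl
  set d : ℕ → E := fun m => (1 / τ) • (y m - y (m - 1)) with hd
  set s : ℕ → E := fun m => (1 / 2 : ℝ) • (y (m - 1) + y m) with hs
  set e : ℕ → ℝ := fun m => ⟪D (d m), d m⟫_ℝ + ⟪A (s m), s m⟫_ℝ with he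
  have hDR : ∀ w, ε ^ 2 * ⟪R w, w⟫_ℝ ≤ ⟪D w, w⟫_ℝ := fun w => (hDin w).symm ▸ hco w
  have hR0 : ∀ w, 0 ≤ ⟪R w, w⟫_ℝ := fun w => le_trans (by positivity) (hRr w)
  have he0 : ∀ m, 0 ≤ e m := fun m =>
    add_nonneg (le_trans (mul_nonneg (sq_nonneg _) (hR0 _)) (hDR _)) (hA0 _)
  have hdn : ∀ m, ‖d m‖ ≤ √(e m) / (ε * √r) := by
    intro m
    rw [le_div_iff₀ (by positivity)]
    apply Real.le_sqrt_of_sq_le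
    have h1 := hDR (d m)
    have h2 := hRr (d m)
    have h3 := hA0 (s m)
    rw [mul_pow, mul_pow, Real.sq_sqrt hr.le]
    have h4 : ε ^ 2 * (r * ‖d m‖ ^ 2) ≤ ε ^ 2 * ⟪R (d m), d m⟫_ℝ :=
      mul_le_mul_of_nonneg_left h2 (sq_nonneg _)
    simp only [he]
    linarith
  have hΦ : ∀ m < M, ∀ w, ⟪φ m, w⟫_ℝ ≤ Φ * ‖w‖ := fun m hm w =>
    (real_inner_le_norm _ _).trans (mul_le_mul_of_nonneg_right (hφ m hm) (norm_nonneg _))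
  have hbound : ∀ m, 1 ≤ m → m ≤ M → √(e m) ≤ Φ / (ε * √r) * (1 + m * τ) := by
    intro m hm
    induction m, hm using Nat.le_induction with
    | base =>
      intro hM
      have hΦ0 : 0 ≤ Φ := (norm_nonneg _).trans (hφ 0 (by omega))
      -- As `y 0 = 0`, the average is `s 1 = (τ/2) d 1`. Its contribution `τ²/4` together with the
      -- `-τ²/6` in `D` makes the `τ²/12` of the first-step equation.
      have h1 : e 1 = ⟪φ 0, d 1⟫_ℝ := by
        rw [← hfirst]
        simp only [he, hs, hd, hD, hy0, Nat.sub_self, sub_zero, zero_add, map_smul,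
          inner_add_left, inner_sub_left, inner_smul_left, inner_smul_right, RCLike.conj_to_real]
        field_simp
        ring
      have h2 : √(e 1) * √(e 1) ≤ Φ / (ε * √r) * √(e 1) := by
        rw [Real.mul_self_sqrt (he0 1), h1]
        refine (hΦ 0 (by omega) _).trans ?_
        calc Φ * ‖d 1‖ ≤ Φ * (√(e 1) / (ε * √r)) := mul_le_mul_of_nonneg_left (hdn 1) hΦ0
          _ = _ := by rw [← h1]; ring
      have h3 : √(e 1) ≤ Φ / (ε * √r) := by
        by_contra hlt
        push Not at hlt
        have hκ : 0 ≤ Φ / (ε * √r) := by positivity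
        nlinarith
      refine h3.trans (le_mul_of_one_le_right (by positivity) ?_)
      simp [hτ.le]
    | succ m hm ih =>
      intro hM
      have ih := ih (by omega)
      have hΦ0 : 0 ≤ Φ := (norm_nonneg _).trans (hφ 0 (by omega))
      have h1 : e (m + 1) = e m + τ * (⟪φ m, d (m + 1)⟫_ℝ + ⟪φ m, d m⟫_ℝ) :=
        energy_step hA hR hD hτ (hmain m hm (by omega))
      have hκ : 0 ≤ Φ / (ε * √r) := by positivity
      have h4 : ∀ j, ⟪φ m, d j⟫_ℝ ≤ Φ / (ε * √r) * √(e j) := fun j => by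
        refine (hΦ m (by omega) _).trans ?_
        calc Φ * ‖d j‖ ≤ Φ * (√(e j) / (ε * √r)) := mul_le_mul_of_nonneg_left (hdn j) hΦ0
          _ = _ := by ring
      have h5 : √(e (m + 1)) ^ 2 ≤ √(e m) ^ 2
          + τ * (Φ / (ε * √r)) * (√(e (m + 1)) + √(e m)) := by
        rw [Real.sq_sqrt (he0 _), Real.sq_sqrt (he0 _), h1]
        have := mul_le_mul_of_nonneg_left (add_le_add (h4 (m + 1)) (h4 m)) hτ.le
        rw [h1] at this
        linarith
      -- A difference of squares is bounded by a multiple of the sum of the roots. Arguing by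
      -- contradiction makes that sum positive, so the factor can be cancelled.
      have h6 : √(e (m + 1)) ≤ √(e m) + τ * (Φ / (ε * √r)) := by
        by_contra hlt
        push Not at hlt
        have ha := Real.sqrt_nonneg (e m)
        have hb : 0 ≤ τ * (Φ / (ε * √r)) := by positivity
        nlinarith
      push_cast
      nlinarith
  intro m hm hM
  refine ⟨le_trans ?_ (hbound m hm hM), le_trans ?_ (hbound m hm hM)⟩
  · apply Real.le_sqrt_of_sq_le
    rw [mul_pow, Real.sq_sqrt (hR0 _)]
    exact (hDR (d m)).trans (le_add_of_nonneg_right (hA0 _))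
  · exact Real.sqrt_le_sqrt (le_add_of_nonneg_left
      (le_trans (mul_nonneg (sq_nonneg _) (hR0 _)) (hDR _)))

/-- Stability of the three-level scheme `B (R Λ_t y) + (τ²/12) A Λ_t y + A y = ψ` when `A` and `B`
have a common orthonormal eigenbasis. -/
theorem stability_of_common_eigenbasis {κ : Type*} [Fintype κ] (b : OrthonormalBasis κ ℝ E)
    {A B R : E →ₗ[ℝ] E} {α β : κ → ℝ} (hA : ∀ j, A (b j) = α j • b j)
    (hB : ∀ j, B (b j) = β j • b j) (hR : R.IsSymmetric) {τ ε r ν0 ν Ψ : ℝ} (hτ : 0 < τ)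
    (hε : 0 < ε) (hr : 0 < r) (hν0 : 0 < ν0) (hν : 0 ≤ ν) (hα : ∀ j, 0 ≤ α j)
    (hβ0 : ∀ j, ν0 ≤ β j)
    (hβ : ∀ j, β j ≤ ν) (hst : ∀ j, 1 / 6 * τ ^ 2 * α j ≤ (1 - ε ^ 2) * r * β j)
    (hε1 : ε < 1)
    (hRr : ∀ w, r * ‖w‖ ^ 2 ≤ ⟪R w, w⟫_ℝ) {M : ℕ} {y ψ : ℕ → E} (hy0 : y 0 = 0)
    (hmain : ∀ m, 1 ≤ m → m < M → B (R ((1 / τ ^ 2) • (y (m + 1) - (2 : ℝ) • y m + y (m - 1))))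
      + (1 / 12 * τ ^ 2) • A ((1 / τ ^ 2) • (y (m + 1) - (2 : ℝ) • y m + y (m - 1))) + A (y m)
        = ψ m)
    (hfirst : B (R ((1 / τ) • (y 1 - y 0))) + (1 / 12 * τ ^ 2) • A ((1 / τ) • (y 1 - y 0)) = ψ 0)
    (hψ : ∀ m < M, ‖ψ m‖ ≤ Ψ) :
    ∀ m, 1 ≤ m → m ≤ M →
      ε * √⟪R ((1 / τ) • (y m - y (m - 1))), (1 / τ) • (y m - y (m - 1))⟫_ℝ
        + √⟪A ((1 / 2 : ℝ) • (y (m - 1) + y m)), (1 / 2 : ℝ) • (y (m - 1) + y m)⟫_ℝ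
          ≤ (1 + √ν) * (Ψ / ν0 / (ε * √r) * (1 + m * τ)) := by
  have hβp : ∀ j, 0 < β j := fun j => hν0.trans_le (hβ0 j)
  -- `B` is divided out rather than `R`: the operator `Binv ∘ A` is still diagonal, hence symmetric,
  -- and the symmetric `R`, which need not commute with `B`, is left untouched.
  set Binv : E →ₗ[ℝ] E := b.toBasis.constr ℝ fun j => (β j)⁻¹ • b j with hBinv
  have hBi : ∀ j, Binv (b j) = (β j)⁻¹ • b j := fun j => by
    have := b.toBasis.constr_basis ℝ (fun j => (β j)⁻¹ • b j) j
    rwa [OrthonormalBasis.coe_toBasis] at this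
  have hBB : ∀ w, Binv (B w) = w := by
    intro w
    have : Binv ∘ₗ B = LinearMap.id := b.toBasis.ext fun j => by
      simp [hB, hBi, smul_smul, (hβp j).ne']
    exact LinearMap.congr_fun this w
  set Q : E →ₗ[ℝ] E := Binv ∘ₗ A with hQ
  have hQd : ∀ j, Q (b j) = (α j / β j) • b j := fun j => by
    simp [hQ, hA, hBi, smul_smul, div_eq_mul_inv]
  have hQs := isSymmetric_of_diag b hQd
  have hQ0 : ∀ w, 0 ≤ ⟪Q w, w⟫_ℝ := fun w => by
    rw [inner_apply_of_diag b hQd]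
    exact Finset.sum_nonneg fun j _ => mul_nonneg (div_nonneg (hα j) (hβp j).le)
      (mul_self_nonneg _)
  -- On each eigenvector `τ²/6 · α/β ≤ (1 - ε²) r`. The lower bound `r` for `R` turns this into a
  -- comparison of `Q` with `R`, which are not simultaneously diagonal.
  have hco : ∀ w, ε ^ 2 * ⟪R w, w⟫_ℝ ≤ ⟪R w, w⟫_ℝ - τ ^ 2 / 6 * ⟪Q w, w⟫_ℝ := by
    intro w
    have h1 : τ ^ 2 / 6 * ⟪Q w, w⟫_ℝ ≤ (1 - ε ^ 2) * r * ‖w‖ ^ 2 := by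
      rw [inner_apply_of_diag b hQd, ← sum_sq_inner_basis b, Finset.mul_sum, Finset.mul_sum]
      refine Finset.sum_le_sum fun j _ => ?_
      rw [← mul_assoc]
      refine mul_le_mul_of_nonneg_right ?_ (mul_self_nonneg _)
      rw [← mul_div_assoc, div_le_iff₀ (hβp j)]
      linarith [hst j]
    have h2 : 0 ≤ 1 - ε ^ 2 := by nlinarith
    have h3 := mul_le_mul_of_nonneg_left (hRr w) h2
    linarith
  have hΨ : ∀ m < M, ‖Binv (ψ m)‖ ≤ Ψ / ν0 := by
    intro m hm
    refine (norm_apply_le_of_diag b hBi (K := 1 / ν0) (by positivity) (fun j => ?_) _).trans ?_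
    · rw [abs_of_pos (inv_pos.mpr (hβp j)), ← one_div]
      exact one_div_le_one_div_of_le hν0 (hβ0 j)
    · rw [one_div_mul_eq_div]
      gcongr
      exact hψ m hm
  have key := energy_bound hQs hR hτ hε hr hQ0 hco hRr hy0 (φ := fun m => Binv (ψ m)) (M := M)
    (fun m h1 h2 => by
      simp only [← hmain m h1 h2, map_add, map_smul Binv, hBB]; rfl)
    (by simp only [← hfirst, map_add, map_smul Binv, hBB]; rfl) hΨ
  intro m hm hM
  obtain ⟨k1, k2⟩ := key m hm hM
  -- The energy controls `Q`, not `A`; the upper bound `β ≤ ν` gives `α ≤ ν α/β`.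
  have h3 : ∀ w, √⟪A w, w⟫_ℝ ≤ √ν * √⟪Q w, w⟫_ℝ := by
    intro w
    rw [← Real.sqrt_mul hν]
    apply Real.sqrt_le_sqrt
    rw [inner_apply_of_diag b hA, inner_apply_of_diag b hQd, Finset.mul_sum]
    refine Finset.sum_le_sum fun j _ => ?_
    rw [← mul_assoc ν]
    refine mul_le_mul_of_nonneg_right ?_ (mul_self_nonneg _)
    rw [← mul_div_assoc, le_div_iff₀ (hβp j)]
    nlinarith [mul_le_mul_of_nonneg_left (hβ j) (hα j)]
  have h4 := (h3 ((1 / 2 : ℝ) • (y (m - 1) + y m))).trans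
    (mul_le_mul_of_nonneg_left k2 (Real.sqrt_nonneg ν))
  linarith

end Energy

open scoped InnerProductSpace

/-! ### The operators of the schemes as polynomials in the second differences -/

section Polynomials

variable {n : ℕ} {R R' : Type*} [Ring R] [Algebra ℝ R] [Ring R'] [Algebra ℝ R']

/-- `1 + ∑ i ≠ j, h_i² L_i / 12`. -/
noncomputable def polySNhat (h : Fin n → ℝ) (L : Fin n → R) (j : Fin n) : R :=
  1 + (1 / 12 : ℝ) • ∑ i ∈ Finset.univ.erase j, h i ^ 2 • L i

/-- `1 + h_k² L_k / 12`. -/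
noncomputable def polySk (h : Fin n → ℝ) (L : Fin n → R) (k : Fin n) : R :=
  1 + (1 / 12 * h k ^ 2 : ℝ) • L k

/-- The polynomial of the operator `B_h`. -/
noncomputable def CompactScheme.polyB : {n : ℕ} → CompactScheme n → (Fin n → ℝ) → (Fin n → R) → R
  | _, .first β, h, L => 1 + (1 / 12 : ℝ) • ∑ i, h i ^ 2 • L i
      + (β * (h 0 ^ 2 / 12) * (h 1 ^ 2 / 12)) • (L 0 * L 1)
  | _, .second β γ _, h, L => 1 + (1 / 12 : ℝ) • ∑ i, h i ^ 2 • L i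
      + β • ((1 / 12 ^ 2 : ℝ) • ((h 0 ^ 2 * h 1 ^ 2) • (L 0 * L 1)
        + (h 0 ^ 2 * h 2 ^ 2) • (L 0 * L 2) + (h 1 ^ 2 * h 2 ^ 2) • (L 1 * L 2)))
      + γ • ((1 / 12 ^ 3 * (h 0 ^ 2 * h 1 ^ 2 * h 2 ^ 2) : ℝ) • (L 0 * L 1 * L 2))
  | n, .third _, h, L => ((List.finRange n).map (polySk h L)).prod

/-- The polynomial of the operator `A_h`. -/
noncomputable def CompactScheme.polyA : {n : ℕ} → CompactScheme n → (a h : Fin n → ℝ) → (Fin n → R) → R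
  | _, .first _, a, h, L => -∑ i, a i ^ 2 • (polySNhat h L i * L i)
  | _, .second _ _ θ, a, h, L => -∑ i, a i ^ 2 • (polySNhat h L i * L i)
      + θ • -((1 / 12 ^ 2 * (a 0 ^ 2 * h 1 ^ 2 * h 2 ^ 2 + a 1 ^ 2 * h 0 ^ 2 * h 2 ^ 2
        + a 2 ^ 2 * h 0 ^ 2 * h 1 ^ 2) : ℝ) • (L 0 * L 1 * L 2))
  | n, .third _, a, h, L => -∑ i, a i ^ 2 •
      ((((List.finRange n).filter (fun k => k ≠ i)).map (polySk h L)).prod * L i)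

theorem CompactScheme.B_eq_polyB (S : CompactScheme n) (h : Fin n → ℝ) :
    S.B h = S.polyB h (lam h) := by cases S <;> rfl

theorem CompactScheme.A_eq_polyA (S : CompactScheme n) (a h : Fin n → ℝ) :
    S.A a h = S.polyA a h (lam h) := by cases S <;> rfl

theorem map_polySNhat (φ : R →ₐ[ℝ] R') (h : Fin n → ℝ) (L : Fin n → R) (j : Fin n) :
    φ (polySNhat h L j) = polySNhat h (fun i => φ (L i)) j := by
  simp [polySNhat, map_sum]

theorem map_polySk (φ : R →ₐ[ℝ] R') (h : Fin n → ℝ) (L : Fin n → R) (j : Fin n) :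
    φ (polySk h L j) = polySk h (fun i => φ (L i)) j := by
  simp [polySk]

theorem CompactScheme.map_polyB (S : CompactScheme n) (φ : R →ₐ[ℝ] R') (h : Fin n → ℝ)
    (L : Fin n → R) : φ (S.polyB h L) = S.polyB h fun i => φ (L i) := by
  cases S <;> simp only [polyB, map_add, map_one, map_smul, map_sum, map_mul, map_list_prod,
    List.map_map, Function.comp_def, map_polySk]

theorem CompactScheme.map_polyA (S : CompactScheme n) (φ : R →ₐ[ℝ] R') (a h : Fin n → ℝ)
    (L : Fin n → R) : φ (S.polyA a h L) = S.polyA a h fun i => φ (L i) := by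
  cases S <;> simp only [polyA, map_add, map_neg, map_smul, map_sum, map_mul, map_list_prod,
    List.map_map, Function.comp_def, map_polySk, map_polySNhat]

/-- One element of the free algebra serves all rings: it is evaluated at the projected differences
and at the real eigenvalues. Non-commuting variables are required because the ring of mesh operators
is not commutative. -/
theorem CompactScheme.exists_lift_polyB (S : CompactScheme n) (h : Fin n → ℝ) :
    ∃ p : FreeAlgebra ℝ (Fin n), ∀ {R : Type} [Ring R] [Algebra ℝ R] (L : Fin n → R),
      S.polyB h L = FreeAlgebra.lift ℝ L p :=
  ⟨S.polyB h (FreeAlgebra.ι ℝ), fun L => by simp [S.map_polyB]⟩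

theorem CompactScheme.exists_lift_polyA (S : CompactScheme n) (a h : Fin n → ℝ) :
    ∃ p : FreeAlgebra ℝ (Fin n), ∀ {R : Type} [Ring R] [Algebra ℝ R] (L : Fin n → R),
      S.polyA a h L = FreeAlgebra.lift ℝ L p :=
  ⟨S.polyA a h (FreeAlgebra.ι ℝ), fun L => by simp [S.map_polyA]⟩

theorem lift_apply_of_joint_eigenvector {V : Type*} [AddCommGroup V] [Module ℝ V]
    {L : Fin n → Module.End ℝ V} {x : Fin n → ℝ} {v : V} (hv : ∀ i, L i v = x i • v)
    (p : FreeAlgebra ℝ (Fin n)) : FreeAlgebra.lift ℝ L p v = FreeAlgebra.lift ℝ x p • v := by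
  induction p with
  | grade0 r => simp [Module.algebraMap_end_apply]
  | grade1 i => simpa using hv i
  | mul p q hp hq => simp [Module.End.mul_apply, hp, hq, smul_smul, mul_comm]
  | add p q hp hq => simp [hp, hq, add_smul]

theorem lift_apply_mem {V : Type*} [AddCommGroup V] [Module ℝ V] {L : Fin n → Module.End ℝ V}
    {W : Submodule ℝ V} (hW : ∀ i, ∀ v ∈ W, L i v ∈ W) (p : FreeAlgebra ℝ (Fin n)) :
    ∀ v ∈ W, FreeAlgebra.lift ℝ L p v ∈ W := by
  induction p with
  | grade0 r => intro v hv; simpa [Module.algebraMap_end_apply] using W.smul_mem r hv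
  | grade1 i => intro v hv; simpa using hW i v hv
  | mul p q hp hq => intro v hv; simpa [Module.End.mul_apply] using hp _ (hq _ hv)
  | add p q hp hq => intro v hv; simpa using W.add_mem (hp v hv) (hq v hv)

end Polynomials

/-! ### Second differences restricted to the nodes that are inner in one direction -/

section Projected

variable {n : ℕ}

/-- The node is inner in the direction `l`. -/
def InnerDir (N : Fin n → ℕ) (l : Fin n) (k : Fin n → ℤ) : Prop := 1 ≤ k l ∧ k l ≤ (N l : ℤ) - 1

instance (N : Fin n → ℕ) (l : Fin n) (k : Fin n → ℤ) : Decidable (InnerDir N l k) :=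
  inferInstanceAs (Decidable (_ ∧ _))

theorem mem_innerNodes {N : Fin n → ℕ} {k : Fin n → ℤ} :
    k ∈ innerNodes N ↔ ∀ i, InnerDir N i k := by
  simp [innerNodes, InnerDir]

theorem mem_closedNodes {N : Fin n → ℕ} {k : Fin n → ℤ} :
    k ∈ closedNodes N ↔ ∀ i, 0 ≤ k i ∧ k i ≤ (N i : ℤ) := by
  simp [closedNodes]

theorem innerNodes_subset_closedNodes (N : Fin n → ℕ) : innerNodes N ⊆ closedNodes N := by
  intro k hk
  rw [mem_closedNodes]
  intro i
  have := mem_innerNodes.mp hk i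
  unfold InnerDir at this
  omega

theorem lam_apply (h : Fin n → ℝ) (l : Fin n) (w : MeshFn n) (k : Fin n → ℤ) :
    lam h l w k = (w (k + Pi.single l 1) - 2 * w k + w (k - Pi.single l 1)) / h l ^ 2 := rfl

/-- The second difference `Λ_l`, replaced by zero at the nodes that are not inner in the direction
`l`. -/
noncomputable def projLam (h : Fin n → ℝ) (N : Fin n → ℕ) (l : Fin n) : MeshOp n where
  toFun w := fun k => if InnerDir N l k then lam h l w k else 0
  map_add' v w := by
    funext k
    by_cases hk : InnerDir N l k <;> simp [hk]
  map_smul' c w := by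
    funext k
    by_cases hk : InnerDir N l k <;> simp [hk]

theorem projLam_apply (h : Fin n → ℝ) (N : Fin n → ℕ) (l : Fin n) (w : MeshFn n)
    (k : Fin n → ℤ) : projLam h N l w k = if InnerDir N l k then lam h l w k else 0 := rfl

theorem innerDir_add_single {N : Fin n → ℕ} {l m : Fin n} (hlm : l ≠ m) (k : Fin n → ℤ) (c : ℤ) :
    InnerDir N l (k + Pi.single m c) ↔ InnerDir N l k := by
  simp [InnerDir, hlm]

theorem innerDir_sub_single {N : Fin n → ℕ} {l m : Fin n} (hlm : l ≠ m) (k : Fin n → ℤ) (c : ℤ) :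
    InnerDir N l (k - Pi.single m c) ↔ InnerDir N l k := by
  simp [InnerDir, hlm]

/-- A shift in the direction `m` does not change the index in the direction `l`, so the two
truncations do not interfere. -/
theorem projLam_comm (h : Fin n → ℝ) (N : Fin n → ℕ) {l m : Fin n} (hlm : l ≠ m)
    (w : MeshFn n) : projLam h N l (projLam h N m w) = projLam h N m (projLam h N l w) := by
  funext k
  simp only [projLam_apply, lam_apply, innerDir_add_single hlm, innerDir_sub_single hlm,
    innerDir_add_single hlm.symm, innerDir_sub_single hlm.symm]
  by_cases h1 : InnerDir N l k <;> by_cases h2 : InnerDir N m k <;> simp only [h1, h2, if_true,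
    if_false]
  · rw [add_right_comm k, sub_add_eq_add_sub k, sub_add_eq_add_sub k, sub_right_comm k]
    ring
  · simp
  · simp

/-- This is the purpose of the truncation: `lam` itself does not preserve `H_h`, since at a face of
the mesh it can pick up a nonzero inner neighbour. -/
theorem projLam_mem_Hh (h : Fin n → ℝ) (N : Fin n → ℕ) (l : Fin n) {w : MeshFn n}
    (hw : w ∈ Hh N) : projLam h N l w ∈ Hh N := by
  intro k hk
  rw [projLam_apply]
  split_ifs with hl
  · obtain ⟨j, hj⟩ := not_forall.mp (mt mem_innerNodes.mpr hk)
    have hjl : j ≠ l := fun h => hj (h ▸ hl)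
    have h1 : k + Pi.single l 1 ∉ innerNodes N := fun h =>
      hj ((innerDir_add_single hjl _ _).mp (mem_innerNodes.mp h j))
    have h2 : k - Pi.single l 1 ∉ innerNodes N := fun h =>
      hj ((innerDir_sub_single hjl _ _).mp (mem_innerNodes.mp h j))
    rw [lam_apply, hw _ hk, hw _ h1, hw _ h2]
    simp
  · rfl

/-- Mesh functions that vanish at the nodes of the closed mesh. -/
def vanishClosed (N : Fin n → ℕ) : Submodule ℝ (MeshFn n) where
  carrier := {w | ∀ k ∈ closedNodes N, w k = 0}
  add_mem' hv hw k hk := by simp [hv k hk, hw k hk]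
  zero_mem' _ _ := rfl
  smul_mem' c w hw k hk := by simp [hw k hk]

theorem add_single_mem_closedNodes {N : Fin n → ℕ} {l : Fin n} {k : Fin n → ℤ}
    (hk : k ∈ closedNodes N) (hl : InnerDir N l k) : k + Pi.single l 1 ∈ closedNodes N := by
  rw [mem_closedNodes] at *
  intro i
  have := hk i
  unfold InnerDir at hl
  by_cases h : i = l
  · subst h; simp; omega
  · simpa [h] using this

theorem sub_single_mem_closedNodes {N : Fin n → ℕ} {l : Fin n} {k : Fin n → ℤ}
    (hk : k ∈ closedNodes N) (hl : InnerDir N l k) : k - Pi.single l 1 ∈ closedNodes N := by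
  rw [mem_closedNodes] at *
  intro i
  have := hk i
  unfold InnerDir at hl
  by_cases h : i = l
  · subst h; simp; omega
  · simpa [h] using this

/-- A node of the closed mesh that is inner in the direction `l` has both its `l`-neighbours in the
closed mesh. Values of the scheme's solution beyond the closed mesh are arbitrary, and this shows
that they have no effect. -/
theorem projLam_mem_vanishClosed (h : Fin n → ℝ) (N : Fin n → ℕ) (l : Fin n) {w : MeshFn n}
    (hw : w ∈ vanishClosed N) : projLam h N l w ∈ vanishClosed N := by
  intro k hk
  rw [projLam_apply]
  split_ifs with hl
  · rw [lam_apply, hw _ hk, hw _ (add_single_mem_closedNodes hk hl),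
      hw _ (sub_single_mem_closedNodes hk hl)]
    simp
  · rfl

/-- `F w = F' w'` at the nodes that are inner in the directions from `J`, as soon as `w = w'` along
the directions from `J`. -/
def AgreeOn (N : Fin n → ℕ) (J : Set (Fin n)) (F F' : MeshOp n) : Prop :=
  ∀ (w w' : MeshFn n) (k : Fin n → ℤ), (∀ i ∈ J, InnerDir N i k) →
    (∀ k' : Fin n → ℤ, (∀ i, i ∉ J → k' i = k i) → w k' = w' k') → F w k = F' w' k

namespace AgreeOn

variable {N : Fin n → ℕ} {J J' : Set (Fin n)} {F F' G G' : MeshOp n}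

theorem mono (hF : AgreeOn N J F F') (hJ : J ⊆ J') : AgreeOn N J' F F' :=
  fun w w' k hk hw => hF w w' k (fun i hi => hk i (hJ hi)) fun k' hk' =>
    hw k' fun i hi => hk' i fun h => hi (hJ h)

/-- `F` reads only nodes that differ from `k` in the directions from `J`. By disjointness these are
still inner in the directions from `J'`, where `G` and `G'` agree. A repeated direction would break
this; in the three schemes every monomial has pairwise distinct directions. -/
theorem mul (hF : AgreeOn N J F F') (hG : AgreeOn N J' G G') (hd : Disjoint J J') :
    AgreeOn N (J ∪ J') (F * G) (F' * G') := by
  intro w w' k hk hw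
  refine hF _ _ k (fun i hi => hk i (Or.inl hi)) fun k' hk' => ?_
  refine hG _ _ k' (fun i hi => ?_) fun k'' hk'' => hw k'' fun i hi => ?_
  · have h1 := hk' i fun h => hd.le_bot ⟨h, hi⟩
    have h2 := hk i (Or.inr hi)
    unfold InnerDir at *
    rwa [h1]
  · rw [hk'' i fun h => hi (Or.inr h), hk' i fun h => hi (Or.inl h)]

theorem add (hF : AgreeOn N J F F') (hG : AgreeOn N J G G') : AgreeOn N J (F + G) (F' + G') := by
  intro w w' k hk hw
  simp only [LinearMap.add_apply, Pi.add_apply]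
  rw [hF w w' k hk hw, hG w w' k hk hw]

theorem neg (hF : AgreeOn N J F F') : AgreeOn N J (-F) (-F') := by
  intro w w' k hk hw
  simp only [LinearMap.neg_apply, Pi.neg_apply]
  rw [hF w w' k hk hw]

theorem smul (c : ℝ) (hF : AgreeOn N J F F') : AgreeOn N J (c • F) (c • F') := by
  intro w w' k hk hw
  simp only [LinearMap.smul_apply, Pi.smul_apply]
  rw [hF w w' k hk hw]

theorem one : AgreeOn N J 1 1 := fun _ _ k _ hw => hw k fun _ _ => rfl

theorem sum {ι : Type*} {s : Finset ι} {f f' : ι → MeshOp n}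
    (h : ∀ i ∈ s, AgreeOn N J (f i) (f' i)) : AgreeOn N J (∑ i ∈ s, f i) (∑ i ∈ s, f' i) := by
  classical
  induction s using Finset.induction_on with
  | empty =>
    intro w w' k _ _
    simp
  | insert i s hi ih =>
    rw [Finset.sum_insert hi, Finset.sum_insert hi]
    exact (h i (Finset.mem_insert_self _ _)).add
      (ih fun j hj => h j (Finset.mem_insert_of_mem hj))

theorem lam (h : Fin n → ℝ) (l : Fin n) :
    AgreeOn N {l} (CompactWave.lam h l) (projLam h N l) := by
  intro w w' k hk hw
  rw [projLam_apply, if_pos (hk l rfl), lam_apply, lam_apply, hw k fun _ _ => rfl,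
    hw (k + Pi.single l 1) fun i hi => by simp [Set.mem_singleton_iff.not.mp hi],
    hw (k - Pi.single l 1) fun i hi => by simp [Set.mem_singleton_iff.not.mp hi]]

theorem polySk (h : Fin n → ℝ) (l : Fin n) : AgreeOn N {l}
    (CompactWave.polySk h (CompactWave.lam h) l) (CompactWave.polySk h (projLam h N) l) :=
  AgreeOn.one.add ((AgreeOn.lam h l).smul _)

theorem list_prod (h : Fin n → ℝ) {l : List (Fin n)} (hl : l.Nodup) : AgreeOn N {i | i ∈ l}
    (l.map (CompactWave.polySk h (CompactWave.lam h))).prod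
    (l.map (CompactWave.polySk h (projLam h N))).prod := by
  induction l with
  | nil => exact AgreeOn.one
  | cons m l ih =>
    rw [List.nodup_cons] at hl
    simp only [List.map_cons, List.prod_cons]
    refine ((AgreeOn.polySk h m).mul (ih hl.2) ?_).mono fun i hi => ?_
    · rw [Set.disjoint_singleton_left]
      exact hl.1
    · rcases hi with hi | hi
      · exact List.mem_cons.mpr (Or.inl hi)
      · exact List.mem_cons.mpr (Or.inr hi)

theorem univ (hF : AgreeOn N J F F') : AgreeOn N Set.univ F F' := hF.mono (Set.subset_univ _)

theorem lam_mul_lam (h : Fin n → ℝ) {i j : Fin n} (hij : i ≠ j) : AgreeOn N {i, j}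
    (CompactWave.lam h i * CompactWave.lam h j) (projLam h N i * projLam h N j) :=
  (AgreeOn.lam h i).mul (AgreeOn.lam h j) (by simpa using hij)

theorem polySNhat_mul_lam (h : Fin n → ℝ) (i : Fin n) : AgreeOn N Set.univ
    (CompactWave.polySNhat h (CompactWave.lam h) i * CompactWave.lam h i)
    (CompactWave.polySNhat h (projLam h N) i * projLam h N i) := by
  refine AgreeOn.univ (AgreeOn.mul (J := {j | j ≠ i}) (AgreeOn.one.add ((AgreeOn.sum
    fun j hj => ?_).smul _)) (AgreeOn.lam h i) ?_)
  · refine ((AgreeOn.lam h j).smul _).mono ?_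
    rw [Set.singleton_subset_iff]
    exact Finset.ne_of_mem_erase hj
  · rw [Set.disjoint_singleton_right]
    exact fun h => h rfl

end AgreeOn

theorem CompactScheme.agreeOn_B (S : CompactScheme n) (h : Fin n → ℝ) (N : Fin n → ℕ) :
    AgreeOn N Set.univ (S.B h) (S.polyB h (projLam h N)) := by
  rw [S.B_eq_polyB]
  have hs : AgreeOn N Set.univ (1 + (1 / 12 : ℝ) • ∑ i, h i ^ 2 • lam h i)
      (1 + (1 / 12 : ℝ) • ∑ i, h i ^ 2 • projLam h N i) :=
    AgreeOn.one.add ((AgreeOn.sum fun i _ => (AgreeOn.lam h i).univ.smul _).smul _)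
  cases S with
  | first β => exact hs.add ((AgreeOn.lam_mul_lam h (by decide)).univ.smul _)
  | second β γ θ =>
    refine (hs.add ((((((AgreeOn.lam_mul_lam h (by decide)).univ.smul _).add
      ((AgreeOn.lam_mul_lam h (by decide)).univ.smul _)).add
      ((AgreeOn.lam_mul_lam h (by decide)).univ.smul _)).smul _).smul _)).add
      (((((AgreeOn.lam_mul_lam h (by decide)).mul (AgreeOn.lam h 2) ?_).univ).smul _).smul _)
    simp
  | third => exact (AgreeOn.list_prod h (List.nodup_finRange n)).univ

theorem CompactScheme.agreeOn_A (S : CompactScheme n) (a h : Fin n → ℝ) (N : Fin n → ℕ) :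
    AgreeOn N Set.univ (S.A a h) (S.polyA a h (projLam h N)) := by
  rw [S.A_eq_polyA]
  have hs : AgreeOn N Set.univ (-∑ i, a i ^ 2 • (polySNhat h (lam h) i * lam h i))
      (-∑ i, a i ^ 2 • (polySNhat h (projLam h N) i * projLam h N i)) :=
    (AgreeOn.sum fun i _ => (AgreeOn.polySNhat_mul_lam h i).smul _).neg
  cases S with
  | first β => exact hs
  | second β γ θ =>
    refine hs.add ((((((AgreeOn.lam_mul_lam h (by decide)).mul (AgreeOn.lam h 2)
      ?_).univ).smul _).neg).smul _)
    simp
  | third =>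
    refine (AgreeOn.sum fun i _ => ?_).neg
    refine AgreeOn.smul _ (((AgreeOn.list_prod h ((List.nodup_finRange n).filter _)).mul
      (AgreeOn.lam h i) ?_).univ)
    rw [Set.disjoint_singleton_right]
    simp

end Projected

/-! ### The Euclidean space of functions on the inner nodes -/

section Space

variable {n : ℕ}

/-- Functions on the inner nodes. -/
abbrev InnerSpace (N : Fin n → ℕ) : Type := EuclideanSpace ℝ (innerNodes N)

/-- Extension by zero of a function on the inner nodes. -/
noncomputable def extend (N : Fin n → ℕ) : InnerSpace N →ₗ[ℝ] MeshFn n where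
  toFun v := fun k => if hk : k ∈ innerNodes N then v ⟨k, hk⟩ else 0
  map_add' v w := by
    funext k
    by_cases hk : k ∈ innerNodes N <;> simp [hk]
  map_smul' c v := by
    funext k
    by_cases hk : k ∈ innerNodes N <;> simp [hk]

/-- Restriction of a mesh function to the inner nodes. -/
noncomputable def restrict (N : Fin n → ℕ) : MeshFn n →ₗ[ℝ] InnerSpace N where
  toFun w := WithLp.toLp 2 fun k => w k
  map_add' _ _ := rfl
  map_smul' _ _ := rfl

theorem restrict_apply (N : Fin n → ℕ) (w : MeshFn n) (k : innerNodes N) :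
    restrict N w k = w k := rfl

theorem restrict_congr {N : Fin n → ℕ} {v w : MeshFn n} (h : ∀ k ∈ innerNodes N, v k = w k) :
    restrict N v = restrict N w := by
  ext k
  exact h k k.2

theorem extend_mem_Hh (N : Fin n → ℕ) (v : InnerSpace N) : extend N v ∈ Hh N := by
  intro k hk
  simp [extend, hk]

theorem restrict_extend (N : Fin n → ℕ) (v : InnerSpace N) : restrict N (extend N v) = v := by
  ext k
  rw [restrict_apply]
  simp [extend]

theorem extend_restrict {N : Fin n → ℕ} {w : MeshFn n} (hw : w ∈ Hh N) :
    extend N (restrict N w) = w := by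
  funext k
  by_cases hk : k ∈ innerNodes N
  · simp [extend, hk, restrict_apply]
  · simp [extend, hk, hw k hk]

theorem inner_restrict (N : Fin n → ℕ) (v w : MeshFn n) :
    ⟪restrict N v, restrict N w⟫_ℝ = ∑ k ∈ innerNodes N, v k * w k := by
  rw [← Finset.sum_coe_sort]
  simp only [PiLp.inner_apply, restrict_apply]
  exact Finset.sum_congr rfl fun k _ => by simp [mul_comm]

theorem innerH_eq (h : Fin n → ℝ) (N : Fin n → ℕ) (v w : MeshFn n) :
    innerH h N v w = (∏ i, h i) * ⟪restrict N v, restrict N w⟫_ℝ := by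
  rw [innerH, inner_restrict]

/-- Compression of an operator on mesh functions to the functions on the inner nodes. -/
noncomputable def compress (N : Fin n → ℕ) (F : MeshOp n) : InnerSpace N →ₗ[ℝ] InnerSpace N :=
  restrict N ∘ₗ F ∘ₗ extend N

/-- Both summands vanish off the inner nodes, so the sums may be taken over the whole lattice and
translated there. This replaces summation by parts. -/
theorem sum_shift_mul (N : Fin n → ℕ) {v w : MeshFn n} (hv : v ∈ Hh N) (hw : w ∈ Hh N)
    (e : Fin n → ℤ) :
    ∑ k ∈ innerNodes N, v (k + e) * w k = ∑ k ∈ innerNodes N, v k * w (k - e) := by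
  rw [← finsum_eq_sum_of_support_subset (fun k => v (k + e) * w k) (s := innerNodes N)
      (fun k hk => by
        by_contra hk'
        exact hk (by simp [hw k (by simpa using hk')])),
    ← finsum_eq_sum_of_support_subset (fun k => v k * w (k - e)) (s := innerNodes N)
      (fun k hk => by
        by_contra hk'
        exact hk (by simp [hv k (by simpa using hk')])),
    ← finsum_comp_equiv (Equiv.addRight e) (f := fun k => v k * w (k - e))]
  simp

/-- Translating the summation set can only lose nonzero terms, because `v` vanishes off the inner
nodes. -/
theorem sum_shift_sq_le (N : Fin n → ℕ) {v : MeshFn n} (hv : v ∈ Hh N) (e : Fin n → ℤ) :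
    ∑ k ∈ innerNodes N, v (k + e) ^ 2 ≤ ∑ k ∈ innerNodes N, v k ^ 2 := by
  have h1 : ∑ k ∈ innerNodes N, v (k + e) ^ 2
      = ∑ k ∈ (innerNodes N).map (addRightEmbedding e), v k ^ 2 := by simp
  rw [h1, ← Finset.sum_filter_ne_zero]
  refine Finset.sum_le_sum_of_subset_of_nonneg (fun k hk => ?_) fun _ _ _ => sq_nonneg _
  by_contra hk'
  exact (Finset.mem_filter.mp hk).2 (by simp [hv k hk'])

theorem inner_compress_projLam (h : Fin n → ℝ) (N : Fin n → ℕ) (l : Fin n)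
    (v w : InnerSpace N) : ⟪compress N (projLam h N l) v, w⟫_ℝ
      = (∑ k ∈ innerNodes N, (extend N v (k + Pi.single l 1) * extend N w k
        - 2 * (extend N v k * extend N w k)
        + extend N v (k - Pi.single l 1) * extend N w k)) / h l ^ 2 := by
  conv_lhs => rw [← restrict_extend N w]
  simp only [compress, LinearMap.comp_apply]
  rw [inner_restrict, Finset.sum_div]
  refine Finset.sum_congr rfl fun k hk => ?_
  rw [projLam_apply, if_pos (mem_innerNodes.mp hk l), lam_apply]
  ring

theorem isSymmetric_compress_projLam (h : Fin n → ℝ) (N : Fin n → ℕ) (l : Fin n) :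
    (compress N (projLam h N l)).IsSymmetric := by
  intro v w
  rw [real_inner_comm _ v, inner_compress_projLam, inner_compress_projLam]
  congr 1
  simp only [Finset.sum_add_distrib, Finset.sum_sub_distrib]
  have h1 := sum_shift_mul N (extend_mem_Hh N v) (extend_mem_Hh N w) (Pi.single l 1)
  have h2 := sum_shift_mul N (extend_mem_Hh N w) (extend_mem_Hh N v) (Pi.single l 1)
  simp only [mul_comm (extend N w _)] at *
  rw [h1, h2]
  ring

theorem inner_compress_projLam_nonpos (h : Fin n → ℝ) (N : Fin n → ℕ) (l : Fin n)
    (v : InnerSpace N) : ⟪compress N (projLam h N l) v, v⟫_ℝ ≤ 0 := by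
  rw [inner_compress_projLam]
  refine div_nonpos_of_nonpos_of_nonneg ?_ (sq_nonneg _)
  set V := extend N v
  have h1 := sum_shift_sq_le N (extend_mem_Hh N v) (Pi.single l 1)
  have h2 := sum_shift_sq_le N (extend_mem_Hh N v) (-Pi.single l 1)
  simp only [← sub_eq_add_neg] at h2
  have h3 : ∑ k ∈ innerNodes N, (V (k + Pi.single l 1) * V k - 2 * (V k * V k)
      + V (k - Pi.single l 1) * V k) ≤ ∑ k ∈ innerNodes N, (1 / 2 * V (k + Pi.single l 1) ^ 2
        + 1 / 2 * V (k - Pi.single l 1) ^ 2 - V k ^ 2) :=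
    Finset.sum_le_sum fun k _ => by
      nlinarith [sq_nonneg (V (k + Pi.single l 1) - V k), sq_nonneg (V (k - Pi.single l 1) - V k)]
  simp only [Finset.sum_add_distrib, Finset.sum_sub_distrib, ← Finset.mul_sum] at *
  linarith

/-- Each product of neighbours is at least minus half the sum of the squares. The two neighbours
then cost 2 in total, and the central weight costs 2 more. The exact eigenvalues are not needed: the
bound `4 / h_l²` already keeps `1 + h_l² x_l / 12` above `2/3`. -/
theorem le_inner_compress_projLam {h : Fin n → ℝ} (N : Fin n → ℕ) (l : Fin n)
    (v : InnerSpace N) :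
    -(4 / h l ^ 2) * ‖v‖ ^ 2 ≤ ⟪compress N (projLam h N l) v, v⟫_ℝ := by
  rw [inner_compress_projLam, ← real_inner_self_eq_norm_sq]
  conv_lhs => rw [← restrict_extend N v]
  rw [inner_restrict, ← neg_div, div_mul_eq_mul_div]
  refine div_le_div_of_nonneg_right ?_ (sq_nonneg _)
  set V := extend N v
  have h1 := sum_shift_sq_le N (extend_mem_Hh N v) (Pi.single l 1)
  have h2 := sum_shift_sq_le N (extend_mem_Hh N v) (-Pi.single l 1)
  simp only [← sub_eq_add_neg] at h2
  have h3 : ∑ k ∈ innerNodes N, (-(1 / 2) * V (k + Pi.single l 1) ^ 2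
        - 1 / 2 * V (k - Pi.single l 1) ^ 2 - 3 * V k ^ 2) ≤
      ∑ k ∈ innerNodes N, (V (k + Pi.single l 1) * V k - 2 * (V k * V k)
      + V (k - Pi.single l 1) * V k) :=
    Finset.sum_le_sum fun k _ => by
      nlinarith [sq_nonneg (V (k + Pi.single l 1) + V k), sq_nonneg (V (k - Pi.single l 1) + V k)]
  simp only [Finset.sum_add_distrib, Finset.sum_sub_distrib, ← Finset.mul_sum, ← sq] at *
  linarith

/-- Since the operators preserve `H_h`, the extension by zero of a joint eigenvector of the
compressions is a joint eigenvector of the operators themselves. Compression is therefore compatible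
with polynomials here, although it is not multiplicative in general. -/
theorem compress_lift_apply {N : Fin n → ℕ} {L : Fin n → MeshOp n} (v : InnerSpace N)
    {x : Fin n → ℝ} (hL : ∀ i, ∀ w ∈ Hh N, L i w ∈ Hh N)
    (hv : ∀ i, compress N (L i) v = x i • v) (p : FreeAlgebra ℝ (Fin n)) :
    compress N (FreeAlgebra.lift ℝ L p) v = FreeAlgebra.lift ℝ x p • v := by
  have : ∀ i, L i (extend N v) = x i • extend N v := fun i => by
    rw [← map_smul, ← hv i]
    exact (extend_restrict (hL i _ (extend_mem_Hh N v))).symm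
  simp only [compress, LinearMap.comp_apply]
  rw [lift_apply_of_joint_eigenvector this, map_smul, restrict_extend]

open Module.End in
/-- Commuting symmetric operators have a common orthonormal eigenbasis. -/
theorem exists_common_orthonormal_eigenbasis {E : Type*} [NormedAddCommGroup E]
    [InnerProductSpace ℝ E] [FiniteDimensional ℝ E] {T : Fin n → E →ₗ[ℝ] E}
    (hT : ∀ i, (T i).IsSymmetric) (hC : ∀ i j, i ≠ j → Commute (T i) (T j)) :
    ∃ (b : OrthonormalBasis (Fin (Module.finrank ℝ E)) ℝ E)
      (x : Fin (Module.finrank ℝ E) → Fin n → ℝ), ∀ j i, T i (b j) = x j i • b j := by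
  classical
  set V : (Fin n → ℝ) → Submodule ℝ E := fun α => ⨅ j, eigenspace (T j) (α j) with hV
  have hI : DirectSum.IsInternal V :=
    LinearMap.IsSymmetric.directSum_isInternal_of_pairwise_commute hT fun i j hij => hC i j hij
  have hO := LinearMap.IsSymmetric.orthogonalFamily_iInf_eigenspaces hT
  -- The joint eigenspaces are indexed by all real `n`-tuples. A subordinate orthonormal basis needs
  -- a finite index type, and only finitely many of these spaces are nonzero.
  have hfin : {α | V α ≠ ⊥}.Finite :=
    WellFoundedGT.finite_ne_bot_of_iSupIndep hI.submodule_iSupIndep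
  have : Fintype {α // V α ≠ ⊥} := hfin.fintype
  have hI' := DirectSum.isInternal_ne_bot_iff.mpr hI
  have hO' : OrthogonalFamily ℝ (fun α : {α // V α ≠ ⊥} => V α) fun α => (V α).subtypeₗᵢ :=
    hO.comp (f := fun α : {α // V α ≠ ⊥} => (α : Fin n → ℝ)) Subtype.val_injective
  refine ⟨hI'.subordinateOrthonormalBasis rfl hO',
    fun j => (hI'.subordinateOrthonormalBasisIndex rfl j hO').1, fun j i => ?_⟩
  have hmem := hI'.subordinateOrthonormalBasis_subordinate rfl j hO'
  simp only [hV, Submodule.mem_iInf] at hmem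
  exact mem_eigenspace_iff.mp (hmem i)

/-- The second differences have a common orthonormal eigenbasis, with eigenvalues in
`[-4 / h_l², 0]`. -/
theorem exists_mesh_eigenbasis (h : Fin n → ℝ) (N : Fin n → ℕ) :
    ∃ (m : ℕ) (b : OrthonormalBasis (Fin m) ℝ (InnerSpace N)) (x : Fin m → Fin n → ℝ),
      (∀ j i, compress N (projLam h N i) (b j) = x j i • b j) ∧
      ∀ j i, -(4 / h i ^ 2) ≤ x j i ∧ x j i ≤ 0 := by
  obtain ⟨b, x, hx⟩ := exists_common_orthonormal_eigenbasis
    (T := fun i => compress N (projLam h N i)) (isSymmetric_compress_projLam h N) (by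
      intro i j hij
      refine LinearMap.ext fun v => ?_
      simp only [Module.End.mul_apply, compress, LinearMap.comp_apply]
      rw [extend_restrict (projLam_mem_Hh h N j (extend_mem_Hh N v)),
        extend_restrict (projLam_mem_Hh h N i (extend_mem_Hh N v)), projLam_comm h N hij])
  refine ⟨_, b, x, hx, fun j i => ?_⟩
  have h1 := inner_compress_projLam_nonpos h N i (b j)
  have h2 := le_inner_compress_projLam (h := h) N i (b j)
  rw [hx, inner_smul_left, real_inner_self_eq_norm_sq, b.norm_eq_one] at h1 h2
  simpa using And.intro h2 h1

end Space

open scoped InnerProductSpace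

/-! ### Bounds for the polynomials of the schemes at the eigenvalues -/

section Eigenvalues

variable {n : ℕ} {a h x : Fin n → ℝ}

/-- The product `h_k² x_k` lies in `[-4, 0]`, and `1 - 4/12 = 2/3`. This is where the factor `2/3`
of part (b) comes from. -/
theorem polySk_mem (hh : ∀ i, 0 < h i) (hx : ∀ i, -(4 / h i ^ 2) ≤ x i ∧ x i ≤ 0) (k : Fin n) :
    2 / 3 ≤ polySk h x k ∧ polySk h x k ≤ 1 := by
  have hk : 0 < h k ^ 2 := pow_pos (hh k) 2
  have h1 : -4 ≤ h k ^ 2 * x k := by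
    have := mul_le_mul_of_nonneg_left (hx k).1 hk.le
    rwa [mul_neg, mul_div_cancel₀ _ hk.ne'] at this
  have h2 : h k ^ 2 * x k ≤ 0 := mul_nonpos_of_nonneg_of_nonpos hk.le (hx k).2
  simp only [polySk, smul_eq_mul]
  constructor <;> linarith

theorem polySNhat_eq (h x : Fin n → ℝ) (j : Fin n) :
    polySNhat h x j = 1 - ∑ i ∈ Finset.univ.erase j, (1 - polySk h x i) := by
  simp only [polySNhat, polySk, smul_eq_mul, Finset.mul_sum, sub_eq_add_neg, ← Finset.sum_neg_distrib]
  congr 1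
  exact Finset.sum_congr rfl fun i _ => by ring

theorem list_filter_map_prod (f : Fin n → ℝ) (i : Fin n) :
    (((List.finRange n).filter (fun k => k ≠ i)).map f).prod = ∏ k ∈ Finset.univ.erase i, f k := by
  rw [← List.prod_toFinset _ ((List.nodup_finRange n).filter _)]
  congr 1
  ext k
  simp

/-- In each scheme the value is a sum of `a_i² p_i (-x_i)` with `-x_i ≥ 0`, so a lower bound on the
weights `p_i` is enough. The weight is one factor `polySk` in the first scheme and a product of `n -
1` of them in the third. -/
theorem CompactScheme.le_polyA (S : CompactScheme n) (hh : ∀ i, 0 < h i)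
    (hx : ∀ i, -(4 / h i ^ 2) ≤ x i ∧ x i ≤ 0) {ε2 c : ℝ} (hε : S.AdmissibleEps ε2) (hc0 : 0 ≤ c)
    (hc : ∀ i, c ≤ a i) :
    ε2 * c ^ 2 * (2 / 3) ^ (n - 1) * -∑ i, x i ≤ S.polyA a h x := by
  have hca : ∀ i, c ^ 2 ≤ a i ^ 2 := fun i => pow_le_pow_left₀ hc0 (hc i) 2
  have hs := polySk_mem hh hx
  have hterm : ∀ i, ∀ p q : ℝ, 0 ≤ q → q ≤ p → c ^ 2 * q * -x i ≤ a i ^ 2 * p * -x i :=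
    fun i p q hq hpq => mul_le_mul_of_nonneg_right
      (mul_le_mul (hca i) hpq hq (sq_nonneg _)) (neg_nonneg.mpr (hx i).2)
  cases S with
  | first β =>
    simp only [AdmissibleEps] at hε
    subst hε
    have h0 := hterm 0 (polySk h x 1) (2 / 3) (by norm_num) (hs 1).1
    have h1 := hterm 1 (polySk h x 0) (2 / 3) (by norm_num) (hs 0).1
    simp only [polyA, polySNhat_eq, Finset.sum_erase_eq_sub (Finset.mem_univ _),
      Fin.sum_univ_two, smul_eq_mul, Nat.add_one_sub_one, pow_one]
    linarith
  | second β γ θ =>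
    obtain ⟨he0, he1, he2⟩ := hε
    -- With `p` and `q` for the two factors, the right-hand side exceeds `θ p q` by `(1 - θ)(p + q -
    -- 1)`, which is nonnegative because `p + q ≥ 4/3`. Then `θ p q ≥ ε2 (2/3)²`.
    have hq : ∀ i j, ε2 * (4 / 9) ≤ polySk h x i + polySk h x j - 1
        + θ * ((1 - polySk h x i) * (1 - polySk h x j)) := by
      intro i j
      obtain ⟨hi0, hi1⟩ := hs i
      obtain ⟨hj0, hj1⟩ := hs j
      nlinarith [mul_nonneg (sub_nonneg.mpr hi0) (sub_nonneg.mpr hj0),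
        mul_nonneg (sub_nonneg.mpr he2) (sub_nonneg.mpr hi0),
        mul_nonneg (sub_nonneg.mpr he2) (sub_nonneg.mpr hj0),
        mul_nonneg (he0.le.trans he1) (mul_nonneg (sub_nonneg.mpr hi0) (sub_nonneg.mpr hj0)),
        mul_nonneg (he0.le.trans he1) (sub_nonneg.mpr hi0),
        mul_nonneg (he0.le.trans he1) (sub_nonneg.mpr hj0)]
    have hq0 : 0 ≤ ε2 * (4 / 9) := by positivity
    have h0 := hterm 0 _ _ hq0 (hq 1 2)
    have h1 := hterm 1 _ _ hq0 (hq 0 2)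
    have h2 := hterm 2 _ _ hq0 (hq 0 1)
    have key : (CompactScheme.second β γ θ).polyA a h x
        = a 0 ^ 2 * (polySk h x 1 + polySk h x 2 - 1
          + θ * ((1 - polySk h x 1) * (1 - polySk h x 2))) * -x 0
        + a 1 ^ 2 * (polySk h x 0 + polySk h x 2 - 1
          + θ * ((1 - polySk h x 0) * (1 - polySk h x 2))) * -x 1
        + a 2 ^ 2 * (polySk h x 0 + polySk h x 1 - 1
          + θ * ((1 - polySk h x 0) * (1 - polySk h x 1))) * -x 2 := by
      simp only [polyA, polySNhat_eq, Finset.sum_erase_eq_sub (Finset.mem_univ _),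
        Fin.sum_univ_three, smul_eq_mul]
      simp only [polySk, smul_eq_mul]
      ring
    rw [key, Fin.sum_univ_three]
    norm_num
    linarith
  | third =>
    simp only [AdmissibleEps] at hε
    subst hε
    simp only [polyA, smul_eq_mul, list_filter_map_prod, ← Finset.sum_neg_distrib, Finset.mul_sum]
    refine Finset.sum_le_sum fun i _ => ?_
    have hp : (2 / 3 : ℝ) ^ (n - 1) ≤ ∏ k ∈ Finset.univ.erase i, polySk h x k := by
      have := Finset.prod_le_prod (s := Finset.univ.erase i) (f := fun _ => (2 / 3 : ℝ))
        (g := polySk h x) (fun _ _ => by norm_num) fun k _ => (hs k).1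
      rwa [Finset.prod_const, Finset.card_erase_of_mem (Finset.mem_univ _), Finset.card_univ,
        Fintype.card_fin] at this
    have := hterm i _ _ (by positivity) hp
    linarith

/-- Term by term, the factor `polySk h x i` missing from the `i`-th summand of `polyA` is recovered
from `-x i ≤ (6 / h i ^ 2) * polySk h x i`, which is the bound `-x i ≤ 4 / h i ^ 2` rewritten. The 6
cancels the `1/6` of the stability condition, and no separate bound on `A_h` by `B_h` is needed. -/
theorem third_stable (hh : ∀ i, 0 < h i) (hx : ∀ i, -(4 / h i ^ 2) ≤ x i ∧ x i ≤ 0) {τ c : ℝ}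
    (hst : τ ^ 2 * ∑ i, a i ^ 2 / h i ^ 2 ≤ c) :
    0 ≤ (CompactScheme.third n).polyA a h x ∧
      1 / 6 * τ ^ 2 * (CompactScheme.third n).polyA a h x
        ≤ c * (CompactScheme.third n).polyB h x := by
  have hs := polySk_mem hh hx
  have hs0 : ∀ k, 0 ≤ polySk h x k := fun k => by linarith [(hs k).1]
  simp only [CompactScheme.polyA, CompactScheme.polyB, smul_eq_mul, list_filter_map_prod,
    ← Fin.prod_univ_def, ← Finset.sum_neg_distrib]
  have hP : ∀ i, 0 ≤ ∏ k ∈ Finset.univ.erase i, polySk h x k :=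
    fun i => Finset.prod_nonneg fun k _ => hs0 k
  constructor
  · refine Finset.sum_nonneg fun i _ => ?_
    rw [← mul_neg, ← mul_neg]
    exact mul_nonneg (sq_nonneg _) (mul_nonneg (hP i) (neg_nonneg.mpr (hx i).2))
  · refine le_trans ?_ (mul_le_mul_of_nonneg_right hst (Finset.prod_nonneg fun k _ => hs0 k))
    rw [mul_assoc (τ ^ 2), Finset.sum_mul, mul_comm (1 / 6), mul_assoc, Finset.mul_sum]
    refine mul_le_mul_of_nonneg_left (Finset.sum_le_sum fun i _ => ?_) (sq_nonneg _)
    rw [← Finset.mul_prod_erase _ _ (Finset.mem_univ i)]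
    have hi : 0 < h i ^ 2 := pow_pos (hh i) 2
    have h1 : -x i ≤ 6 / h i ^ 2 * polySk h x i := by
      rw [div_mul_eq_mul_div, le_div_iff₀ hi]
      have := (hs i).1
      simp only [polySk, smul_eq_mul] at this ⊢
      linarith
    have h2 := mul_le_mul_of_nonneg_left h1 (mul_nonneg (sq_nonneg (a i)) (hP i))
    calc _ = 1 / 6 * (a i ^ 2 * (∏ k ∈ Finset.univ.erase i, polySk h x k) * -x i) := by ring
      _ ≤ 1 / 6 * (a i ^ 2 * (∏ k ∈ Finset.univ.erase i, polySk h x k)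
          * (6 / h i ^ 2 * polySk h x i)) := by gcongr
      _ = _ := by ring

end Eigenvalues

/-! ### The operators of the schemes in the common eigenbasis -/

section Spectral

variable {n : ℕ}

/-- `w` is known only to vanish at the boundary nodes and need not lie in `H_h`. Its difference from
the zero extension of its restriction vanishes on the closed mesh, and projected polynomials
preserve that property. -/
theorem restrict_of_agreeOn {h : Fin n → ℝ} {N : Fin n → ℕ} {F : MeshOp n}
    {p : FreeAlgebra ℝ (Fin n)} (hF : AgreeOn N Set.univ F (FreeAlgebra.lift ℝ (projLam h N) p))
    {w : MeshFn n} (hw : ∀ k ∈ boundaryNodes N, w k = 0) :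
    restrict N (F w) = compress N (FreeAlgebra.lift ℝ (projLam h N) p) (restrict N w) := by
  simp only [compress, LinearMap.comp_apply]
  refine restrict_congr fun k hk => ?_
  rw [hF w w k (fun i _ => mem_innerNodes.mp hk i) fun k' hk' => rfl]
  have hZ : w - extend N (restrict N w) ∈ vanishClosed N := by
    intro k hk
    by_cases hk' : k ∈ innerNodes N
    · simp [extend, hk', restrict_apply]
    · simp [extend, hk', hw k (by simp [boundaryNodes, hk, hk'])]
  have := lift_apply_mem (fun i _ => projLam_mem_vanishClosed h N i) p _ hZ k
    (innerNodes_subset_closedNodes N hk)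
  rw [map_sub] at this
  exact sub_eq_zero.mp this

/-- A simultaneous diagonalization of the operators of the schemes. -/
theorem CompactScheme.exists_diagonalization (S : CompactScheme n) (a h : Fin n → ℝ)
    (N : Fin n → ℕ) :
    ∃ (m : ℕ) (b : OrthonormalBasis (Fin m) ℝ (InnerSpace N)) (x : Fin m → Fin n → ℝ)
      (A B D : InnerSpace N →ₗ[ℝ] InnerSpace N),
      (∀ j i, -(4 / h i ^ 2) ≤ x j i ∧ x j i ≤ 0) ∧
      (∀ j, A (b j) = S.polyA a h (x j) • b j) ∧ (∀ j, B (b j) = S.polyB h (x j) • b j) ∧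
      (∀ j, D (b j) = (-∑ i, x j i) • b j) ∧
      ∀ w : MeshFn n, (∀ k ∈ boundaryNodes N, w k = 0) →
        restrict N (S.A a h w) = A (restrict N w) ∧ restrict N (S.B h w) = B (restrict N w) ∧
        restrict N ((-lapH h) w) = D (restrict N w) := by
  obtain ⟨m, b, x, hb, hx⟩ := exists_mesh_eigenbasis h N
  obtain ⟨pA, hpA⟩ := S.exists_lift_polyA a h
  obtain ⟨pB, hpB⟩ := S.exists_lift_polyB h
  have hD : AgreeOn N Set.univ (-lapH h)
      (FreeAlgebra.lift ℝ (projLam h N) (-∑ i, FreeAlgebra.ι ℝ i)) := by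
    simp only [map_neg, map_sum, FreeAlgebra.lift_ι_apply]
    exact (AgreeOn.sum fun i _ => (AgreeOn.lam h i).univ).neg
  have hinv : ∀ i, ∀ w ∈ Hh N, projLam h N i w ∈ Hh N := fun i w => projLam_mem_Hh h N i
  refine ⟨m, b, x, compress N (FreeAlgebra.lift ℝ (projLam h N) pA),
    compress N (FreeAlgebra.lift ℝ (projLam h N) pB),
    compress N (FreeAlgebra.lift ℝ (projLam h N) (-∑ i, FreeAlgebra.ι ℝ i)), hx,
    fun j => ?_, fun j => ?_, fun j => ?_, fun w hw => ⟨?_, ?_, restrict_of_agreeOn hD hw⟩⟩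
  · rw [compress_lift_apply _ hinv (hb j), hpA]
  · rw [compress_lift_apply _ hinv (hb j), hpB]
  · rw [compress_lift_apply _ hinv (hb j)]
    simp
  · exact restrict_of_agreeOn (hpA (projLam h N) ▸ S.agreeOn_A a h N) hw
  · exact restrict_of_agreeOn (hpB (projLam h N) ▸ S.agreeOn_B h N) hw

theorem eq_zero_of_mem_boundaryNodes {N : Fin n → ℕ} {w : MeshFn n} (hw : w ∈ Hh N) :
    ∀ k ∈ boundaryNodes N, w k = 0 := fun k hk => hw k (Finset.mem_sdiff.mp hk).2

/-- The lower bound for the norm generated by `A_h`. -/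
theorem CompactScheme.normOp_A_ge (S : CompactScheme n) (hn : 1 ≤ n) {a h : Fin n → ℝ}
    {N : Fin n → ℕ} (ha : ∀ i, 0 < a i) (hh : ∀ i, 0 < h i) {ε2 : ℝ} (hε : S.AdmissibleEps ε2)
    {w : MeshFn n} (hw : w ∈ Hh N) :
    Real.sqrt ε2 * (⨅ i, a i) * (2 / 3 : ℝ) ^ (((n : ℝ) - 1) / 2) * normOp h N (-lapH h) w
      ≤ normOp h N (S.A a h) w := by
  obtain ⟨m, b, x, A, B, D, hx, hA, -, hD, hr⟩ := S.exists_diagonalization a h N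
  obtain ⟨hr1, -, hr2⟩ := hr w (eq_zero_of_mem_boundaryNodes hw)
  have : Nonempty (Fin n) := ⟨⟨0, hn⟩⟩
  set c := ⨅ i, a i
  have hc : ∀ i, c ≤ a i := fun i => ciInf_le (Set.finite_range a).bddBelow i
  have hc0 : 0 ≤ c := Real.iInf_nonneg fun i => (ha i).le
  have hε0 : 0 ≤ ε2 := by
    cases S with
    | first => exact (show ε2 = 1 from hε) ▸ zero_le_one
    | second => exact (show 0 < ε2 ∧ _ from hε).1.le
    | third => exact (show ε2 = 1 from hε) ▸ zero_le_one
  have hP : 0 ≤ ∏ i, h i := Finset.prod_nonneg fun i _ => (hh i).le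
  have h23 : ((2 / 3 : ℝ) ^ (((n : ℝ) - 1) / 2)) ^ 2 = (2 / 3 : ℝ) ^ (n - 1) := by
    rw [← Real.rpow_natCast, ← Real.rpow_mul (by norm_num), ← Real.rpow_natCast, Nat.cast_sub hn]
    congr 1
    push_cast
    ring
  have hq : 0 ≤ Real.sqrt ε2 * c * (2 / 3 : ℝ) ^ (((n : ℝ) - 1) / 2) := by positivity
  rw [normOp, normOp, ← Real.sqrt_sq hq, ← Real.sqrt_mul (sq_nonneg _)]
  apply Real.sqrt_le_sqrt
  rw [mul_pow, mul_pow, Real.sq_sqrt hε0, h23, innerH_eq, innerH_eq, hr1, hr2,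
    inner_apply_of_diag b hA, inner_apply_of_diag b hD, mul_left_comm]
  refine mul_le_mul_of_nonneg_left ?_ hP
  rw [Finset.mul_sum]
  refine Finset.sum_le_sum fun j _ => ?_
  rw [← mul_assoc]
  exact mul_le_mul_of_nonneg_right (S.le_polyA hh (hx j) hε hc0 hc) (mul_self_nonneg _)

/-! ### Operator inequalities as inequalities between eigenvalues -/

section Stability

variable (S : CompactScheme n) {a h : Fin n → ℝ} {N : Fin n → ℕ}

theorem innerH_extend (h : Fin n → ℝ) {F : MeshOp n} {G : InnerSpace N →ₗ[ℝ] InnerSpace N}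
    (hFG : ∀ w : MeshFn n, (∀ k ∈ boundaryNodes N, w k = 0) →
      restrict N (F w) = G (restrict N w)) {v : InnerSpace N} (hv : ‖v‖ = 1) {c : ℝ}
    (hG : G v = c • v) :
    innerH h N (F (extend N v)) (extend N v) = (∏ i, h i) * c := by
  rw [innerH_eq, hFG _ (eq_zero_of_mem_boundaryNodes (extend_mem_Hh N v)), restrict_extend, hG,
    inner_smul_left, real_inner_self_eq_norm_sq, hv]
  simp

theorem innerH_smul_left (h : Fin n → ℝ) (N : Fin n → ℕ) (c : ℝ) (v w : MeshFn n) :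
    innerH h N (c • v) w = c * innerH h N v w := by
  rw [innerH_eq, innerH_eq, map_smul, inner_smul_left]
  simp [mul_left_comm]

theorem innerH_extend_self (h : Fin n → ℝ) {v : InnerSpace N} (hv : ‖v‖ = 1) :
    innerH h N (extend N v) (extend N v) = ∏ i, h i := by
  rw [innerH_eq, restrict_extend, real_inner_self_eq_norm_sq, hv]
  simp

/-- The positivity and stability conditions in terms of the eigenvalues. -/
theorem CompactScheme.Stable.eigenvalues {S : CompactScheme n} (hh : ∀ i, 0 < h i)
    {τ ε r : ℝ} (hst : S.Stable a h N τ ε r) {m : ℕ}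
    {b : OrthonormalBasis (Fin m) ℝ (InnerSpace N)} {x : Fin m → Fin n → ℝ}
    {A B : InnerSpace N →ₗ[ℝ] InnerSpace N} (hx : ∀ j i, -(4 / h i ^ 2) ≤ x j i ∧ x j i ≤ 0)
    (hA : ∀ j, A (b j) = S.polyA a h (x j) • b j) (hB : ∀ j, B (b j) = S.polyB h (x j) • b j)
    (hAr : ∀ w : MeshFn n, (∀ k ∈ boundaryNodes N, w k = 0) →
      restrict N (S.A a h w) = A (restrict N w))
    (hBr : ∀ w : MeshFn n, (∀ k ∈ boundaryNodes N, w k = 0) →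
      restrict N (S.B h w) = B (restrict N w)) (hβ : ∀ j, 0 ≤ S.polyB h (x j)) (j : Fin m) :
    0 ≤ S.polyA a h (x j) ∧
      1 / 6 * τ ^ 2 * S.polyA a h (x j) ≤ (1 - ε ^ 2) * r * S.polyB h (x j) := by
  have hP : 0 < ∏ i, h i := Finset.prod_pos fun i _ => hh i
  have hne : extend N (b j) ≠ 0 := by
    intro h0
    have := restrict_extend N (b j)
    rw [h0, map_zero] at this
    have h1 := b.norm_eq_one j
    rw [← this] at h1
    simp at h1
  have hIA := innerH_extend h hAr (b.norm_eq_one j) (hA j)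
  have hIB := innerH_extend h hBr (b.norm_eq_one j) (hB j)
  have hmem := extend_mem_Hh N (b j)
  -- The form inequalities are tested on the zero extension of the eigenvector `b j`, where each
  -- form equals its eigenvalue times `∏ h i`.
  have main : PosOp h N (S.A a h) → (∃ α : ℝ, LeOp h N (S.A a h) (α ^ 2 • S.B h) ∧
      1 / 6 * τ ^ 2 * α ^ 2 ≤ (1 - ε ^ 2) * r) → 0 ≤ S.polyA a h (x j) ∧
      1 / 6 * τ ^ 2 * S.polyA a h (x j) ≤ (1 - ε ^ 2) * r * S.polyB h (x j) := by
    rintro hpos ⟨α, hle, hα⟩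
    have h1 := hpos _ hmem hne
    have h2 := hle _ hmem
    rw [LinearMap.smul_apply, innerH_smul_left, hIB, hIA, mul_left_comm] at h2
    rw [hIA] at h1
    have h3 := le_of_mul_le_mul_left h2 hP
    refine ⟨(pos_of_mul_pos_right h1 hP.le).le, ?_⟩
    calc 1 / 6 * τ ^ 2 * S.polyA a h (x j) ≤ 1 / 6 * τ ^ 2 * (α ^ 2 * S.polyB h (x j)) := by
          gcongr
      _ = 1 / 6 * τ ^ 2 * α ^ 2 * S.polyB h (x j) := by ring
      _ ≤ _ := mul_le_mul_of_nonneg_right hα (hβ j)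
  cases S with
  | first => exact main hst.2.1 hst.2.2
  | second => exact main hst.2.1 hst.2.2
  | third => exact third_stable hh (hx j) hst

theorem normH_eq (h : Fin n → ℝ) (N : Fin n → ℕ) (w : MeshFn n) :
    normH h N w = √(∏ i, h i) * ‖restrict N w‖ := by
  rw [normH, innerH_eq, real_inner_self_eq_norm_sq, Real.sqrt_mul' _ (sq_nonneg _),
    Real.sqrt_sq (norm_nonneg _)]

end Stability

end Spectral

open scoped InnerProductSpace

/-! ### Stability of the schemes -/

section MeshStability

variable {n : ℕ}

/-- Multiplication by a mesh function. -/
noncomputable def mulOp (N : Fin n → ℕ) (q : MeshFn n) : InnerSpace N →ₗ[ℝ] InnerSpace N where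
  toFun v := WithLp.toLp 2 fun k => q k * v k
  map_add' v w := by
    ext k
    simp [mul_add]
  map_smul' c v := by
    ext k
    simp [mul_left_comm]

theorem mulOp_apply (N : Fin n → ℕ) (q : MeshFn n) (v : InnerSpace N) (k : innerNodes N) :
    mulOp N q v k = q k * v k := rfl

theorem restrict_mul (N : Fin n → ℕ) (q w : MeshFn n) :
    restrict N (q * w) = mulOp N q (restrict N w) := rfl

theorem isSymmetric_mulOp (N : Fin n → ℕ) (q : MeshFn n) : (mulOp N q).IsSymmetric := by
  intro v w
  simp only [PiLp.inner_apply, mulOp_apply]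
  exact Finset.sum_congr rfl fun k _ => by simp; ring

theorem inner_mulOp_self (N : Fin n → ℕ) (q : MeshFn n) (v : InnerSpace N) :
    ⟪mulOp N q v, v⟫_ℝ = ∑ k : innerNodes N, q k * v k ^ 2 := by
  simp only [PiLp.inner_apply, mulOp_apply]
  exact Finset.sum_congr rfl fun k _ => by simp; ring

theorem le_inner_mulOp {N : Fin n → ℕ} {q : MeshFn n} {r : ℝ} (hq : ∀ k ∈ innerNodes N, r ≤ q k)
    (v : InnerSpace N) : r * ‖v‖ ^ 2 ≤ ⟪mulOp N q v, v⟫_ℝ := by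
  rw [inner_mulOp_self, EuclideanSpace.norm_sq_eq, Finset.mul_sum]
  refine Finset.sum_le_sum fun k _ => ?_
  rw [Real.norm_eq_abs, sq_abs]
  exact mul_le_mul_of_nonneg_right (hq k k.2) (sq_nonneg _)

theorem norm_restrict_sqrt_mul {N : Fin n → ℕ} {q : MeshFn n} (hq : ∀ k ∈ innerNodes N, 0 ≤ q k)
    (w : MeshFn n) :
    ‖restrict N fun k => √(q k) * w k‖ = √⟪mulOp N q (restrict N w), restrict N w⟫_ℝ := by
  rw [inner_mulOp_self, EuclideanSpace.norm_eq]
  congr 1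
  refine Finset.sum_congr rfl fun k _ => ?_
  rw [restrict_apply, restrict_apply, Real.norm_eq_abs, sq_abs, mul_pow, Real.sq_sqrt (hq k k.2)]

/-- There are at most `∏ N_i` inner nodes, each of weight `∏ h_i`, so their total mass is at most
the volume of `Ω`. Uniform bounds thus become mesh norm bounds with a constant independent of the
mesh. -/
theorem sqrt_prod_mul_norm_restrict_le {X h : Fin n → ℝ} {N : Fin n → ℕ} (hX : ∀ i, 0 < X i)
    (hN : ∀ i, 1 ≤ N i) (hh : ∀ i, h i = X i / N i) {w : MeshFn n} {Ψ : ℝ} (hΨ : 0 ≤ Ψ)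
    (hw : ∀ k ∈ innerNodes N, |w k| ≤ Ψ) :
    √(∏ i, h i) * ‖restrict N w‖ ≤ √(∏ i, X i) * Ψ := by
  have hNp : ∀ i, (0 : ℝ) < N i := fun i => by exact_mod_cast hN i
  have hcard : ((innerNodes N).card : ℝ) ≤ ∏ i, (N i : ℝ) := by
    rw [innerNodes, Fintype.card_piFinset]
    push_cast
    refine Finset.prod_le_prod (fun _ _ => Nat.cast_nonneg _) fun i _ => ?_
    rw [Int.card_Icc]
    have : ((N i : ℤ) - 1 + 1 - 1).toNat ≤ N i := by omega
    exact_mod_cast this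
  have h1 : ‖restrict N w‖ ≤ √((innerNodes N).card) * Ψ := by
    rw [EuclideanSpace.norm_eq, ← Real.sqrt_sq hΨ, ← Real.sqrt_mul (Nat.cast_nonneg _)]
    apply Real.sqrt_le_sqrt
    calc _ ≤ ∑ _k : innerNodes N, Ψ ^ 2 := Finset.sum_le_sum fun k _ => by
          rw [restrict_apply, Real.norm_eq_abs]
          exact pow_le_pow_left₀ (abs_nonneg _) (hw k k.2) 2
      _ = _ := by simp
  have hP : 0 ≤ ∏ i, h i := Finset.prod_nonneg fun i _ => by
    rw [hh]; exact (div_pos (hX i) (hNp i)).le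
  refine (mul_le_mul_of_nonneg_left h1 (Real.sqrt_nonneg _)).trans ?_
  rw [← mul_assoc, ← Real.sqrt_mul hP]
  refine mul_le_mul_of_nonneg_right (Real.sqrt_le_sqrt ?_) hΨ
  have h2 : (∏ i, h i) * ∏ i, (N i : ℝ) = ∏ i, X i := by
    rw [← Finset.prod_mul_distrib]
    exact Finset.prod_congr rfl fun i _ => by rw [hh, div_mul_cancel₀ _ (hNp i).ne']
  rw [← h2]
  exact mul_le_mul_of_nonneg_left hcard hP

/-- `stability_of_common_eigenbasis` on the space of functions on the inner nodes. The bounds on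
`B_h` are read off on eigenvectors, and `√(∏ h i)` converts Euclidean norms into mesh norms at the
beginning and at the end. -/
theorem mesh_stability (S : CompactScheme n) {a X h : Fin n → ℝ} {N : Fin n → ℕ}
    (hX : ∀ i, 0 < X i) (hN : ∀ i, 1 ≤ N i) (hh : ∀ i, h i = X i / N i) {τ ε r ν0 ν Ψ T : ℝ}
    (hτ : 0 < τ) (hε : 0 < ε) (hε1 : ε < 1) (hr : 0 < r) (hν0 : 0 < ν0) (hν : 0 ≤ ν)
    {M : ℕ} (hM : 2 ≤ M) (hT : M * τ = T) (hst : S.Stable a h N τ ε r)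
    (hB1 : LeOp h N (ν0 • (1 : MeshOp n)) (S.B h)) (hB2 : LeOp h N (S.B h) (ν • (1 : MeshOp n)))
    {q : MeshFn n} (hq : ∀ k ∈ innerNodes N, r ≤ q k) {e ψ : ℕ → MeshFn n}
    (hbd : ∀ m ≤ M, ∀ k ∈ boundaryNodes N, e m k = 0) (he0 : ∀ k ∈ innerNodes N, e 0 k = 0)
    (hmain : ∀ m, 1 ≤ m → m ≤ M - 1 → ∀ k ∈ innerNodes N,
      S.B h (q * lamT τ e m) k + 1 / 12 * τ ^ 2 * S.A a h (lamT τ e m) k + S.A a h (e m) k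
        = ψ m k)
    (hfirst : ∀ k ∈ innerNodes N, S.B h (q * deltaFwd τ e 0) k
      + 1 / 12 * τ ^ 2 * S.A a h (deltaFwd τ e 0) k + 1 / 2 * τ * S.A a h (e 0) k = ψ 0 k)
    (hψ : ∀ m < M, ∀ k ∈ innerNodes N, |ψ m k| ≤ Ψ) (hΨ : 0 ≤ Ψ) :
    ∀ m, 1 ≤ m → m ≤ M →
      ε * normH h N (fun k => √(q k) * deltaBar τ e m k) + normOp h N (S.A a h) (sBar e m)
        ≤ (1 + √ν) * (√(∏ i, X i) * Ψ / ν0 / (ε * √r) * (1 + T)) := by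
  have hhp : ∀ i, 0 < h i := fun i => by
    rw [hh]; exact div_pos (hX i) (by exact_mod_cast hN i)
  have hP : 0 < ∏ i, h i := Finset.prod_pos fun i _ => hhp i
  obtain ⟨d, b, x, A, B, D, hx, hA, hB, -, hr0⟩ := S.exists_diagonalization a h N
  have hAr := fun w hw => (hr0 w hw).1
  have hBr := fun w hw => (hr0 w hw).2.1
  have hβ : ∀ j, ν0 ≤ S.polyB h (x j) ∧ S.polyB h (x j) ≤ ν := by
    intro j
    have hI := innerH_extend h hBr (b.norm_eq_one j) (hB j)
    have h1 := hB1 _ (extend_mem_Hh N (b j))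
    have h2 := hB2 _ (extend_mem_Hh N (b j))
    rw [LinearMap.smul_apply, innerH_smul_left, Module.End.one_apply,
      innerH_extend_self h (b.norm_eq_one j), hI, mul_comm] at h1 h2
    refine ⟨le_of_mul_le_mul_left h1 hP, ?_⟩
    rw [mul_comm, mul_comm ν] at h2
    exact le_of_mul_le_mul_left h2 hP
  have hα := hst.eigenvalues hhp hx hA hB hAr hBr fun j => hν0.le.trans (hβ j).1
  set y : ℕ → InnerSpace N := fun m => restrict N (e m) with hy
  have hlam : ∀ m, restrict N (lamT τ e m)
      = (1 / τ ^ 2) • (y (m + 1) - (2 : ℝ) • y m + y (m - 1)) := fun m => by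
    ext k
    simp [hy, restrict_apply, lamT, div_eq_inv_mul]
    ring
  have hdel : ∀ m, restrict N (deltaFwd τ e m) = (1 / τ) • (y (m + 1) - y m) := fun m => by
    ext k
    simp [hy, restrict_apply, deltaFwd, div_eq_inv_mul]
  have hbar : ∀ m, restrict N (deltaBar τ e m) = (1 / τ) • (y m - y (m - 1)) := fun m => by
    ext k
    simp [hy, restrict_apply, deltaBar, div_eq_inv_mul]
  have hsb : ∀ m, restrict N (sBar e m) = (1 / 2 : ℝ) • (y (m - 1) + y m) := fun m => by
    ext k
    simp [hy, restrict_apply, sBar, div_eq_inv_mul]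
    ring
  have hy0 : y 0 = 0 := by
    ext k
    exact he0 k k.2
  have bl : ∀ m, 1 ≤ m → m < M → ∀ k ∈ boundaryNodes N, lamT τ e m k = 0 := fun m h1 h2 k hk => by
    simp [lamT, hbd (m + 1) (by omega) k hk, hbd m (by omega) k hk, hbd (m - 1) (by omega) k hk]
  have bd : ∀ k ∈ boundaryNodes N, deltaFwd τ e 0 k = 0 := fun k hk => by
    simp [deltaFwd, hbd 1 (by omega) k hk, hbd 0 (by omega) k hk]
  have mainE : ∀ m, 1 ≤ m → m < M →
      B (mulOp N q ((1 / τ ^ 2) • (y (m + 1) - (2 : ℝ) • y m + y (m - 1))))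
      + (1 / 12 * τ ^ 2) • A ((1 / τ ^ 2) • (y (m + 1) - (2 : ℝ) • y m + y (m - 1))) + A (y m)
        = restrict N (ψ m) := by
    intro m h1 h2
    rw [← hlam, ← restrict_mul, ← hBr _ fun k hk => by simp [bl m h1 h2 k hk],
      ← hAr _ (bl m h1 h2), hy, ← hAr _ (hbd m h2.le), ← map_smul (restrict N), ← map_add, ← map_add]
    exact restrict_congr fun k hk => hmain m h1 (by omega) k hk
  have firstE : B (mulOp N q ((1 / τ) • (y 1 - y 0))) + (1 / 12 * τ ^ 2) • A ((1 / τ) • (y 1 - y 0))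
      = restrict N (ψ 0) := by
    -- The term `(h_t/2) A_h v⁰` of the first step is missing from the abstract estimate, because
    -- the error vanishes at the initial level.
    have h0 : (1 / 2 * τ) • A (y 0) = 0 := by rw [hy0, map_zero, smul_zero]
    rw [← add_zero (B _ + _), ← h0, ← hdel 0, ← restrict_mul,
      ← hBr _ fun k hk => by simp [bd k hk], ← hAr _ bd, hy,
      ← hAr _ (hbd 0 (by omega)), ← map_smul (restrict N), ← map_smul (restrict N), ← map_add, ← map_add]
    exact restrict_congr fun k hk => hfirst k hk
  have hsP : 0 < √(∏ i, h i) := Real.sqrt_pos.mpr hP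
  have hψE : ∀ m < M, ‖restrict N (ψ m)‖ ≤ √(∏ i, X i) * Ψ / √(∏ i, h i) := by
    intro m hm
    rw [le_div_iff₀ hsP, mul_comm]
    exact sqrt_prod_mul_norm_restrict_le hX hN hh hΨ (hψ m hm)
  have key := stability_of_common_eigenbasis b hA hB (isSymmetric_mulOp N q) hτ hε hr hν0 hν
    (fun j => (hα j).1) (fun j => (hβ j).1) (fun j => (hβ j).2) (fun j => (hα j).2) hε1
    (le_inner_mulOp hq) hy0 mainE firstE hψE
  intro m h1 h2
  have k1 := mul_le_mul_of_nonneg_left (key m h1 h2) hsP.le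
  have n1 : normH h N (fun k => √(q k) * deltaBar τ e m k)
      = √(∏ i, h i) * √⟪mulOp N q ((1 / τ) • (y m - y (m - 1))), (1 / τ) • (y m - y (m - 1))⟫_ℝ := by
    rw [normH_eq, norm_restrict_sqrt_mul fun k hk => hr.le.trans (hq k hk), hbar]
  have n2 : normOp h N (S.A a h) (sBar e m) = √(∏ i, h i) *
      √⟪A ((1 / 2 : ℝ) • (y (m - 1) + y m)), (1 / 2 : ℝ) • (y (m - 1) + y m)⟫_ℝ := by
    rw [normOp, innerH_eq, hAr _ fun k hk => by
      simp [sBar, hbd m h2 k hk, hbd (m - 1) (by omega) k hk], hsb, Real.sqrt_mul hP.le]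
  rw [n1, n2]
  calc _ = √(∏ i, h i) * (ε * √⟪mulOp N q ((1 / τ) • (y m - y (m - 1))),
        (1 / τ) • (y m - y (m - 1))⟫_ℝ + √⟪A ((1 / 2 : ℝ) • (y (m - 1) + y m)),
        (1 / 2 : ℝ) • (y (m - 1) + y m)⟫_ℝ) := by ring
    _ ≤ _ := k1
    _ = (1 + √ν) * (√(∏ i, X i) * Ψ / ν0 / (ε * √r) * (1 + m * τ)) := by
      field_simp
    _ ≤ _ := by
      have : (m : ℝ) * τ ≤ T := by
        rw [← hT]
        exact mul_le_mul_of_nonneg_right (by exact_mod_cast h2) hτ.le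
      gcongr

end MeshStability

/-! ### The operators of the schemes as perturbations of `s_N` and `A_N` -/

section Remainders

variable {n : ℕ}

/-- Nodes of the closed mesh that are inner in the directions from `J`. -/
def InnerOn (N : Fin n → ℕ) (J : Set (Fin n)) (k : Fin n → ℤ) : Prop :=
  k ∈ closedNodes N ∧ ∀ i ∈ J, InnerDir N i k

theorem InnerOn.mono {N : Fin n → ℕ} {J J' : Set (Fin n)} (hJ : J' ⊆ J) {k : Fin n → ℤ}
    (hk : InnerOn N J k) : InnerOn N J' k := ⟨hk.1, fun i hi => hk.2 i (hJ hi)⟩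

theorem InnerOn.add_single {N : Fin n → ℕ} {J : Set (Fin n)} {k : Fin n → ℤ} {m : Fin n}
    (hk : InnerOn N J k) (hm : InnerDir N m k) (hmJ : m ∉ J) :
    InnerOn N J (k + Pi.single m 1) :=
  ⟨add_single_mem_closedNodes hk.1 hm, fun i hi =>
    (innerDir_add_single (ne_of_mem_of_not_mem hi hmJ) k 1).mpr (hk.2 i hi)⟩

theorem InnerOn.sub_single {N : Fin n → ℕ} {J : Set (Fin n)} {k : Fin n → ℤ} {m : Fin n}
    (hk : InnerOn N J k) (hm : InnerDir N m k) (hmJ : m ∉ J) :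
    InnerOn N J (k - Pi.single m 1) :=
  ⟨sub_single_mem_closedNodes hk.1 hm, fun i hi =>
    (innerDir_sub_single (ne_of_mem_of_not_mem hi hmJ) k 1).mpr (hk.2 i hi)⟩

theorem innerOn_of_mem_innerNodes {N : Fin n → ℕ} {k : Fin n → ℤ} (hk : k ∈ innerNodes N)
    (J : Set (Fin n)) : InnerOn N J k :=
  ⟨innerNodes_subset_closedNodes N hk, fun i _ => mem_innerNodes.mp hk i⟩

/-- The operator `h_i² Λ_i / 12`. -/
noncomputable def scaledLam (h : Fin n → ℝ) (i : Fin n) : MeshOp n := (1 / 12 * h i ^ 2 : ℝ) • lam h i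

theorem scaledLam_apply (h : Fin n → ℝ) (i : Fin n) (w : MeshFn n) (k : Fin n → ℤ) :
    scaledLam h i w k = 1 / 12 * h i ^ 2 * lam h i w k := rfl

theorem scaledLam_apply_eq {h : Fin n → ℝ} {i : Fin n} (hi : h i ≠ 0) (w : MeshFn n)
    (k : Fin n → ℤ) : scaledLam h i w k
      = (w (k + Pi.single i 1) - 2 * w k + w (k - Pi.single i 1)) / 12 := by
  rw [scaledLam_apply, lam_apply]
  field_simp

/-- The weights of `h_i² Λ_i / 12` have absolute sum `4/12`, and `1 + h_i² Λ_i / 12` has the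
nonnegative weights `1/12, 10/12, 1/12` of an average. Extra factors of either kind therefore never
enlarge a bound and require no smoothness. -/
theorem abs_scaledLam_le {h : Fin n → ℝ} {i : Fin n} (hi : h i ≠ 0) {N : Fin n → ℕ}
    {J : Set (Fin n)} {w : MeshFn n} {D : ℝ} (hw : ∀ k, InnerOn N J k → |w k| ≤ D) (hiJ : i ∉ J)
    {k : Fin n → ℤ} (hk : InnerOn N J k) (hki : InnerDir N i k) :
    |scaledLam h i w k| ≤ D / 3 ∧ |w k + scaledLam h i w k| ≤ D := by
  have h0 := abs_le.mp (hw k hk)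
  have h1 := abs_le.mp (hw _ (hk.add_single hki hiJ))
  have h2 := abs_le.mp (hw _ (hk.sub_single hki hiJ))
  rw [scaledLam_apply_eq hi, abs_le, abs_le]
  refine ⟨⟨?_, ?_⟩, ⟨?_, ?_⟩⟩ <;> linarith [h0.1, h0.2, h1.1, h1.2, h2.1, h2.2]

theorem lam_comm (h : Fin n → ℝ) (i j : Fin n) (w : MeshFn n) :
    lam h i (lam h j w) = lam h j (lam h i w) := by
  funext k
  simp only [lam_apply]
  rw [add_right_comm k, sub_add_eq_add_sub k, sub_add_eq_add_sub k, sub_right_comm k]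
  ring

theorem polySk_lam (h : Fin n → ℝ) (i : Fin n) : polySk h (lam h) i = 1 + scaledLam h i := rfl

/-- What remains of the product after its constant and linear terms contains at least two scaled
differences. When a factor `1 + s_m` is added, the old remainder is averaged by it, which preserves
its bound, and the terms `s_m s_i` contribute at most `l.length * D`. The count closes by `l² + l ≤
(l + 1)²`. -/
theorem abs_list_prod_sub_le {h : Fin n → ℝ} (hh : ∀ i, h i ≠ 0) {N : Fin n → ℕ}
    {J : Set (Fin n)} {l : List (Fin n)} (hl : l.Nodup) (hJ : ∀ i ∈ l, i ∉ J) {w : MeshFn n} {D : ℝ}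
    (hD : 0 ≤ D) (hw : ∀ i ∈ l, ∀ j ∈ l, i ≠ j → ∀ k, InnerOn N (J ∪ {i, j}) k →
      |scaledLam h i (scaledLam h j w) k| ≤ D) :
    ∀ k, InnerOn N (J ∪ {i | i ∈ l}) k →
      |((l.map (polySk h (lam h))).prod w - w - (l.map fun i => scaledLam h i w).sum) k|
        ≤ (l.length : ℝ) ^ 2 * D := by
  induction l with
  | nil => intro k _; simp
  | cons m l ih =>
    rw [List.nodup_cons] at hl
    have ih := ih hl.2 (fun i hi => hJ i (List.mem_cons_of_mem _ hi))
      (fun i hi j hj => hw i (List.mem_cons_of_mem _ hi) j (List.mem_cons_of_mem _ hj))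
    intro k hk
    set q : MeshFn n := (l.map (polySk h (lam h))).prod w - w
      - (l.map fun i => scaledLam h i w).sum with hq
    have hmJ : m ∉ J ∪ {i | i ∈ l} := fun hm => hm.elim (hJ m List.mem_cons_self) hl.1
    have hkm : InnerDir N m k := hk.2 m (Or.inr List.mem_cons_self)
    have hk' : InnerOn N (J ∪ {i | i ∈ l}) k := hk.mono fun i hi =>
      hi.imp id fun h => List.mem_cons_of_mem _ h
    have hsum : |scaledLam h m (l.map fun i => scaledLam h i w).sum k| ≤ l.length * D := by
      have : ∀ l' : List (Fin n), l' ⊆ l →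
          |scaledLam h m (l'.map fun i => scaledLam h i w).sum k| ≤ l'.length * D := by
        intro l'
        induction l' with
        | nil => intro _; simp
        | cons j l' ih' =>
          intro hs
          have hj := hs List.mem_cons_self
          have hjm : m ≠ j := fun h => hl.1 (h ▸ hj)
          have h1 := hw m List.mem_cons_self j (List.mem_cons_of_mem _ hj) hjm k
            (hk.mono fun i hi => hi.imp id (by
              rintro (h | h)
              · exact h ▸ List.mem_cons_self
              · exact (Set.mem_singleton_iff.mp h) ▸ List.mem_cons_of_mem _ hj))
          have h2 := ih' fun i hi => hs (List.mem_cons_of_mem _ hi)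
          simp only [List.map_cons, List.sum_cons, map_add, Pi.add_apply, List.length_cons]
          refine (abs_add_le _ _).trans ?_
          push_cast
          linarith
      exact this l fun _ h => h
    have hqk := (abs_scaledLam_le (hh m) ih hmJ hk' hkm).2
    have hdec : (((m :: l).map (polySk h (lam h))).prod w - w
        - ((m :: l).map fun i => scaledLam h i w).sum) k
        = (q k + scaledLam h m q k) + scaledLam h m (l.map fun i => scaledLam h i w).sum k := by
      simp only [List.map_cons, List.prod_cons, List.sum_cons, Module.End.mul_apply, polySk_lam,
        hq, map_sub, LinearMap.add_apply, Module.End.one_apply, Pi.sub_apply, Pi.add_apply]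
      ring
    rw [hdec]
    refine (abs_add_le _ _).trans ((add_le_add hqk hsum).trans ?_)
    simp only [List.length_cons]
    push_cast
    nlinarith [mul_nonneg (Nat.cast_nonneg (α := ℝ) l.length) hD]

theorem sN_apply (h : Fin n → ℝ) (w : MeshFn n) :
    sN h w = w + ∑ i, scaledLam h i w := by
  simp [sN, scaledLam, Finset.smul_sum, smul_smul]

theorem sNhat_apply (h : Fin n → ℝ) (j : Fin n) (w : MeshFn n) :
    sNhat h j w = w + ∑ i ∈ Finset.univ.erase j, scaledLam h i w := by
  simp only [sNhat, scaledLam, LinearMap.add_apply, Module.End.one_apply, LinearMap.smul_apply,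
    LinearMap.sum_apply, Finset.smul_sum, smul_smul]

theorem AN_apply (a h : Fin n → ℝ) (w : MeshFn n) (k : Fin n → ℤ) :
    AN a h w k = -∑ i, a i ^ 2 * (lam h i w k
      + ∑ j ∈ Finset.univ.erase i, scaledLam h j (lam h i w) k) := by
  simp only [AN, sNhat_apply, Module.End.mul_apply, LinearMap.neg_apply, LinearMap.sum_apply,
    LinearMap.smul_apply, Pi.neg_apply, Finset.sum_apply, Pi.smul_apply, Pi.add_apply,
    smul_eq_mul]

theorem list_filter_map_sum (f : Fin n → MeshFn n) (i : Fin n) :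
    (((List.finRange n).filter (fun k => k ≠ i)).map f).sum = ∑ k ∈ Finset.univ.erase i, f k := by
  rw [← List.sum_toFinset _ ((List.nodup_finRange n).filter _)]
  congr 1
  ext k
  simp

/-- `B_h = s_N` up to terms of the form `(h_i² Λ_i / 12) (h_j² Λ_j / 12)`. -/
theorem CompactScheme.exists_abs_B_sub_le (S : CompactScheme n) :
    ∃ c : ℝ, 0 ≤ c ∧ ∀ (h : Fin n → ℝ) (N : Fin n → ℕ) (w : MeshFn n) (D : ℝ), (∀ i, h i ≠ 0) →
      0 ≤ D → (∀ i j, i ≠ j → ∀ k, InnerOn N {i, j} k →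
        |scaledLam h i (scaledLam h j w) k| ≤ D) →
      ∀ k ∈ innerNodes N, |S.B h w k - sN h w k| ≤ c * D := by
  cases S with
  | first β =>
    refine ⟨|β|, abs_nonneg _, fun h N w D hh hD hw k hk => ?_⟩
    have h1 := hw 0 1 (by decide) k (innerOn_of_mem_innerNodes hk _)
    have : (CompactScheme.first β).B h w k - sN h w k
        = β * scaledLam h 0 (scaledLam h 1 w) k := by
      simp [B, sNbeta, scaledLam, Module.End.mul_apply]
      ring
    rw [this, abs_mul]
    exact mul_le_mul_of_nonneg_left h1 (abs_nonneg _)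
  | second β γ θ =>
    refine ⟨3 * |β| + |γ|, by positivity, fun h N w D hh hD hw k hk => ?_⟩
    have h1 := hw 0 1 (by decide) k (innerOn_of_mem_innerNodes hk _)
    have h2 := hw 0 2 (by decide) k (innerOn_of_mem_innerNodes hk _)
    have h3 := hw 1 2 (by decide) k (innerOn_of_mem_innerNodes hk _)
    -- The triple product is a scaled difference of an already bounded double product, hence obeys
    -- the same bound.
    have h4 := (abs_scaledLam_le (hh 0) (hw 1 2 (by decide)) (by simp)
      (innerOn_of_mem_innerNodes hk _) (mem_innerNodes.mp hk 0)).1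
    have : (CompactScheme.second β γ θ).B h w k - sN h w k
        = β * (scaledLam h 0 (scaledLam h 1 w) k + scaledLam h 0 (scaledLam h 2 w) k
          + scaledLam h 1 (scaledLam h 2 w) k)
          + γ * scaledLam h 0 (scaledLam h 1 (scaledLam h 2 w)) k := by
      simp [B, sNbetagamma, sbarN2, sbarN3, scaledLam, Module.End.mul_apply]
      ring
    rw [this]
    refine (abs_add_le _ _).trans ?_
    rw [abs_mul, abs_mul, add_mul]
    have h5 : |scaledLam h 0 (scaledLam h 1 w) k + scaledLam h 0 (scaledLam h 2 w) k
          + scaledLam h 1 (scaledLam h 2 w) k| ≤ 3 * D := by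
      refine (abs_add_three _ _ _).trans ?_
      linarith
    have h6 := mul_le_mul_of_nonneg_left h5 (abs_nonneg β)
    have h7 := mul_le_mul_of_nonneg_left (h4.trans (by linarith : D / 3 ≤ D)) (abs_nonneg γ)
    linarith
  | third =>
    refine ⟨(n : ℝ) ^ 2, by positivity, fun h N w D hh hD hw k hk => ?_⟩
    have h1 := abs_list_prod_sub_le hh (J := ∅) (N := N) (List.nodup_finRange n) (by simp) hD
      (fun i _ j _ hij k hk => hw i j hij k (by simpa using hk)) k (innerOn_of_mem_innerNodes hk _)
    rw [← Fin.sum_univ_def, List.length_finRange] at h1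
    rw [(CompactScheme.third n).B_eq_polyB, sN_apply]
    simp only [polyB]
    convert h1 using 2
    simp only [Pi.sub_apply, Pi.add_apply]
    ring

/-- `A_h = A_N` up to terms of the form `(h_i² Λ_i / 12) (h_j² Λ_j / 12) Λ_l`. -/
theorem CompactScheme.exists_abs_A_sub_le (S : CompactScheme n) (a : Fin n → ℝ) :
    ∃ c : ℝ, 0 ≤ c ∧ ∀ (h : Fin n → ℝ) (N : Fin n → ℕ) (w : MeshFn n) (D : ℝ), (∀ i, h i ≠ 0) →
      0 ≤ D → (∀ i j l, i ≠ j → i ≠ l → j ≠ l → ∀ k, InnerOn N {l, i, j} k →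
        |scaledLam h i (scaledLam h j (lam h l w)) k| ≤ D) →
      ∀ k ∈ innerNodes N, |S.A a h w k - AN a h w k| ≤ c * D := by
  cases S with
  | first β =>
    refine ⟨0, le_rfl, fun h N w D hh hD hw k hk => ?_⟩
    simp [A]
  | second β γ θ =>
    refine ⟨|θ| * (a 0 ^ 2 + a 1 ^ 2 + a 2 ^ 2), by positivity, fun h N w D hh hD hw k hk => ?_⟩
    have h1 := hw 1 2 0 (by decide) (by decide) (by decide) k (innerOn_of_mem_innerNodes hk _)
    have h2 := hw 0 2 1 (by decide) (by decide) (by decide) k (innerOn_of_mem_innerNodes hk _)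
    have h3 := hw 0 1 2 (by decide) (by decide) (by decide) k (innerOn_of_mem_innerNodes hk _)
    have e1 : lam h 1 (lam h 2 (lam h 0 w)) = lam h 0 (lam h 1 (lam h 2 w)) := by
      rw [lam_comm h 2 0, lam_comm h 1 0]
    have e2 : lam h 0 (lam h 2 (lam h 1 w)) = lam h 0 (lam h 1 (lam h 2 w)) := by
      rw [lam_comm h 2 1]
    have : (CompactScheme.second β γ θ).A a h w k - AN a h w k
        = -θ * (a 0 ^ 2 * scaledLam h 1 (scaledLam h 2 (lam h 0 w)) k
          + a 1 ^ 2 * scaledLam h 0 (scaledLam h 2 (lam h 1 w)) k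
          + a 2 ^ 2 * scaledLam h 0 (scaledLam h 1 (lam h 2 w)) k) := by
      simp only [A, ANtheta, AbarN3, scaledLam, Module.End.mul_apply, e1, e2, LinearMap.add_apply,
        LinearMap.smul_apply, LinearMap.neg_apply, Pi.add_apply, Pi.smul_apply, Pi.neg_apply,
        map_smul, smul_eq_mul]
      ring
    rw [this, abs_mul, abs_neg, mul_assoc]
    refine mul_le_mul_of_nonneg_left ((abs_add_three _ _ _).trans ?_) (abs_nonneg _)
    rw [abs_mul, abs_mul, abs_mul, abs_sq, abs_sq, abs_sq]
    have := mul_le_mul_of_nonneg_left h1 (sq_nonneg (a 0))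
    have := mul_le_mul_of_nonneg_left h2 (sq_nonneg (a 1))
    have := mul_le_mul_of_nonneg_left h3 (sq_nonneg (a 2))
    linarith
  | third =>
    refine ⟨(∑ i, a i ^ 2) * (n : ℝ) ^ 2, by positivity, fun h N w D hh hD hw k hk => ?_⟩
    have hterm : ∀ i, |((((List.finRange n).filter (fun k => k ≠ i)).map
        (polySk h (lam h))).prod (lam h i w) - lam h i w
        - ∑ j ∈ Finset.univ.erase i, scaledLam h j (lam h i w)) k| ≤ (n : ℝ) ^ 2 * D := by
      intro i
      have h1 := abs_list_prod_sub_le hh (J := {i}) (N := N) (w := lam h i w)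
        ((List.nodup_finRange n).filter (fun k => k ≠ i)) (by simp) hD
        (fun j hj j' hj' hjj k hk => hw j j' i hjj (by simpa using hj) (by simpa using hj') k
          (by rwa [Set.singleton_union] at hk)) k (innerOn_of_mem_innerNodes hk _)
      rw [list_filter_map_sum] at h1
      refine h1.trans ?_
      have : ((List.finRange n).filter (fun k => k ≠ i)).length ≤ n := by
        simpa using List.length_filter_le (fun k => decide (k ≠ i)) (List.finRange n)
      gcongr
    have : (CompactScheme.third n).A a h w k - AN a h w k
        = -∑ i, a i ^ 2 * ((((List.finRange n).filter (fun k => k ≠ i)).map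
        (polySk h (lam h))).prod (lam h i w) - lam h i w
        - ∑ j ∈ Finset.univ.erase i, scaledLam h j (lam h i w)) k := by
      rw [AN_apply, (CompactScheme.third n).A_eq_polyA]
      simp only [polyA, LinearMap.neg_apply, LinearMap.sum_apply, LinearMap.smul_apply,
        Module.End.mul_apply, Pi.neg_apply, Finset.sum_apply, Pi.smul_apply, smul_eq_mul,
        Pi.sub_apply, sub_neg_eq_add, mul_sub, mul_add, Finset.sum_add_distrib,
        Finset.sum_sub_distrib]
      ring
    rw [this, abs_neg]
    refine (Finset.abs_sum_le_sum_abs _ _).trans ?_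
    rw [Finset.sum_mul, Finset.sum_mul]
    refine Finset.sum_le_sum fun i _ => ?_
    rw [abs_mul, abs_sq, mul_assoc]
    exact mul_le_mul_of_nonneg_left (hterm i) (sq_nonneg _)

end Remainders

/-! ### Divided differences of smooth functions on a box -/

section Divided

variable {ι : Type*} [DecidableEq ι]

/-- Divided second difference in the direction `d` with the step `s d`. -/
noncomputable def divLam (s : ι → ℝ) (d : ι) (w : (ι → ℝ) → ℝ) : (ι → ℝ) → ℝ :=
  fun p => secondDiff d (s d) w p / s d ^ 2

/-- Divided forward difference in the direction `d` with the step `s d`. -/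
noncomputable def divDel (s : ι → ℝ) (d : ι) (w : (ι → ℝ) → ℝ) : (ι → ℝ) → ℝ :=
  fun p => forwardDiff d (s d) w p / s d

theorem divLam_comm (s : ι → ℝ) (a b : ι) (w : (ι → ℝ) → ℝ) :
    divLam s a (divLam s b w) = divLam s b (divLam s a w) := by
  funext p
  simp only [divLam, secondDiff]
  rw [add_right_comm p, sub_add_eq_add_sub p, sub_add_eq_add_sub p, sub_right_comm p]
  ring

theorem divLam_divDel_comm (s : ι → ℝ) (a b : ι) (w : (ι → ℝ) → ℝ) :
    divLam s a (divDel s b w) = divDel s b (divLam s a w) := by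
  funext p
  simp only [divLam, divDel, secondDiff, forwardDiff]
  rw [add_right_comm p, sub_add_eq_add_sub p]
  ring

variable {s : ι → ℝ} {lo hi : ι → ℝ} {G : ℕ → (ι → ℝ) → ℝ} {d b : ι} {m : ℕ}

theorem Tower.div_const (hG : Tower d m lo hi G) (c : ℝ) :
    Tower d m lo hi fun j p => G j p / c :=
  fun j hj p hp => (hG j hj p hp).div_const c

theorem Tower.divLam (hs : 0 < s b) (hG : Tower d m lo hi G) :
    Tower d m (lo + Pi.single b (s b)) (hi - Pi.single b (s b))
      fun j => CompactWave.divLam s b (G j) :=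
  (hG.secondDiff hs.le).div_const _

theorem Tower.divDel (hs : 0 < s b) (hG : Tower d m lo hi G) :
    Tower d m lo (hi - Pi.single b (s b)) fun j => CompactWave.divDel s b (G j) :=
  (hG.forwardDiff hs.le).div_const _

variable {C : ℝ} {p : ι → ℝ}

theorem Tower.abs_divLam_le (hG : Tower d 2 lo hi G) (hs : 0 < s d)
    (hb : ∀ p ∈ Set.Icc lo hi, |G 2 p| ≤ C)
    (hp : p ∈ Set.Icc (lo + Pi.single d (s d)) (hi - Pi.single d (s d))) :
    |CompactWave.divLam s d (G 0) p| ≤ 2 * C := by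
  have := hG.secondDiff_le hs.le hb hp
  rw [CompactWave.divLam, abs_div, abs_sq, div_le_iff₀ (by positivity)]
  exact this

theorem Tower.abs_divLam_sub_le (hG : Tower d 4 lo hi G) (hs : 0 < s d)
    (hb : ∀ p ∈ Set.Icc lo hi, |G 4 p| ≤ C)
    (hp : p ∈ Set.Icc (lo + Pi.single d (s d)) (hi - Pi.single d (s d))) :
    |CompactWave.divLam s d (G 0) p - G 2 p| ≤ 2 * C * s d ^ 2 := by
  have := hG.secondDiff_sub_le hs.le hb hp
  have e : CompactWave.divLam s d (G 0) p - G 2 p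
      = (CompactWave.secondDiff d (s d) (G 0) p - s d ^ 2 * G 2 p) / s d ^ 2 := by
    rw [CompactWave.divLam]
    field_simp
  rw [e, abs_div, abs_sq, div_le_iff₀ (by positivity)]
  exact this.trans_eq (by ring)

theorem Tower.abs_divLam_sub_sub_le (hG : Tower d 6 lo hi G) (hs : 0 < s d)
    (hb : ∀ p ∈ Set.Icc lo hi, |G 6 p| ≤ C)
    (hp : p ∈ Set.Icc (lo + Pi.single d (s d)) (hi - Pi.single d (s d))) :
    |CompactWave.divLam s d (G 0) p - G 2 p - 1 / 12 * s d ^ 2 * CompactWave.divLam s d (G 2) p|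
      ≤ 3 * C * s d ^ 4 := by
  have := hG.secondDiff_sub_sub_le hs.le hb hp
  have e : CompactWave.divLam s d (G 0) p - G 2 p
        - 1 / 12 * s d ^ 2 * CompactWave.divLam s d (G 2) p
      = (CompactWave.secondDiff d (s d) (G 0) p - s d ^ 2 * G 2 p
        - s d ^ 2 / 12 * CompactWave.secondDiff d (s d) (G 2) p) / s d ^ 2 := by
    simp only [CompactWave.divLam]
    field_simp
  rw [e, abs_div, abs_sq, div_le_iff₀ (by positivity)]
  exact this.trans_eq (by ring)

theorem Tower.abs_divDel_le (hG : Tower d 1 lo hi G) (hs : 0 < s d)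
    (hb : ∀ p ∈ Set.Icc lo hi, |G 1 p| ≤ C) (hp : p ∈ Set.Icc lo (hi - Pi.single d (s d))) :
    |CompactWave.divDel s d (G 0) p| ≤ C := by
  have := hG.abs_forward_le hs.le hb hp
  simp only [Finset.sum_range_succ, Finset.range_zero, Finset.sum_empty] at this
  norm_num at this
  rw [CompactWave.divDel, abs_div, abs_of_pos hs, div_le_iff₀ hs]
  exact this

theorem Tower.abs_divDel_sub_le (hG : Tower d 3 lo hi G) (hs : 0 < s d)
    (hb : ∀ p ∈ Set.Icc lo hi, |G 3 p| ≤ C) (hp : p ∈ Set.Icc lo (hi - Pi.single d (s d))) :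
    |CompactWave.divDel s d (G 0) p - G 1 p - s d / 2 * G 2 p| ≤ C * s d ^ 2 := by
  have := hG.abs_forward_le hs.le hb hp
  simp only [Finset.sum_range_succ, Finset.range_zero, Finset.sum_empty] at this
  norm_num [Nat.factorial] at this
  have e : CompactWave.divDel s d (G 0) p - G 1 p - s d / 2 * G 2 p
      = (G 0 (p + Pi.single d (s d)) - (G 0 p + s d * G 1 p + s d ^ 2 / 2 * G 2 p)) / s d := by
    rw [CompactWave.divDel, CompactWave.forwardDiff]
    field_simp
    ring
  rw [e, abs_div, abs_of_pos hs, div_le_iff₀ hs]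
  exact this.trans_eq (by ring)

theorem Tower.abs_divDel_sub4_le (hG : Tower d 5 lo hi G) (hs : 0 < s d)
    (hb : ∀ p ∈ Set.Icc lo hi, |G 5 p| ≤ C) (hp : p ∈ Set.Icc lo (hi - Pi.single d (s d))) :
    |CompactWave.divDel s d (G 0) p - G 1 p - s d / 2 * G 2 p - s d ^ 2 / 6 * G 3 p
      - s d ^ 3 / 24 * G 4 p| ≤ C * s d ^ 4 := by
  have := hG.abs_forward_le hs.le hb hp
  simp only [Finset.sum_range_succ, Finset.range_zero, Finset.sum_empty] at this
  norm_num [Nat.factorial] at this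
  have e : CompactWave.divDel s d (G 0) p - G 1 p - s d / 2 * G 2 p - s d ^ 2 / 6 * G 3 p
      - s d ^ 3 / 24 * G 4 p = (G 0 (p + Pi.single d (s d)) - (G 0 p + s d * G 1 p
        + s d ^ 2 / 2 * G 2 p + s d ^ 3 / 6 * G 3 p + s d ^ 4 / 24 * G 4 p)) / s d := by
    rw [CompactWave.divDel, CompactWave.forwardDiff]
    field_simp
    ring
  rw [e, abs_div, abs_of_pos hs, div_le_iff₀ hs]
  exact this.trans_eq (by ring)

theorem mem_shrink (hp : p ∈ Set.Icc lo hi) {r : ℝ} (h1 : lo d + r ≤ p d) (h2 : p d ≤ hi d - r) :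
    p ∈ Set.Icc (lo + Pi.single d r) (hi - Pi.single d r) := by
  refine ⟨fun i => ?_, fun i => ?_⟩ <;> by_cases h : i = d
  · subst h; simpa using h1
  · simpa [h] using hp.1 i
  · subst h; simpa using h2
  · simpa [h] using hp.2 i

theorem mem_shrink_right (hp : p ∈ Set.Icc lo hi) {r : ℝ} (h2 : p d ≤ hi d - r) :
    p ∈ Set.Icc lo (hi - Pi.single d r) := by
  refine ⟨hp.1, fun i => ?_⟩
  by_cases h : i = d
  · subst h; simpa using h2
  · simpa [h] using hp.2 i

/-- The points `p ± s d` in the direction `d` are within the bounds `[0, L d]`. -/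
def Fits (L s : ι → ℝ) (d : ι) (p : ι → ℝ) : Prop := s d ≤ p d ∧ p d ≤ L d - s d

theorem Fits.mem_shrink {L : ι → ℝ} (h : Fits L s d p) (hp : p ∈ Set.Icc lo hi) (hlo : lo d = 0)
    (hhi : hi d = L d) : p ∈ Set.Icc (lo + Pi.single d (s d)) (hi - Pi.single d (s d)) :=
  CompactWave.mem_shrink hp (by rw [hlo, zero_add]; exact h.1) (by rw [hhi]; exact h.2)

end Divided

/-! ### Consistency of difference quotients for functions of class `C^6` on a box -/

section Smooth

variable {ι : Type*} [DecidableEq ι] [Fintype ι] {L s : ι → ℝ} {w : (ι → ℝ) → ℝ} {M : ℝ}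

/-- `w` is of class `C^6` on the box `[0, L]`, and its partial derivatives of order at most `6` are
bounded by `M`. -/
structure SmoothBounded (L : ι → ℝ) (w : (ι → ℝ) → ℝ) (M : ℝ) : Prop where
  pos : ∀ i, 0 < L i
  smooth : ContDiffOn ℝ ((6 : ℕ) : WithTop ℕ∞) w (Set.Icc 0 L)
  bound : ∀ l : List ι, l.length ≤ 6 → ∀ p ∈ Set.Icc 0 L,
    |l.foldl (fun φ d => boxDeriv L d φ) w p| ≤ M

namespace SmoothBounded

theorem exists_of_contDiffOn (hL : ∀ i, 0 < L i)
    (hw : ContDiffOn ℝ ((6 : ℕ) : WithTop ℕ∞) w (Set.Icc 0 L)) : ∃ M, SmoothBounded L w M := by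
  obtain ⟨M, hM⟩ := exists_bound_boxDeriv hL 6 hw
  exact ⟨M, hL, hw, hM⟩

theorem mono {M' : ℝ} (h : SmoothBounded L w M) (hM : M ≤ M') : SmoothBounded L w M' :=
  ⟨h.pos, h.smooth, fun l hl p hp => (h.bound l hl p hp).trans hM⟩

theorem tower (h : SmoothBounded L w M) (d : ι) (j : ℕ) (hj : j ≤ 6) :
    Tower d j 0 L fun j => (boxDeriv L d)^[j] w :=
  (tower_boxDeriv h.pos d h.smooth).of_le hj

theorem tower₁ (h : SmoothBounded L w M) (d e : ι) (i j : ℕ) (hj : j + i ≤ 6) :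
    Tower d j 0 L fun j => (boxDeriv L d)^[j] ((boxDeriv L e)^[i] w) :=
  tower_boxDeriv h.pos d (ContDiffOn.boxDeriv_iterate h.pos e i
    (h.smooth.of_le (by exact_mod_cast hj)))

theorem tower₂ (h : SmoothBounded L w M) (d e f : ι) (i i' j : ℕ) (hj : j + i + i' ≤ 6) :
    Tower d j 0 L fun j => (boxDeriv L d)^[j] ((boxDeriv L e)^[i] ((boxDeriv L f)^[i'] w)) :=
  tower_boxDeriv h.pos d (ContDiffOn.boxDeriv_iterate h.pos e i
    (ContDiffOn.boxDeriv_iterate h.pos f i' (h.smooth.of_le (by exact_mod_cast hj))))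

variable {a b c t : ι} {p : ι → ℝ}

/-- Each divided second difference costs a factor 2 and two derivatives, six in all. The directions
must be distinct: shrinking the box for one of them then leaves the room needed by the others. -/
theorem abs_divLam_divLam_divLam_le (h : SmoothBounded L w M) (hs : ∀ i, 0 < s i) (hab : a ≠ b)
    (hac : a ≠ c) (hbc : b ≠ c) (hp : p ∈ Set.Icc 0 L) (ha : Fits L s a p) (hb : Fits L s b p)
    (hc : Fits L s c p) : |divLam s a (divLam s b (divLam s c w)) p| ≤ 8 * M := by
  have h3 : ∀ q ∈ Set.Icc (0 + Pi.single c (s c)) (L - Pi.single c (s c)),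
      |divLam s c ((boxDeriv L b)^[2] ((boxDeriv L a)^[2] w)) q| ≤ 2 * M := fun q hq =>
    (h.tower₂ c b a 2 2 2 le_rfl).abs_divLam_le (hs c)
      (fun q hq => h.bound [a, a, b, b, c, c] le_rfl q hq) hq
  have h2 : ∀ q ∈ Set.Icc (0 + Pi.single c (s c) + Pi.single b (s b))
      (L - Pi.single c (s c) - Pi.single b (s b)),
      |divLam s b (divLam s c ((boxDeriv L a)^[2] w)) q| ≤ 2 * (2 * M) := fun q hq =>
    ((h.tower₁ b a 2 2 (by norm_num)).divLam (hs c)).abs_divLam_le (hs b) h3 hq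
  have h1 := (((h.tower a 2 (by norm_num)).divLam (hs c)).divLam (hs b)).abs_divLam_le (hs a) h2
    (p := p) (ha.mem_shrink (hb.mem_shrink (hc.mem_shrink hp rfl rfl) (by simp [hbc])
      (by simp [hbc])) (by simp [hac, hab]) (by simp [hac, hab]))
  exact h1.trans_eq (by ring)

theorem abs_divLam_sub_sub_le (h : SmoothBounded L w M) (hs : ∀ i, 0 < s i)
    (hp : p ∈ Set.Icc 0 L) (ha : Fits L s a p) :
    |divLam s a w p - (boxDeriv L a)^[2] w p
      - 1 / 12 * s a ^ 2 * divLam s a ((boxDeriv L a)^[2] w) p| ≤ 3 * M * s a ^ 4 :=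
  (h.tower a 6 le_rfl).abs_divLam_sub_sub_le (hs a)
    (fun q hq => h.bound [a, a, a, a, a, a] le_rfl q hq) (ha.mem_shrink hp rfl rfl)

/-- Second order consistency in the direction `a`, applied to the tower already differenced in the
direction `b`. The fourth `a`-derivative of that tower costs two further derivatives in `b`. -/
theorem abs_divLam_divLam_sub_le (h : SmoothBounded L w M) (hs : ∀ i, 0 < s i) (hab : a ≠ b)
    (hp : p ∈ Set.Icc 0 L) (ha : Fits L s a p) (hb : Fits L s b p) :
    |divLam s b (divLam s a w) p - divLam s b ((boxDeriv L a)^[2] w) p| ≤ 4 * M * s a ^ 2 := by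
  have h2 : ∀ q ∈ Set.Icc (0 + Pi.single b (s b)) (L - Pi.single b (s b)),
      |divLam s b ((boxDeriv L a)^[4] w) q| ≤ 2 * M := fun q hq =>
    (h.tower₁ b a 4 2 (by norm_num)).abs_divLam_le (hs b)
      (fun q hq => h.bound [a, a, a, a, b, b] le_rfl q hq) hq
  have h1 := ((h.tower a 4 (by norm_num)).divLam (hs b)).abs_divLam_sub_le (hs a) h2
    (p := p) (ha.mem_shrink (hb.mem_shrink hp rfl rfl) (by simp [hab]) (by simp [hab]))
  rw [divLam_comm]
  exact h1.trans_eq (by ring)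

/-- The first-step counterpart of the triple bound. The forward difference needs room only at the
upper end of the time interval, so `t = 0` is allowed. -/
theorem abs_divLam_divLam_divDel_le (h : SmoothBounded L w M) (hs : ∀ i, 0 < s i) (hab : a ≠ b)
    (hat : a ≠ t) (hbt : b ≠ t) (hp : p ∈ Set.Icc 0 L) (ha : Fits L s a p) (hb : Fits L s b p)
    (ht : p t ≤ L t - s t) : |divLam s a (divLam s b (divDel s t w)) p| ≤ 4 * M := by
  have h3 : ∀ q ∈ Set.Icc 0 (L - Pi.single t (s t)),
      |divDel s t ((boxDeriv L b)^[2] ((boxDeriv L a)^[2] w)) q| ≤ M := fun q hq =>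
    (h.tower₂ t b a 2 2 1 (by norm_num)).abs_divDel_le (hs t)
      (fun q hq => h.bound [a, a, b, b, t] (by simp) q hq) hq
  have h2 : ∀ q ∈ Set.Icc (0 + Pi.single b (s b)) (L - Pi.single t (s t) - Pi.single b (s b)),
      |divLam s b (divDel s t ((boxDeriv L a)^[2] w)) q| ≤ 2 * M := fun q hq =>
    ((h.tower₁ b a 2 2 (by norm_num)).divDel (hs t)).abs_divLam_le (hs b) h3 hq
  have h1 := (((h.tower a 2 (by norm_num)).divDel (hs t)).divLam (hs b)).abs_divLam_le (hs a) h2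
    (p := p) (ha.mem_shrink (hb.mem_shrink (mem_shrink_right hp ht) rfl
      (by simp [hbt])) (by simp [hab]) (by simp [hat, hab]))
  exact h1.trans_eq (by ring)

theorem abs_divDel_sub4_le (h : SmoothBounded L w M) (hs : ∀ i, 0 < s i) (hp : p ∈ Set.Icc 0 L)
    (ht : p t ≤ L t - s t) :
    |divDel s t w p - boxDeriv L t w p - s t / 2 * (boxDeriv L t)^[2] w p
      - s t ^ 2 / 6 * (boxDeriv L t)^[3] w p - s t ^ 3 / 24 * (boxDeriv L t)^[4] w p|
      ≤ M * s t ^ 4 :=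
  (h.tower t 5 (by norm_num)).abs_divDel_sub4_le (hs t)
    (fun q hq => h.bound [t, t, t, t, t] (by simp) q hq) (mem_shrink_right hp ht)

theorem abs_divLam_divDel_sub_le (h : SmoothBounded L w M) (hs : ∀ i, 0 < s i) (hat : a ≠ t)
    (hp : p ∈ Set.Icc 0 L) (ha : Fits L s a p) (ht : p t ≤ L t - s t) :
    |divLam s a (divDel s t w) p - divLam s a (boxDeriv L t w) p
      - s t / 2 * divLam s a ((boxDeriv L t)^[2] w) p| ≤ 2 * M * s t ^ 2 := by
  have h2 : ∀ q ∈ Set.Icc (0 + Pi.single a (s a)) (L - Pi.single a (s a)),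
      |divLam s a ((boxDeriv L t)^[3] w) q| ≤ 2 * M := fun q hq =>
    (h.tower₁ a t 3 2 (by norm_num)).abs_divLam_le (hs a)
      (fun q hq => h.bound [t, t, t, a, a] (by simp) q hq) hq
  have h1 := ((h.tower t 3 (by norm_num)).divLam (hs a)).abs_divDel_sub_le (hs t) h2
    (p := p) (mem_shrink_right (ha.mem_shrink hp rfl rfl) (by simpa [hat.symm] using ht))
  rw [divLam_divDel_comm]
  exact h1

theorem abs_divLam_divDel_sub_divDel_le (h : SmoothBounded L w M) (hs : ∀ i, 0 < s i)
    (hat : a ≠ t) (hp : p ∈ Set.Icc 0 L) (ha : Fits L s a p) (ht : p t ≤ L t - s t) :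
    |divLam s a (divDel s t w) p - divDel s t ((boxDeriv L a)^[2] w) p| ≤ 2 * M * s a ^ 2 := by
  have h2 : ∀ q ∈ Set.Icc 0 (L - Pi.single t (s t)),
      |divDel s t ((boxDeriv L a)^[4] w) q| ≤ M := fun q hq =>
    (h.tower₁ t a 4 1 (by norm_num)).abs_divDel_le (hs t)
      (fun q hq => h.bound [a, a, a, a, t] (by simp) q hq) hq
  exact ((h.tower a 4 (by norm_num)).divDel (hs t)).abs_divLam_sub_le (hs a) h2
    (p := p) (ha.mem_shrink (mem_shrink_right hp ht) rfl (by simp [hat]))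

theorem abs_divDel_deriv_sub_le (h : SmoothBounded L w M) (hs : ∀ i, 0 < s i)
    (hp : p ∈ Set.Icc 0 L) (ht : p t ≤ L t - s t) :
    |divDel s t ((boxDeriv L a)^[2] w) p - boxDeriv L t ((boxDeriv L a)^[2] w) p
      - s t / 2 * (boxDeriv L t)^[2] ((boxDeriv L a)^[2] w) p| ≤ M * s t ^ 2 :=
  (h.tower₁ t a 2 3 (by norm_num)).abs_divDel_sub_le (hs t)
    (fun q hq => h.bound [a, a, t, t, t] (by simp) q hq) (mem_shrink_right hp ht)

/-- The Taylor estimate yields the derivatives in the order `∂_a² ∂_t`. Two applications of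
`boxDeriv_comm` restore the order in which the other terms of the first step carry them. -/
theorem abs_divLam_deriv_sub_le (h : SmoothBounded L w M) (hs : ∀ i, 0 < s i)
    (hp : p ∈ Set.Icc 0 L) (ha : Fits L s a p) :
    |divLam s a (boxDeriv L t w) p - boxDeriv L t ((boxDeriv L a)^[2] w) p|
      ≤ 2 * M * s a ^ 2 := by
  have h1 := (h.tower₁ a t 1 4 (by norm_num)).abs_divLam_sub_le (hs a)
    (fun q hq => h.bound [t, a, a, a, a] (by simp) q hq) (ha.mem_shrink hp rfl rfl)
  have e : (boxDeriv L a)^[2] (boxDeriv L t w) p = boxDeriv L t ((boxDeriv L a)^[2] w) p := by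
    have c1 := boxDeriv_comm h.pos a t (h.smooth.of_le (by norm_num))
    have c2 := boxDeriv_comm h.pos a t (w := boxDeriv L a w)
      (ContDiffOn.boxDeriv h.pos a (h.smooth.of_le (by norm_num)))
    exact (boxDeriv_congr c1 hp).trans (c2 hp)
  rw [← e]
  exact h1

end SmoothBounded

end Smooth

/-! ### Functions of space and time on the mesh -/

section SpaceTime

variable {n : ℕ}

/-- A function of `(x, t)` as a function on `ℝ^(n+1)`; the coordinate `none` is the time. -/
def spaceTime (u : (Fin n → ℝ) → ℝ → ℝ) : (Option (Fin n) → ℝ) → ℝ :=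
  fun p => u (fun i => p (some i)) (p none)

/-- The spatial values `x` together with the time value `t`. -/
def withTime (t : ℝ) (x : Fin n → ℝ) : Option (Fin n) → ℝ := fun d => d.elim t x

/-- Values of a function of space and time at the nodes at the time `t`. -/
def sampleAt (h : Fin n → ℝ) (φ : (Option (Fin n) → ℝ) → ℝ) (t : ℝ) : MeshFn n :=
  fun k => φ (withTime t (node h k))

theorem sampleT_eq (h : Fin n → ℝ) (τ : ℝ) (u : (Fin n → ℝ) → ℝ → ℝ) (m : ℕ) :
    sampleT h τ u m = sampleAt h (spaceTime u) (m * τ) := rfl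

theorem withTime_node_add (h : Fin n → ℝ) (t : ℝ) (k : Fin n → ℤ) (i : Fin n) :
    withTime t (node h (k + Pi.single i 1))
      = withTime t (node h k) + Pi.single (some i) (h i) := by
  funext d
  cases d with
  | none => simp [withTime]
  | some j =>
    by_cases hj : j = i
    · subst hj; simp [withTime, node, add_mul]
    · simp [withTime, node, hj]

theorem withTime_node_sub (h : Fin n → ℝ) (t : ℝ) (k : Fin n → ℤ) (i : Fin n) :
    withTime t (node h (k - Pi.single i 1))
      = withTime t (node h k) - Pi.single (some i) (h i) := by
  rw [eq_sub_iff_add_eq, ← withTime_node_add, sub_add_cancel]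

theorem withTime_add (t r : ℝ) (x : Fin n → ℝ) :
    withTime (t + r) x = withTime t x + Pi.single none r := by
  funext d
  cases d <;> simp [withTime]

theorem withTime_sub (t r : ℝ) (x : Fin n → ℝ) :
    withTime (t - r) x = withTime t x - Pi.single none r := by
  rw [eq_sub_iff_add_eq, ← withTime_add, sub_add_cancel]

theorem lam_sampleAt (h : Fin n → ℝ) (τ : ℝ) (φ : (Option (Fin n) → ℝ) → ℝ) (t : ℝ) (i : Fin n) :
    lam h i (sampleAt h φ t) = sampleAt h (divLam (withTime τ h) (some i) φ) t := by
  funext k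
  simp only [lam_apply, sampleAt, divLam, secondDiff, withTime_node_add, withTime_node_sub]
  rfl

theorem scaledLam_sampleAt (h : Fin n → ℝ) (τ : ℝ) (φ : (Option (Fin n) → ℝ) → ℝ) (t : ℝ)
    (i : Fin n) (k : Fin n → ℤ) : scaledLam h i (sampleAt h φ t) k
      = 1 / 12 * h i ^ 2 * divLam (withTime τ h) (some i) φ (withTime t (node h k)) := by
  rw [scaledLam_apply, lam_sampleAt h τ]
  rfl

theorem lamT_sampleAt (h : Fin n → ℝ) (τ : ℝ) (φ : (Option (Fin n) → ℝ) → ℝ) {m : ℕ}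
    (hm : 1 ≤ m) : lamT τ (fun j => sampleAt h φ (j * τ)) m
      = sampleAt h (divLam (withTime τ h) none φ) (m * τ) := by
  funext k
  have e1 : ((m + 1 : ℕ) : ℝ) * τ = m * τ + τ := by push_cast; ring
  have e2 : ((m - 1 : ℕ) : ℝ) * τ = m * τ - τ := by push_cast [Nat.cast_sub hm]; ring
  simp only [lamT, sampleAt, divLam, secondDiff, e1, e2, withTime_add, withTime_sub]
  rfl

theorem deltaFwd_sampleAt (h : Fin n → ℝ) (τ : ℝ) (φ : (Option (Fin n) → ℝ) → ℝ) :
    deltaFwd τ (fun j => sampleAt h φ (j * τ)) 0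
      = sampleAt h (divDel (withTime τ h) none φ) 0 := by
  funext k
  have e1 : ((0 + 1 : ℕ) : ℝ) * τ = 0 + τ := by push_cast; ring
  have e2 : ((0 : ℕ) : ℝ) * τ = 0 := by simp
  simp only [deltaFwd, sampleAt, divDel, forwardDiff, e1, e2, withTime_add]
  rfl

theorem lam_congr {N : Fin n → ℕ} (h : Fin n → ℝ) {v w : MeshFn n}
    (hvw : ∀ k ∈ closedNodes N, v k = w k) {k : Fin n → ℤ} (hk : k ∈ innerNodes N) (i : Fin n) :
    lam h i v k = lam h i w k := by
  have hk' := innerNodes_subset_closedNodes N hk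
  have hi := mem_innerNodes.mp hk i
  rw [lam_apply, lam_apply, hvw _ hk', hvw _ (add_single_mem_closedNodes hk' hi),
    hvw _ (sub_single_mem_closedNodes hk' hi)]

theorem divLam_sub_sum {ι κ : Type*} [DecidableEq ι] [Fintype κ] (s : ι → ℝ) (d : ι)
    (v : (ι → ℝ) → ℝ) (c : κ → ℝ) (w : κ → (ι → ℝ) → ℝ) (p : ι → ℝ) :
    divLam s d (fun p => v p - ∑ l, c l * w l p) p
      = divLam s d v p - ∑ l, c l * divLam s d (w l) p := by
  simp only [divLam, secondDiff, ← mul_div_assoc, ← Finset.sum_div, mul_add, mul_sub,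
    Finset.sum_add_distrib, Finset.sum_sub_distrib, mul_left_comm _ (2 : ℝ), ← Finset.mul_sum]
  ring

/-- A mesh on `[0, X] × [0, T]`. -/
structure IsMesh (X : Fin n → ℝ) (T : ℝ) (h : Fin n → ℝ) (N : Fin n → ℕ) (τ : ℝ) (M : ℕ) :
    Prop where
  h_pos : ∀ i, 0 < h i
  h_mul : ∀ i, N i * h i = X i
  t_pos : 0 < τ
  t_mul : M * τ = T

namespace IsMesh

variable {X h : Fin n → ℝ} {T τ : ℝ} {N : Fin n → ℕ} {M : ℕ}

theorem steps_pos (hm : IsMesh X T h N τ M) (d : Option (Fin n)) : 0 < withTime τ h d := by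
  cases d with
  | none => exact hm.t_pos
  | some i => exact hm.h_pos i

theorem mem_box (hm : IsMesh X T h N τ M) {k : Fin n → ℤ} (hk : k ∈ closedNodes N) {t : ℝ}
    (h0 : 0 ≤ t) (h1 : t ≤ T) : withTime t (node h k) ∈ Set.Icc 0 (withTime T X) := by
  rw [mem_closedNodes] at hk
  refine ⟨fun d => ?_, fun d => ?_⟩ <;> cases d with
  | none => assumption
  | some i => ?_
  · change (0 : ℝ) ≤ (k i : ℝ) * h i
    exact mul_nonneg (by exact_mod_cast (hk i).1) (hm.h_pos i).le
  · change (k i : ℝ) * h i ≤ X i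
    rw [← hm.h_mul]
    exact mul_le_mul_of_nonneg_right (by exact_mod_cast (hk i).2) (hm.h_pos i).le

theorem fits (hm : IsMesh X T h N τ M) {k : Fin n → ℤ} {i : Fin n} (hk : InnerDir N i k) (t : ℝ) :
    Fits (withTime T X) (withTime τ h) (some i) (withTime t (node h k)) := by
  have h1 : (1 : ℝ) ≤ k i := by exact_mod_cast hk.1
  have h2 : (k i : ℝ) ≤ N i - 1 := by exact_mod_cast hk.2
  have h3 := hm.h_pos i
  constructor
  · change h i ≤ (k i : ℝ) * h i
    nlinarith
  · change (k i : ℝ) * h i ≤ X i - h i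
    rw [← hm.h_mul]
    nlinarith

theorem time_le (hm : IsMesh X T h N τ M) {m : ℕ} (h2 : m ≤ M) : (m : ℝ) * τ ≤ T := by
  rw [← hm.t_mul]
  exact mul_le_mul_of_nonneg_right (by exact_mod_cast h2) hm.t_pos.le

theorem time_le_sub (hm : IsMesh X T h N τ M) {m : ℕ} (h2 : m < M) :
    (m : ℝ) * τ ≤ T - τ := by
  have : ((m : ℝ) + 1) * τ ≤ T := by exact_mod_cast hm.time_le h2
  linarith

theorem time_fits (hm : IsMesh X T h N τ M) {m : ℕ} (h1 : 1 ≤ m) (h2 : m ≤ M - 1)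
    (x : Fin n → ℝ) : Fits (withTime T X) (withTime τ h) none (withTime (m * τ) x) := by
  constructor
  · change τ ≤ (m : ℝ) * τ
    have : (1 : ℝ) ≤ m := by exact_mod_cast h1
    nlinarith [hm.t_pos]
  · exact hm.time_le_sub (by omega)

end IsMesh

end SpaceTime

/-! ### The approximation errors of the schemes -/

section Truncation

variable {n : ℕ}

theorem abs_sum_mul_le {ι : Type*} [Fintype ι] {c e : ι → ℝ} {B : ℝ} (hc : ∀ i, 0 ≤ c i)
    (he : ∀ i, |e i| ≤ B) : |∑ i, c i * e i| ≤ (∑ i, c i) * B := by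
  refine (Finset.abs_sum_le_sum_abs _ _).trans ?_
  rw [Finset.sum_mul]
  refine Finset.sum_le_sum fun i _ => ?_
  rw [abs_mul, abs_of_nonneg (hc i)]
  exact mul_le_mul_of_nonneg_left (he i) (hc i)

theorem abs_sum_subset_le {s : Finset (Fin n)} {e : Fin n → ℝ} {B : ℝ} (hB : 0 ≤ B)
    (he : ∀ i ∈ s, |e i| ≤ B) : |∑ i ∈ s, e i| ≤ n * B := by
  refine (Finset.abs_sum_le_sum_abs _ _).trans ((Finset.sum_le_sum he).trans ?_)
  rw [Finset.sum_const, nsmul_eq_mul]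
  have : (s.card : ℝ) ≤ n := by exact_mod_cast (Finset.card_le_univ s).trans_eq (by simp)
  exact mul_le_mul_of_nonneg_right this hB

/-- When `s_N` acts on `∑ a_l² ∂_l² u`, the diagonal part corrects the error of `Λ_l` itself, and
the rest matches the factors in `A_N` that omit the direction `l`. -/
theorem sum_sum_eq_diag_add (c : Fin n → ℝ) (x : Fin n → Fin n → ℝ) :
    ∑ i, ∑ l, c l * x l i = ∑ l, c l * (x l l + ∑ j ∈ Finset.univ.erase l, x l j) := by
  rw [Finset.sum_comm]
  refine Finset.sum_congr rfl fun l _ => ?_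
  rw [← Finset.mul_sum, Finset.add_sum_erase _ _ (Finset.mem_univ l)]

/-- Regroups the truncation error at an inner level so that each bracket is small by itself. In the
application `τ` stands for `h_t²/12`, `z` for `Λ_t(ρ u)`, `R` for `∂_t²(ρ u)` and `W l` for `∂_l²
u`. The prefix `x` marks a scaled difference, `l` marks `Λ_l`, and `t` and `T` mark `Λ_t`. -/
theorem main_error_identity (c : Fin n → ℝ) (τ z R TR : ℝ) (xz xR lz tW lU W : Fin n → ℝ)
    (xlz xlU xW : Fin n → Fin n → ℝ) :
    z + ∑ i, xz i + τ * -∑ l, c l * (lz l + ∑ j ∈ Finset.univ.erase l, xlz l j)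
      + -∑ l, c l * (lU l + ∑ j ∈ Finset.univ.erase l, xlU l j)
      - (R - ∑ l, c l * W l + ∑ i, (xR i - ∑ l, c l * xW l i) + τ * (TR - ∑ l, c l * tW l))
    = (z - R - τ * TR) + ∑ i, (xz i - xR i)
      - τ * ∑ l, c l * ((lz l - tW l) + ∑ j ∈ Finset.univ.erase l, xlz l j)
      - ∑ l, c l * ((lU l - W l - xW l l)
        + ∑ j ∈ Finset.univ.erase l, (xlU l j - xW l j)) := by
  simp only [Finset.sum_sub_distrib, sum_sum_eq_diag_add]
  simp only [mul_add, mul_sub, Finset.sum_sub_distrib, Finset.sum_add_distrib]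
  ring

/-- The coefficients `1/3` and `1/12` of the approximation to `f` at `t = 0`, multiplied by `τ/2`,
give the Taylor coefficients `τ²/6` and `τ³/24` of `δ_t(ρ u)`. The same terms without `ρ`, together
with `Λ_l u_1` from `u1N`, leave `2 ∂_t ∂_l² u + (τ/2) ∂_t² ∂_l² u` to be matched by `Λ_l δ_t u +
Λ_l u_1`. -/
theorem first_error_identity (c : Fin n → ℝ) (τ z R1 R2 R3 R4 : ℝ)
    (xz xR1 xR2 lz lU1 lU W W1 W2 : Fin n → ℝ) (xlz xlU xW : Fin n → Fin n → ℝ) :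
    z + ∑ i, xz i
      + 1 / 12 * τ ^ 2 * -∑ l, c l * (lz l + ∑ j ∈ Finset.univ.erase l, xlz l j)
      + 1 / 2 * τ * -∑ l, c l * (lU l + ∑ j ∈ Finset.univ.erase l, xlU l j)
      - (R1 + ∑ i, xR1 i + 1 / 12 * τ ^ 2 * ∑ l, c l * lU1 l)
      - 1 / 2 * τ * ((R2 - ∑ l, c l * W l) + 1 / 3 * τ * (R3 - ∑ l, c l * W1 l)
        + 1 / 12 * τ ^ 2 * (R4 - ∑ l, c l * W2 l) + ∑ i, (xR2 i - ∑ l, c l * xW l i))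
    = (z - R1 - τ / 2 * R2 - τ ^ 2 / 6 * R3 - τ ^ 3 / 24 * R4)
      + ∑ i, (xz i - xR1 i - τ / 2 * xR2 i)
      - 1 / 12 * τ ^ 2 * ∑ l, c l * ((lz l + lU1 l - 2 * W1 l - τ / 2 * W2 l)
        + ∑ j ∈ Finset.univ.erase l, xlz l j)
      - 1 / 2 * τ * ∑ l, c l * ((lU l - W l - xW l l)
        + ∑ j ∈ Finset.univ.erase l, (xlU l j - xW l j)) := by
  simp only [Finset.sum_sub_distrib, sum_sum_eq_diag_add]
  simp only [mul_add, mul_sub, Finset.sum_sub_distrib, Finset.sum_add_distrib, ← Finset.mul_sum,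
    mul_left_comm _ (2 : ℝ), mul_left_comm _ (τ / 2)]
  ring

end Truncation

/-! ### Truncation error at the inner time levels -/

section Errors

variable {n : ℕ}

/-- The function `∂_t² (ρ u) - ∑ a_l² ∂_l² u` on the box, with derivatives up to the boundary. -/
noncomputable def boxWave (L : Option (Fin n) → ℝ) (a : Fin n → ℝ)
    (U Z : (Option (Fin n) → ℝ) → ℝ) : (Option (Fin n) → ℝ) → ℝ :=
  fun p => (boxDeriv L none)^[2] Z p - ∑ l, a l ^ 2 * (boxDeriv L (some l))^[2] U p

theorem abs_scaledLam_scaledLam_le {h : Fin n → ℝ} {i j : Fin n} {w : MeshFn n} {k : Fin n → ℤ}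
    {H D : ℝ} (hi : h i ^ 2 ≤ H) (hj : h j ^ 2 ≤ H) (hw : |lam h i (lam h j w) k| ≤ D) :
    |scaledLam h i (scaledLam h j w) k| ≤ H ^ 2 * D := by
  have hD : 0 ≤ D := (abs_nonneg _).trans hw
  have hH : 0 ≤ H := (sq_nonneg _).trans hi
  have e : scaledLam h i (scaledLam h j w) k
      = 1 / 144 * (h i ^ 2 * h j ^ 2) * lam h i (lam h j w) k := by
    simp only [scaledLam, LinearMap.smul_apply, map_smul, Pi.smul_apply, smul_eq_mul]
    ring
  rw [e, abs_mul, abs_of_nonneg (by positivity)]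
  refine mul_le_mul ?_ hw (abs_nonneg _) (sq_nonneg _)
  have : h i ^ 2 * h j ^ 2 ≤ H * H := mul_le_mul hi hj (sq_nonneg _) hH
  nlinarith [mul_nonneg (sq_nonneg (h i)) (sq_nonneg (h j))]

variable {X h : Fin n → ℝ} {T τ : ℝ} {N : Fin n → ℕ} {M : ℕ}
  {U Z : (Option (Fin n) → ℝ) → ℝ} {B : ℝ}

/-- `A_N u + ∑ a_l² s_N ∂_l² u = O(|h|⁴)`, in the form used for both levels. -/
theorem abs_space_error_le (hm : IsMesh X T h N τ M) (hU : SmoothBounded (withTime T X) U B)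
    (hB : 0 ≤ B) {H : ℝ} (hH : ∀ i, h i ^ 2 ≤ H) (hH0 : 0 ≤ H) {k : Fin n → ℤ}
    (hk : k ∈ innerNodes N) {t : ℝ} (h0 : 0 ≤ t) (h1 : t ≤ T) (l : Fin n) :
    |(lam h l (sampleAt h U t) k
        - (boxDeriv (withTime T X) (some l))^[2] U (withTime t (node h k))
        - scaledLam h l (sampleAt h ((boxDeriv (withTime T X) (some l))^[2] U) t) k)
      + ∑ j ∈ Finset.univ.erase l, (scaledLam h j (lam h l (sampleAt h U t)) k
        - scaledLam h j (sampleAt h ((boxDeriv (withTime T X) (some l))^[2] U) t) k)|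
      ≤ (3 * B + n * (4 * B)) * H ^ 2 := by
  have hk' := innerNodes_subset_closedNodes N hk
  have hp := hm.mem_box hk' h0 h1
  have hf := fun i => hm.fits (mem_innerNodes.mp hk i) t
  have hs := hm.steps_pos
  have e1 := hU.abs_divLam_sub_sub_le hs hp (hf l)
  simp only [scaledLam_sampleAt h τ, lam_sampleAt h τ]
  refine (abs_add_le _ _).trans ?_
  rw [add_mul]
  refine add_le_add (e1.trans ?_) ?_
  · have : withTime τ h (some l) ^ 4 ≤ H ^ 2 := by
      have := pow_le_pow_left₀ (sq_nonneg (h l)) (hH l) 2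
      calc withTime τ h (some l) ^ 4 = (h l ^ 2) ^ 2 := by simp only [withTime, Option.elim]; ring
        _ ≤ _ := this
    exact mul_le_mul_of_nonneg_left this (by positivity)
  · rw [mul_assoc]
    refine abs_sum_subset_le (by positivity) fun j hj => ?_
    have hjl : j ≠ l := Finset.ne_of_mem_erase hj
    have e2 := hU.abs_divLam_divLam_sub_le hs (a := some l) (b := some j)
      (fun h => hjl (Option.some_injective _ h).symm) hp (hf l) (hf j)
    rw [← mul_sub, abs_mul, abs_of_nonneg (by positivity)]
    calc 1 / 12 * h j ^ 2 * _ ≤ 1 / 12 * H * (4 * B * h l ^ 2) :=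
          mul_le_mul (by linarith [hH j]) e2 (abs_nonneg _) (by positivity)
      _ ≤ 1 / 12 * H * (4 * B * H) := by have := hH l; gcongr
      _ ≤ 4 * B * H ^ 2 := by nlinarith [mul_nonneg hB (sq_nonneg H)]

/-- The operators are first replaced by `s_N` and `A_N`; the rest is split by `main_error_identity`
into brackets, each a Numerov remainder or a product of two second order effects. `H` bounds the
squares of all the steps, so `H ^ 2` is the fourth order. The constant depends only on the scheme,
on `a` and on the bound `B`. -/
theorem exists_main_error_le (S : CompactScheme n) (a : Fin n → ℝ) (B : ℝ) (hB : 0 ≤ B) :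
    ∃ C : ℝ, 0 ≤ C ∧ ∀ {X h : Fin n → ℝ} {T τ : ℝ} {N : Fin n → ℕ} {M : ℕ}
      {ρ : (Fin n → ℝ) → ℝ} {f u : (Fin n → ℝ) → ℝ → ℝ} {H : ℝ}, IsMesh X T h N τ M →
      SmoothBounded (withTime T X) (spaceTime u) B →
      SmoothBounded (withTime T X) (spaceTime fun x t => ρ x * u x t) B →
      (∀ p ∈ Set.Icc 0 (withTime T X), spaceTime f p
        = boxWave (withTime T X) a (spaceTime u) (spaceTime fun x t => ρ x * u x t) p) →
      (∀ i, h i ^ 2 ≤ H) → τ ^ 2 ≤ H → ∀ m, 1 ≤ m → m ≤ M - 1 → ∀ k ∈ innerNodes N,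
      |S.B h (sample h ρ * lamT τ (sampleT h τ u) m) k
        + 1 / 12 * τ ^ 2 * S.A a h (lamT τ (sampleT h τ u) m) k + S.A a h (sampleT h τ u m) k
        - fN h τ f m k| ≤ C * H ^ 2 := by
  obtain ⟨cB, hcB, hSB⟩ := S.exists_abs_B_sub_le
  obtain ⟨cA, hcA, hSA⟩ := S.exists_abs_A_sub_le a
  set sa := ∑ l, a l ^ 2 with hsa
  have hsa0 : 0 ≤ sa := Finset.sum_nonneg fun _ _ => sq_nonneg _
  refine ⟨cB * (8 * B) + cA * (8 * B) + cA * (8 * B) + (3 * B + n * (4 * B)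
    + sa * (4 * B + n * (8 * B)) + sa * (3 * B + n * (4 * B))), by positivity, ?_⟩
  intro X h T τ N M ρ f u H hm hU hZ hf hH hτH m hm1 hm2 k hk
  set L := withTime T X
  set U := spaceTime u
  set Z := spaceTime fun x t => ρ x * u x t
  have hH0 : 0 ≤ H := (sq_nonneg _).trans hτH
  have hk' := innerNodes_subset_closedNodes N hk
  have hs := hm.steps_pos
  have hne : ∀ i, h i ≠ 0 := fun i => (hm.h_pos i).ne'
  set t : ℝ := m * τ with ht
  have ht0 : 0 ≤ t := mul_nonneg (Nat.cast_nonneg _) hm.t_pos.le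
  have htT : t ≤ T := hm.time_le (by omega)
  have hp := hm.mem_box hk' ht0 htT
  set p := withTime t (node h k) with hpdef
  have hfit := fun i => hm.fits (mem_innerNodes.mp hk i) t
  have hfitN : Fits L (withTime τ h) none p := hm.time_fits hm1 hm2 _
  have hinj : ∀ {i j : Fin n}, i ≠ j → (some i : Option (Fin n)) ≠ some j :=
    fun hij h => hij (Option.some_injective _ h)
  have hsn : ∀ i : Fin n, (some i : Option (Fin n)) ≠ none := fun i => Option.some_ne_none i
  -- the mesh functions
  have ez : lamT τ (sampleT h τ u) m = sampleAt h (divLam (withTime τ h) none U) t :=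
    lamT_sampleAt h τ U hm1
  -- Since `ρ` does not depend on time, it passes under `Λ_t`. From here on `ρ u` is a smooth
  -- function in its own right, and no discrete product rule is needed.
  have eZ : sample h ρ * lamT τ (sampleT h τ u) m
      = sampleAt h (divLam (withTime τ h) none Z) t := by
    rw [← lamT_sampleAt h τ Z hm1]
    funext k
    simp only [Pi.mul_apply, lamT, sampleT, sample, sampleAt, Z, spaceTime, withTime, Option.elim]
    ring
  set z := sampleAt h (divLam (withTime τ h) none U) t with hz
  set zr := sampleAt h (divLam (withTime τ h) none Z) t with hzr
  -- remainders of the operators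
  have rB : |S.B h zr k - sN h zr k| ≤ cB * (H ^ 2 * (8 * B)) := by
    refine hSB h N zr _ hne (by positivity) (fun i j hij k hk => ?_) k hk
    refine abs_scaledLam_scaledLam_le (hH i) (hH j) ?_
    rw [hzr, lam_sampleAt h τ, lam_sampleAt h τ]
    exact hZ.abs_divLam_divLam_divLam_le hs (hinj hij) (hsn i) (hsn j) (hm.mem_box hk.1 ht0 htT)
      (hm.fits (hk.2 i (by simp)) t) (hm.fits (hk.2 j (by simp)) t) (hm.time_fits hm1 hm2 _)
  have rAU : |S.A a h (sampleAt h U t) k - AN a h (sampleAt h U t) k| ≤ cA * (H ^ 2 * (8 * B)) := by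
    refine hSA h N _ _ hne (by positivity) (fun i j l hij hil hjl k hk => ?_) k hk
    refine abs_scaledLam_scaledLam_le (hH i) (hH j) ?_
    rw [lam_sampleAt h τ, lam_sampleAt h τ, lam_sampleAt h τ]
    exact hU.abs_divLam_divLam_divLam_le hs (hinj hij) (hinj hil) (hinj hjl)
      (hm.mem_box hk.1 ht0 htT) (hm.fits (hk.2 i (by simp)) t) (hm.fits (hk.2 j (by simp)) t)
      (hm.fits (hk.2 l (by simp)) t)
  have hlz : ∀ j l, j ≠ l → ∀ k, InnerOn N {l, j} k →
      |scaledLam h j (lam h l z) k| ≤ H * (8 * B) := by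
    intro j l hjl k hk
    rw [hz, lam_sampleAt h τ, scaledLam_sampleAt h τ, abs_mul, abs_of_nonneg (by positivity)]
    refine mul_le_mul (by linarith [hH j]) ?_ (abs_nonneg _) hH0
    exact hU.abs_divLam_divLam_divLam_le hs (hinj hjl) (hsn j) (hsn l) (hm.mem_box hk.1 ht0 htT)
      (hm.fits (hk.2 j (by simp)) t) (hm.fits (hk.2 l (by simp)) t) (hm.time_fits hm1 hm2 _)
  -- Three spatial second differences of `Λ_t u` would need eight derivatives. The outer scaled
  -- difference is bounded by its stencil weights alone, which loses one power of `H`; the factor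
  -- `τ²/12` in front supplies it later.
  have rAz : |S.A a h z k - AN a h z k| ≤ cA * (H * (8 * B)) := by
    refine hSA h N _ _ hne (by positivity) (fun i j l hij hil hjl k hk => ?_) k hk
    refine ((abs_scaledLam_le (hne i) (hlz j l hjl) (by simp [hil, hij]) (hk.mono ?_)
      (hk.2 i (by simp))).1).trans ?_
    · intro x hx
      simp only [Set.mem_insert_iff, Set.mem_singleton_iff] at hx ⊢
      tauto
    · have : 0 ≤ H * (8 * B) := by positivity
      linarith
  -- the right-hand side
  have eF : ∀ s : ℝ, 0 ≤ s → s ≤ T → ∀ k ∈ closedNodes N, sampleAt h (spaceTime f) s k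
      = sampleAt h (boxWave L a U Z) s k := fun s h0 h1 k hk => hf _ (hm.mem_box hk h0 h1)
  set Wf : Fin n → (Option (Fin n) → ℝ) → ℝ := fun l => (boxDeriv L (some l))^[2] U with hWf
  set Rf := (boxDeriv L none)^[2] Z with hRf
  have ef : fN h τ f m k = Rf p - ∑ l, a l ^ 2 * Wf l p
      + ∑ i, (scaledLam h i (sampleAt h Rf t) k
        - ∑ l, a l ^ 2 * scaledLam h i (sampleAt h (Wf l) t) k)
      + 1 / 12 * τ ^ 2 * (divLam (withTime τ h) none Rf p
        - ∑ l, a l ^ 2 * divLam (withTime τ h) none (Wf l) p) := by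
    have e1 : sampleT h τ f m k = Rf p - ∑ l, a l ^ 2 * Wf l p := eF t ht0 htT k hk'
    have e2 : ∀ i, scaledLam h i (sampleT h τ f m) k = scaledLam h i (sampleAt h Rf t) k
        - ∑ l, a l ^ 2 * scaledLam h i (sampleAt h (Wf l) t) k := by
      intro i
      have : scaledLam h i (sampleT h τ f m) k = scaledLam h i (sampleAt h (boxWave L a U Z) t) k := by
        rw [sampleT_eq, scaledLam_apply, scaledLam_apply]
        exact congrArg _ (lam_congr h (eF t ht0 htT) hk i)
      rw [this]
      simp only [scaledLam_sampleAt h τ]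
      have : divLam (withTime τ h) (some i) (boxWave L a U Z) (withTime t (node h k))
          = divLam (withTime τ h) (some i) Rf p
            - ∑ l, a l ^ 2 * divLam (withTime τ h) (some i) (Wf l) p :=
        divLam_sub_sum (withTime τ h) (some i) Rf (fun l => a l ^ 2) Wf p
      rw [this, mul_sub, Finset.mul_sum]
      congr 1
      exact Finset.sum_congr rfl fun l _ => by ring
    have e3 : lamT τ (sampleT h τ f) m k = divLam (withTime τ h) none Rf p
        - ∑ l, a l ^ 2 * divLam (withTime τ h) none (Wf l) p := by
      have h1 : lamT τ (sampleT h τ f) m k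
          = lamT τ (fun j => sampleAt h (boxWave L a U Z) (j * τ)) m k := by
        simp only [lamT, sampleT_eq]
        rw [eF _ (by have := hm.t_pos; positivity) (hm.time_le (by omega)) k hk',
          eF _ (by have := hm.t_pos; positivity) (hm.time_le (by omega)) k hk',
          eF _ (by have := hm.t_pos; positivity) (hm.time_le (by omega)) k hk']
      rw [h1, lamT_sampleAt h τ _ hm1]
      exact divLam_sub_sum (withTime τ h) none Rf (fun l => a l ^ 2) Wf p
    simp only [fN, Pi.add_apply, Pi.smul_apply, smul_eq_mul, sN_apply, Finset.sum_apply, e1, e2, e3]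
  -- the errors
  have hτ4 : τ ^ 4 ≤ H ^ 2 := by
    calc τ ^ 4 = (τ ^ 2) ^ 2 := by ring
      _ ≤ H ^ 2 := pow_le_pow_left₀ (sq_nonneg _) hτH 2
  have E1 : |zr k - Rf p - 1 / 12 * τ ^ 2 * divLam (withTime τ h) none Rf p| ≤ 3 * B * H ^ 2 :=
    (hZ.abs_divLam_sub_sub_le hs hp hfitN).trans
      (mul_le_mul_of_nonneg_left hτ4 (by positivity))
  have E2 : |∑ i, (scaledLam h i zr k - scaledLam h i (sampleAt h Rf t) k)|
      ≤ n * (4 * B) * H ^ 2 := by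
    rw [mul_assoc]
    refine abs_sum_subset_le (by positivity) fun i _ => ?_
    have e2 := hZ.abs_divLam_divLam_sub_le hs (hsn i).symm hp hfitN (hfit i)
    rw [hzr, scaledLam_sampleAt h τ, scaledLam_sampleAt h τ, ← mul_sub, abs_mul,
      abs_of_nonneg (by positivity)]
    calc 1 / 12 * h i ^ 2 * _ ≤ 1 / 12 * H * (4 * B * τ ^ 2) :=
          mul_le_mul (by linarith [hH i]) e2 (abs_nonneg _) (by positivity)
      _ ≤ 1 / 12 * H * (4 * B * H) := by gcongr
      _ ≤ 4 * B * H ^ 2 := by nlinarith [mul_nonneg hB (sq_nonneg H)]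
  have E3 : |∑ l, a l ^ 2 * ((lam h l z k - divLam (withTime τ h) none (Wf l) p)
      + ∑ j ∈ Finset.univ.erase l, scaledLam h j (lam h l z) k)|
      ≤ sa * ((4 * B + n * (8 * B)) * H) := by
    refine abs_sum_mul_le (fun _ => sq_nonneg _) fun l => (abs_add_le _ _).trans ?_
    rw [add_mul]
    refine add_le_add ?_ ?_
    · have e2 := hU.abs_divLam_divLam_sub_le hs (hsn l) hp (hfit l) hfitN
      rw [divLam_comm] at e2
      rw [hz, lam_sampleAt h τ]
      exact e2.trans (mul_le_mul_of_nonneg_left (hH l) (by positivity))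
    · have := abs_sum_subset_le (s := Finset.univ.erase l)
        (e := fun j => scaledLam h j (lam h l z) k) (B := H * (8 * B)) (by positivity)
        fun j hj => hlz j l (Finset.ne_of_mem_erase hj) k (innerOn_of_mem_innerNodes hk _)
      exact this.trans_eq (by ring)
  have E4 := abs_sum_mul_le (c := fun l => a l ^ 2) (fun _ => sq_nonneg _)
    (abs_space_error_le hm hU hB hH hH0 hk ht0 htT)
  have key := main_error_identity (fun l => a l ^ 2) (1 / 12 * τ ^ 2) (zr k) (Rf p)
    (divLam (withTime τ h) none Rf p) (fun i => scaledLam h i zr k)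
    (fun i => scaledLam h i (sampleAt h Rf t) k) (fun l => lam h l z k)
    (fun l => divLam (withTime τ h) none (Wf l) p) (fun l => lam h l (sampleAt h U t) k)
    (fun l => Wf l p) (fun l j => scaledLam h j (lam h l z) k)
    (fun l j => scaledLam h j (lam h l (sampleAt h U t)) k)
    (fun l j => scaledLam h j (sampleAt h (Wf l) t) k)
  have E3' : |1 / 12 * τ ^ 2 * ∑ l, a l ^ 2 * ((lam h l z k - divLam (withTime τ h) none (Wf l) p)
      + ∑ j ∈ Finset.univ.erase l, scaledLam h j (lam h l z) k)|
      ≤ sa * (4 * B + n * (8 * B)) * H ^ 2 := by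
    rw [abs_mul, abs_of_nonneg (by positivity)]
    calc _ ≤ H * (sa * ((4 * B + n * (8 * B)) * H)) :=
          mul_le_mul (by linarith) E3 (abs_nonneg _) hH0
      _ = _ := by ring
  have rAz' : |1 / 12 * τ ^ 2 * (S.A a h z k - AN a h z k)| ≤ cA * (8 * B) * H ^ 2 := by
    rw [abs_mul, abs_of_nonneg (by positivity)]
    calc _ ≤ H * (cA * (H * (8 * B))) := mul_le_mul (by linarith) rAz (abs_nonneg _) hH0
      _ = _ := by ring
  rw [eZ, ez, sampleT_eq, ef]
  have hdecomp : S.B h zr k + 1 / 12 * τ ^ 2 * S.A a h z k + S.A a h (sampleAt h U t) k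
      - (Rf p - ∑ l, a l ^ 2 * Wf l p
      + ∑ i, (scaledLam h i (sampleAt h Rf t) k
        - ∑ l, a l ^ 2 * scaledLam h i (sampleAt h (Wf l) t) k)
      + 1 / 12 * τ ^ 2 * (divLam (withTime τ h) none Rf p
        - ∑ l, a l ^ 2 * divLam (withTime τ h) none (Wf l) p))
      = (S.B h zr k - sN h zr k) + 1 / 12 * τ ^ 2 * (S.A a h z k - AN a h z k)
        + (S.A a h (sampleAt h U t) k - AN a h (sampleAt h U t) k)
        + ((zr k - Rf p - 1 / 12 * τ ^ 2 * divLam (withTime τ h) none Rf p)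
          + ∑ i, (scaledLam h i zr k - scaledLam h i (sampleAt h Rf t) k)
          - 1 / 12 * τ ^ 2 * ∑ l, a l ^ 2 * ((lam h l z k - divLam (withTime τ h) none (Wf l) p)
            + ∑ j ∈ Finset.univ.erase l, scaledLam h j (lam h l z) k)
          - ∑ l, a l ^ 2 * ((lam h l (sampleAt h U t) k - Wf l p
              - scaledLam h l (sampleAt h (Wf l) t) k)
            + ∑ j ∈ Finset.univ.erase l, (scaledLam h j (lam h l (sampleAt h U t)) k
              - scaledLam h j (sampleAt h (Wf l) t) k))) := by
    rw [← key, AN_apply, AN_apply, sN_apply]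
    simp only [Pi.add_apply, Finset.sum_apply]
    ring
  rw [hdecomp]
  refine (abs_add_le _ _).trans ((add_le_add ((abs_add_le _ _).trans (add_le_add
    ((abs_add_le _ _).trans (add_le_add rB rAz')) rAU)) ((abs_sub _ _).trans (add_le_add
    ((abs_sub _ _).trans (add_le_add ((abs_add_le _ _).trans (add_le_add E1 E2)) E3')) E4))).trans
      (le_of_eq ?_))
  ring

end Errors

/-! ### Truncation error of the first step -/

section FirstStep

variable {n : ℕ}

/-- The argument of the inner levels with `δ_t` in place of `Λ_t`. Terms with the prefactor `τ/2`
that are already of fourth order use only `τ ≤ T`, which is how `T` enters the constant. `R j` and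
`W j l` stand for `∂_t^j (ρ u)` and `∂_t^j ∂_l² u`. -/
theorem exists_first_error_le (S : CompactScheme n) (a : Fin n → ℝ) {B : ℝ} (hB : 0 ≤ B) {T : ℝ}
    (hT : 0 ≤ T) (Cd : ℝ) :
    ∃ C : ℝ, 0 ≤ C ∧ ∀ {X h : Fin n → ℝ} {τ : ℝ} {N : Fin n → ℕ} {M : ℕ}
      {ρ u1 : (Fin n → ℝ) → ℝ} {f u : (Fin n → ℝ) → ℝ → ℝ} {fd : MeshFn n} {H : ℝ}
      {R : ℕ → (Option (Fin n) → ℝ) → ℝ} {W : ℕ → Fin n → (Option (Fin n) → ℝ) → ℝ},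
      IsMesh X T h N τ M → 1 ≤ M → SmoothBounded (withTime T X) (spaceTime u) B →
      SmoothBounded (withTime T X) (spaceTime fun x t => ρ x * u x t) B →
      (∀ j, R j = (boxDeriv (withTime T X) none)^[j] (spaceTime fun x t => ρ x * u x t)) →
      (∀ j l, W j l = (boxDeriv (withTime T X) none)^[j]
        ((boxDeriv (withTime T X) (some l))^[2] (spaceTime u))) →
      (∀ k ∈ closedNodes N, f (node h k) 0
        = R 2 (withTime 0 (node h k)) - ∑ l, a l ^ 2 * W 0 l (withTime 0 (node h k))) →
      (∀ k ∈ closedNodes N, u1 (node h k)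
        = boxDeriv (withTime T X) none (spaceTime u) (withTime 0 (node h k))) →
      (∀ k ∈ closedNodes N, ρ (node h k) * u1 (node h k) = R 1 (withTime 0 (node h k))) →
      (∀ k ∈ innerNodes N, |fd k
        - (R 2 (withTime 0 (node h k)) - ∑ l, a l ^ 2 * W 0 l (withTime 0 (node h k))
          + 1 / 3 * τ * (R 3 (withTime 0 (node h k))
            - ∑ l, a l ^ 2 * W 1 l (withTime 0 (node h k)))
          + 1 / 12 * τ ^ 2 * (R 4 (withTime 0 (node h k))
            - ∑ l, a l ^ 2 * W 2 l (withTime 0 (node h k))))| ≤ Cd * τ ^ 3) →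
      (∀ i, h i ^ 2 ≤ H) → τ ^ 2 ≤ H → ∀ k ∈ innerNodes N,
      |S.B h (sample h ρ * deltaFwd τ (sampleT h τ u) 0) k
        + 1 / 12 * τ ^ 2 * S.A a h (deltaFwd τ (sampleT h τ u) 0) k
        + 1 / 2 * τ * S.A a h (sampleT h τ u 0) k
        - (u1N a h τ ρ u1 k + 1 / 2 * τ * fN0 h f fd k)| ≤ C * H ^ 2 := by
  obtain ⟨cB, hcB, hSB⟩ := S.exists_abs_B_sub_le
  obtain ⟨cA, hcA, hSA⟩ := S.exists_abs_A_sub_le a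
  set sa := ∑ l, a l ^ 2 with hsa
  have hsa0 : 0 ≤ sa := Finset.sum_nonneg fun _ _ => sq_nonneg _
  refine ⟨cB * (4 * B) + cA * (4 * B) + T * (cA * (8 * B)) + (B + n * (2 * B)
    + sa * (5 * B + n * (4 * B)) + T * (sa * (3 * B + n * (4 * B)))) + |Cd|, by positivity, ?_⟩
  intro X h τ N M ρ u1 f u fd H R W hm hM1 hU hZ hR hW hf hu1 hρu1 hfd hH hτH k hk
  set L := withTime T X
  set U := spaceTime u
  set Z := spaceTime fun x t => ρ x * u x t
  have hH0 : 0 ≤ H := (sq_nonneg _).trans hτH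
  have hk' := innerNodes_subset_closedNodes N hk
  have hs := hm.steps_pos
  have hτ := hm.t_pos
  have hne : ∀ i, h i ≠ 0 := fun i => (hm.h_pos i).ne'
  have hτT : τ ≤ T := by simpa using hm.time_le hM1
  have hp := hm.mem_box hk' le_rfl hT
  set p := withTime 0 (node h k) with hpdef
  have hfit := fun i => hm.fits (mem_innerNodes.mp hk i) 0
  have hfitN : ∀ x : Fin n → ℝ, withTime 0 x none ≤ L none - withTime τ h none := fun x => by
    change (0 : ℝ) ≤ T - τ
    linarith
  have hinj : ∀ {i j : Fin n}, i ≠ j → (some i : Option (Fin n)) ≠ some j :=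
    fun hij h => hij (Option.some_injective _ h)
  have hsn : ∀ i : Fin n, (some i : Option (Fin n)) ≠ none := fun i => Option.some_ne_none i
  have ez : deltaFwd τ (sampleT h τ u) 0 = sampleAt h (divDel (withTime τ h) none U) 0 :=
    deltaFwd_sampleAt h τ U
  have eZ : sample h ρ * deltaFwd τ (sampleT h τ u) 0
      = sampleAt h (divDel (withTime τ h) none Z) 0 := by
    rw [← deltaFwd_sampleAt h τ Z]
    funext k
    simp only [Pi.mul_apply, deltaFwd, sampleT, sample, sampleAt, Z, spaceTime, withTime,
      Option.elim]
    ring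
  have eU : sampleT h τ u 0 = sampleAt h U 0 := by simp [sampleT_eq, U]
  set z := sampleAt h (divDel (withTime τ h) none U) 0 with hz
  set zr := sampleAt h (divDel (withTime τ h) none Z) 0 with hzr
  have rB : |S.B h zr k - sN h zr k| ≤ cB * (H ^ 2 * (4 * B)) := by
    refine hSB h N zr _ hne (by positivity) (fun i j hij k hk => ?_) k hk
    refine abs_scaledLam_scaledLam_le (hH i) (hH j) ?_
    rw [hzr, lam_sampleAt h τ, lam_sampleAt h τ]
    exact hZ.abs_divLam_divLam_divDel_le hs (hinj hij) (hsn i) (hsn j) (hm.mem_box hk.1 le_rfl hT)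
      (hm.fits (hk.2 i (by simp)) 0) (hm.fits (hk.2 j (by simp)) 0) (hfitN _)
  have rAU : |1 / 2 * τ * (S.A a h (sampleAt h U 0) k - AN a h (sampleAt h U 0) k)|
      ≤ T * (cA * (8 * B)) * H ^ 2 := by
    have : |S.A a h (sampleAt h U 0) k - AN a h (sampleAt h U 0) k|
        ≤ cA * (H ^ 2 * (8 * B)) := by
      refine hSA h N _ _ hne (by positivity) (fun i j l hij hil hjl k hk => ?_) k hk
      refine abs_scaledLam_scaledLam_le (hH i) (hH j) ?_
      rw [lam_sampleAt h τ, lam_sampleAt h τ, lam_sampleAt h τ]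
      exact hU.abs_divLam_divLam_divLam_le hs (hinj hij) (hinj hil) (hinj hjl)
        (hm.mem_box hk.1 le_rfl hT) (hm.fits (hk.2 i (by simp)) 0) (hm.fits (hk.2 j (by simp)) 0)
        (hm.fits (hk.2 l (by simp)) 0)
    rw [abs_mul, abs_of_nonneg (by positivity)]
    calc _ ≤ T * (cA * (H ^ 2 * (8 * B))) := mul_le_mul (by linarith) this (abs_nonneg _) hT
      _ = _ := by ring
  have hlz : ∀ j l, j ≠ l → ∀ k, InnerOn N {l, j} k →
      |scaledLam h j (lam h l z) k| ≤ H * (4 * B) := by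
    intro j l hjl k hk
    rw [hz, lam_sampleAt h τ, scaledLam_sampleAt h τ, abs_mul, abs_of_nonneg (by positivity)]
    refine mul_le_mul (by linarith [hH j]) ?_ (abs_nonneg _) hH0
    exact hU.abs_divLam_divLam_divDel_le hs (hinj hjl) (hsn j) (hsn l) (hm.mem_box hk.1 le_rfl hT)
      (hm.fits (hk.2 j (by simp)) 0) (hm.fits (hk.2 l (by simp)) 0) (hfitN _)
  -- The outer scaled difference is again bounded by its stencil weights only, to stay within six
  -- derivatives, and `τ²/12` restores the order.
  have rAz : |1 / 12 * τ ^ 2 * (S.A a h z k - AN a h z k)| ≤ cA * (4 * B) * H ^ 2 := by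
    have : |S.A a h z k - AN a h z k| ≤ cA * (H * (4 * B)) := by
      refine hSA h N _ _ hne (by positivity) (fun i j l hij hil hjl k hk => ?_) k hk
      refine ((abs_scaledLam_le (hne i) (hlz j l hjl) (by simp [hil, hij]) (hk.mono ?_)
        (hk.2 i (by simp))).1).trans ?_
      · intro x hx
        simp only [Set.mem_insert_iff, Set.mem_singleton_iff] at hx ⊢
        tauto
      · have : 0 ≤ H * (4 * B) := by positivity
        linarith
    rw [abs_mul, abs_of_nonneg (by positivity)]
    calc _ ≤ H * (cA * (H * (4 * B))) := mul_le_mul (by linarith) this (abs_nonneg _) hH0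
      _ = _ := by ring
  -- the right-hand sides
  have eu1 : u1N a h τ ρ u1 k = R 1 p + ∑ i, scaledLam h i (sampleAt h (R 1) 0) k
      + 1 / 12 * τ ^ 2 * ∑ l, a l ^ 2 * lam h l (sampleAt h (boxDeriv L none U) 0) k := by
    have e1 : ∀ k ∈ closedNodes N, (sample h ρ * sample h u1) k = sampleAt h (R 1) 0 k := hρu1
    have e2 : ∀ k ∈ closedNodes N, sample h u1 k = sampleAt h (boxDeriv L none U) 0 k := hu1
    have e3 : ∀ i, scaledLam h i (sample h ρ * sample h u1) k
        = scaledLam h i (sampleAt h (R 1) 0) k := fun i => by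
      rw [scaledLam_apply, scaledLam_apply, lam_congr h e1 hk i]
    simp only [u1N, Pi.add_apply, Pi.smul_apply, smul_eq_mul, sN_apply, Finset.sum_apply, e3,
      e1 k hk', LinearMap.sum_apply, LinearMap.smul_apply, lam_congr h e2 hk]
    rfl
  have ef : fN0 h f fd k = fd k + ∑ i, (scaledLam h i (sampleAt h (R 2) 0) k
      - ∑ l, a l ^ 2 * scaledLam h i (sampleAt h (W 0 l) 0) k) := by
    have e1 : ∀ k ∈ closedNodes N, sample h (fun x => f x 0) k
        = sampleAt h (fun p => R 2 p - ∑ l, a l ^ 2 * W 0 l p) 0 k := hf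
    have e2 : ∀ i, lam h i (sample h fun x => f x 0) k
        = lam h i (sampleAt h (R 2) 0) k - ∑ l, a l ^ 2 * lam h i (sampleAt h (W 0 l) 0) k := by
      intro i
      rw [lam_congr h e1 hk i]
      simp only [lam_sampleAt h τ]
      exact divLam_sub_sum (withTime τ h) (some i) (R 2) (fun l => a l ^ 2) (W 0) p
    simp only [fN0, Pi.add_apply, Pi.smul_apply, smul_eq_mul, LinearMap.sum_apply,
      LinearMap.smul_apply, Finset.sum_apply, e2, scaledLam_apply, Finset.mul_sum, mul_sub]
    congr 1
    refine Finset.sum_congr rfl fun i _ => ?_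
    congr 1
    · ring
    · exact Finset.sum_congr rfl fun l _ => by ring
  -- the errors
  have hτ4 : τ ^ 4 ≤ H ^ 2 := by
    calc τ ^ 4 = (τ ^ 2) ^ 2 := by ring
      _ ≤ H ^ 2 := pow_le_pow_left₀ (sq_nonneg _) hτH 2
  have E1 : |zr k - R 1 p - τ / 2 * R 2 p - τ ^ 2 / 6 * R 3 p - τ ^ 3 / 24 * R 4 p|
      ≤ B * H ^ 2 := by
    simp only [hR]
    exact (hZ.abs_divDel_sub4_le hs hp (hfitN _)).trans (mul_le_mul_of_nonneg_left hτ4 hB)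
  have E2 : |∑ i, (scaledLam h i zr k - scaledLam h i (sampleAt h (R 1) 0) k
      - τ / 2 * scaledLam h i (sampleAt h (R 2) 0) k)| ≤ n * (2 * B) * H ^ 2 := by
    rw [mul_assoc]
    refine abs_sum_subset_le (by positivity) fun i _ => ?_
    have e2 := hZ.abs_divLam_divDel_sub_le hs (hsn i) hp (hfit i) (hfitN _)
    have e3 : scaledLam h i zr k - scaledLam h i (sampleAt h (R 1) 0) k
        - τ / 2 * scaledLam h i (sampleAt h (R 2) 0) k = 1 / 12 * h i ^ 2 *
          (divLam (withTime τ h) (some i) (divDel (withTime τ h) none Z) p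
            - divLam (withTime τ h) (some i) (boxDeriv L none Z) p
            - withTime τ h none / 2 * divLam (withTime τ h) (some i) ((boxDeriv L none)^[2] Z) p) := by
      simp only [hzr, scaledLam_sampleAt h τ, hR, withTime, Option.elim, Function.iterate_one]
      ring
    rw [e3, abs_mul, abs_of_nonneg (by positivity)]
    calc 1 / 12 * h i ^ 2 * _ ≤ 1 / 12 * H * (2 * B * τ ^ 2) :=
          mul_le_mul (by linarith [hH i]) e2 (abs_nonneg _) (by positivity)
      _ ≤ 1 / 12 * H * (2 * B * H) := by gcongr
      _ ≤ 2 * B * H ^ 2 := by nlinarith [mul_nonneg hB (sq_nonneg H)]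
  have E3 : |1 / 12 * τ ^ 2 * ∑ l, a l ^ 2 * ((lam h l z k
        + lam h l (sampleAt h (boxDeriv L none U) 0) k - 2 * W 1 l p - τ / 2 * W 2 l p)
      + ∑ j ∈ Finset.univ.erase l, scaledLam h j (lam h l z) k)|
      ≤ sa * (5 * B + n * (4 * B)) * H ^ 2 := by
    rw [abs_mul, abs_of_nonneg (by positivity)]
    have : |∑ l, a l ^ 2 * ((lam h l z k
        + lam h l (sampleAt h (boxDeriv L none U) 0) k - 2 * W 1 l p - τ / 2 * W 2 l p)
      + ∑ j ∈ Finset.univ.erase l, scaledLam h j (lam h l z) k)|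
        ≤ sa * ((5 * B + n * (4 * B)) * H) := by
      refine abs_sum_mul_le (fun _ => sq_nonneg _) fun l => (abs_add_le _ _).trans ?_
      rw [add_mul]
      refine add_le_add ?_ ?_
      · have e1 := (hU.abs_divLam_divDel_sub_divDel_le hs (hsn l) hp (hfit l) (hfitN _)).trans
          (mul_le_mul_of_nonneg_left (hH l) (by positivity))
        have e2 := (hU.abs_divDel_deriv_sub_le (a := some l) hs hp (hfitN _)).trans
          (mul_le_mul_of_nonneg_left hτH hB)
        have e3 := (hU.abs_divLam_deriv_sub_le (t := none) hs hp (hfit l)).trans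
          (mul_le_mul_of_nonneg_left (hH l) (by positivity))
        -- Telescoping: `Λ_l δ_t u` is replaced by `δ_t ∂_l² u`, which is then expanded in time,
        -- while `Λ_l ∂_t u` is replaced by `∂_t ∂_l² u`.
        have e4 : lam h l z k + lam h l (sampleAt h (boxDeriv L none U) 0) k - 2 * W 1 l p
            - τ / 2 * W 2 l p
            = (divLam (withTime τ h) (some l) (divDel (withTime τ h) none U) p
                - divDel (withTime τ h) none ((boxDeriv L (some l))^[2] U) p)
              + (divDel (withTime τ h) none ((boxDeriv L (some l))^[2] U) p
                - boxDeriv L none ((boxDeriv L (some l))^[2] U) p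
                - withTime τ h none / 2
                  * (boxDeriv L none)^[2] ((boxDeriv L (some l))^[2] U) p)
              + (divLam (withTime τ h) (some l) (boxDeriv L none U) p
                - boxDeriv L none ((boxDeriv L (some l))^[2] U) p) := by
          have h1 : withTime τ h none = τ := rfl
          simp only [hz, lam_sampleAt h τ, hW, h1, Function.iterate_one]
          simp only [sampleAt]
          ring
        rw [e4]
        refine (abs_add_le _ _).trans ((add_le_add ((abs_add_le _ _).trans (add_le_add e1 e2))
          e3).trans (le_of_eq (by ring)))
      · have := abs_sum_subset_le (s := Finset.univ.erase l)
          (e := fun j => scaledLam h j (lam h l z) k) (B := H * (4 * B)) (by positivity)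
          fun j hj => hlz j l (Finset.ne_of_mem_erase hj) k (innerOn_of_mem_innerNodes hk _)
        exact this.trans_eq (by ring)
    calc _ ≤ H * (sa * ((5 * B + n * (4 * B)) * H)) :=
          mul_le_mul (by linarith) this (abs_nonneg _) hH0
      _ = _ := by ring
  have E4 : |1 / 2 * τ * ∑ l, a l ^ 2 * ((lam h l (sampleAt h U 0) k - W 0 l p
        - scaledLam h l (sampleAt h (W 0 l) 0) k)
      + ∑ j ∈ Finset.univ.erase l, (scaledLam h j (lam h l (sampleAt h U 0)) k
        - scaledLam h j (sampleAt h (W 0 l) 0) k))|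
      ≤ T * (sa * (3 * B + n * (4 * B))) * H ^ 2 := by
    rw [abs_mul, abs_of_nonneg (by positivity)]
    have := abs_sum_mul_le (c := fun l => a l ^ 2) (fun _ => sq_nonneg _)
      (abs_space_error_le hm hU hB hH hH0 hk le_rfl hT)
    have hW0 : ∀ l, W 0 l = (boxDeriv L (some l))^[2] U := fun l => hW 0 l
    simp only [hW0]
    calc _ ≤ T * (sa * ((3 * B + n * (4 * B)) * H ^ 2)) :=
          mul_le_mul (by linarith) this (abs_nonneg _) hT
      _ = _ := by ring
  -- The prefactor `τ/2` raises the admissible third order error of `fd` to the fourth order. The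
  -- absolute value of `Cd` is used because its sign is not prescribed.
  have E5 : |1 / 2 * τ * (fd k - (R 2 p - ∑ l, a l ^ 2 * W 0 l p
      + 1 / 3 * τ * (R 3 p - ∑ l, a l ^ 2 * W 1 l p)
      + 1 / 12 * τ ^ 2 * (R 4 p - ∑ l, a l ^ 2 * W 2 l p)))| ≤ |Cd| * H ^ 2 := by
    rw [abs_mul, abs_of_nonneg (by positivity)]
    calc _ ≤ 1 / 2 * τ * (|Cd| * τ ^ 3) := by
          refine mul_le_mul_of_nonneg_left ((hfd k hk).trans ?_) (by positivity)
          exact mul_le_mul_of_nonneg_right (le_abs_self _) (by positivity)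
      _ = 1 / 2 * |Cd| * τ ^ 4 := by ring
      _ ≤ |Cd| * H ^ 2 := mul_le_mul (by linarith [abs_nonneg Cd]) hτ4 (by positivity)
          (abs_nonneg _)
  have key := first_error_identity (fun l => a l ^ 2) τ (zr k) (R 1 p) (R 2 p) (R 3 p) (R 4 p)
    (fun i => scaledLam h i zr k) (fun i => scaledLam h i (sampleAt h (R 1) 0) k)
    (fun i => scaledLam h i (sampleAt h (R 2) 0) k) (fun l => lam h l z k)
    (fun l => lam h l (sampleAt h (boxDeriv L none U) 0) k)
    (fun l => lam h l (sampleAt h U 0) k)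
    (fun l => W 0 l p) (fun l => W 1 l p) (fun l => W 2 l p)
    (fun l j => scaledLam h j (lam h l z) k)
    (fun l j => scaledLam h j (lam h l (sampleAt h U 0)) k)
    (fun l j => scaledLam h j (sampleAt h (W 0 l) 0) k)
  rw [eZ, ez, eU, eu1, ef]
  have hdecomp : S.B h zr k + 1 / 12 * τ ^ 2 * S.A a h z k
      + 1 / 2 * τ * S.A a h (sampleAt h U 0) k
      - (R 1 p + ∑ i, scaledLam h i (sampleAt h (R 1) 0) k
      + 1 / 12 * τ ^ 2 * ∑ l, a l ^ 2 * lam h l (sampleAt h (boxDeriv L none U) 0) k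
        + 1 / 2 * τ * (fd k + ∑ i, (scaledLam h i (sampleAt h (R 2) 0) k
          - ∑ l, a l ^ 2 * scaledLam h i (sampleAt h (W 0 l) 0) k)))
      = (S.B h zr k - sN h zr k) + 1 / 12 * τ ^ 2 * (S.A a h z k - AN a h z k)
        + 1 / 2 * τ * (S.A a h (sampleAt h U 0) k - AN a h (sampleAt h U 0) k)
        + ((zr k - R 1 p - τ / 2 * R 2 p - τ ^ 2 / 6 * R 3 p - τ ^ 3 / 24 * R 4 p)
          + ∑ i, (scaledLam h i zr k - scaledLam h i (sampleAt h (R 1) 0) k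
            - τ / 2 * scaledLam h i (sampleAt h (R 2) 0) k)
          - 1 / 12 * τ ^ 2 * ∑ l, a l ^ 2 * ((lam h l z k
              + lam h l (sampleAt h (boxDeriv L none U) 0) k - 2 * W 1 l p - τ / 2 * W 2 l p)
            + ∑ j ∈ Finset.univ.erase l, scaledLam h j (lam h l z) k)
          - 1 / 2 * τ * ∑ l, a l ^ 2 * ((lam h l (sampleAt h U 0) k - W 0 l p
              - scaledLam h l (sampleAt h (W 0 l) 0) k)
            + ∑ j ∈ Finset.univ.erase l, (scaledLam h j (lam h l (sampleAt h U 0)) k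
              - scaledLam h j (sampleAt h (W 0 l) 0) k)))
        - 1 / 2 * τ * (fd k - (R 2 p - ∑ l, a l ^ 2 * W 0 l p
          + 1 / 3 * τ * (R 3 p - ∑ l, a l ^ 2 * W 1 l p)
          + 1 / 12 * τ ^ 2 * (R 4 p - ∑ l, a l ^ 2 * W 2 l p))) := by
    rw [← key, AN_apply, AN_apply, sN_apply]
    simp only [Pi.add_apply, Finset.sum_apply]
    ring
  rw [hdecomp]
  refine (abs_sub _ _).trans ((add_le_add ((abs_add_le _ _).trans (add_le_add
    ((abs_add_le _ _).trans (add_le_add ((abs_add_le _ _).trans (add_le_add rB rAz)) rAU))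
    ((abs_sub _ _).trans (add_le_add ((abs_sub _ _).trans (add_le_add
      ((abs_add_le _ _).trans (add_le_add E1 E2)) E3)) E4)))) E5).trans (le_of_eq ?_))
  ring

end FirstStep

/-! ### The data of the wave problem in terms of derivatives up to the boundary -/

section BoxCalculus

variable {ι : Type*} [DecidableEq ι] {L : ι → ℝ}

theorem update_mem_box {d : ι} {p : ι → ℝ} (hp : p ∈ Set.Icc 0 L) {s : ℝ}
    (hs : s ∈ Set.Icc 0 (L d)) : Function.update p d s ∈ Set.Icc 0 L := by
  refine ⟨fun i => ?_, fun i => ?_⟩ <;> by_cases hi : i = d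
  · subst hi; simpa using hs.1
  · simpa [hi] using hp.1 i
  · subst hi; simpa using hs.2
  · simpa [hi] using hp.2 i

variable [Fintype ι]

theorem hasDerivWithinAt_boxDeriv (hL : ∀ i, 0 < L i) {d : ι} {w : (ι → ℝ) → ℝ}
    (hw : ContDiffOn ℝ ((1 : ℕ) : WithTop ℕ∞) w (Set.Icc 0 L)) {p : ι → ℝ}
    (hp : p ∈ Set.Icc 0 L) :
    HasDerivWithinAt (fun s : ℝ => w (p + Pi.single d s)) (boxDeriv L d w p)
      {s | p + Pi.single d s ∈ Set.Icc 0 L} 0 :=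
  tower_boxDeriv hL d hw 0 one_pos p hp

/-- A coordinate line meets the box in a nondegenerate interval, also when the point lies on a face,
so derivatives along it are unique. Box derivatives can thus be computed by one-variable rules. -/
theorem boxDeriv_eq_of_hasDerivWithinAt (hL : ∀ i, 0 < L i) {d : ι} {w : (ι → ℝ) → ℝ}
    (hw : ContDiffOn ℝ ((1 : ℕ) : WithTop ℕ∞) w (Set.Icc 0 L)) {p : ι → ℝ}
    (hp : p ∈ Set.Icc 0 L) {v : ℝ}
    (h : HasDerivWithinAt (fun s : ℝ => w (p + Pi.single d s)) v
      {s | p + Pi.single d s ∈ Set.Icc 0 L} 0) : boxDeriv L d w p = v := by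
  have hset : {s : ℝ | p + Pi.single d s ∈ Set.Icc 0 L} = Set.Icc (-p d) (L d - p d) := by
    ext s
    constructor
    · intro hs
      have h1 := hs.1 d
      have h2 := hs.2 d
      simp only [Pi.zero_apply, Pi.add_apply, Pi.single_eq_same] at h1 h2
      exact ⟨by linarith, by linarith⟩
    · intro hs
      refine ⟨fun i => ?_, fun i => ?_⟩ <;> by_cases hi : i = d
      · subst hi
        simpa using (by linarith [hs.1] : 0 ≤ p i + s)
      · simpa [hi] using hp.1 i
      · subst hi
        simpa using (by linarith [hs.2] : p i + s ≤ L i)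
      · simpa [hi] using hp.2 i
  have hu : UniqueDiffWithinAt ℝ {s : ℝ | p + Pi.single d s ∈ Set.Icc 0 L} 0 := by
    rw [hset]
    exact uniqueDiffOn_Icc (by linarith [hL d]) 0
      ⟨by have := hp.1 d; simpa using this, by have := hp.2 d; linarith⟩
  exact hu.eq_deriv _ (hasDerivWithinAt_boxDeriv hL hw hp) h

theorem boxDeriv_sub_sum (hL : ∀ i, 0 < L i) {κ : Type*} [Fintype κ] (d : ι)
    {v : (ι → ℝ) → ℝ} (c : κ → ℝ) {w : κ → (ι → ℝ) → ℝ}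
    (hv : ContDiffOn ℝ ((1 : ℕ) : WithTop ℕ∞) v (Set.Icc 0 L))
    (hw : ∀ l, ContDiffOn ℝ ((1 : ℕ) : WithTop ℕ∞) (w l) (Set.Icc 0 L)) :
    Set.EqOn (boxDeriv L d fun p => v p - ∑ l, c l * w l p)
      (fun p => boxDeriv L d v p - ∑ l, c l * boxDeriv L d (w l) p) (Set.Icc 0 L) := by
  intro p hp
  refine boxDeriv_eq_of_hasDerivWithinAt hL
    (hv.sub (ContDiffOn.sum fun l _ => contDiffOn_const.mul (hw l))) hp ?_
  exact (hasDerivWithinAt_boxDeriv hL hv hp).sub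
    (HasDerivWithinAt.fun_sum fun l _ => (hasDerivWithinAt_boxDeriv hL (hw l) hp).const_mul (c l))

theorem boxDeriv_mul (hL : ∀ i, 0 < L i) {d : ι} {r w : (ι → ℝ) → ℝ}
    (hr : ContDiffOn ℝ ((1 : ℕ) : WithTop ℕ∞) r (Set.Icc 0 L))
    (hrd : ∀ p s, r (p + Pi.single d s) = r p)
    (hw : ContDiffOn ℝ ((1 : ℕ) : WithTop ℕ∞) w (Set.Icc 0 L)) :
    Set.EqOn (boxDeriv L d fun p => r p * w p) (fun p => r p * boxDeriv L d w p)
      (Set.Icc 0 L) := by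
  intro p hp
  refine boxDeriv_eq_of_hasDerivWithinAt hL (hr.mul hw) hp ?_
  simp only [hrd]
  exact (hasDerivWithinAt_boxDeriv hL hw hp).const_mul (r p)

/-- A factor that is constant along `d` contributes no product-rule terms. It is applied with `ρ`
and the time direction. -/
theorem boxDeriv_iterate_mul (hL : ∀ i, 0 < L i) {d : ι} {r w : (ι → ℝ) → ℝ}
    (hr : ContDiffOn ℝ ((1 : ℕ) : WithTop ℕ∞) r (Set.Icc 0 L))
    (hrd : ∀ p s, r (p + Pi.single d s) = r p) (j : ℕ)
    (hw : ContDiffOn ℝ (j : WithTop ℕ∞) w (Set.Icc 0 L)) :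
    Set.EqOn ((boxDeriv L d)^[j] fun p => r p * w p) (fun p => r p * (boxDeriv L d)^[j] w p)
      (Set.Icc 0 L) := by
  induction j with
  | zero => exact fun _ _ => rfl
  | succ j ih =>
    intro p hp
    simp only [Function.iterate_succ_apply']
    exact (boxDeriv_congr (ih (hw.of_le (by exact_mod_cast j.le_succ))) hp).trans
      (boxDeriv_mul hL hr hrd (ContDiffOn.boxDeriv_iterate hL d j (m := 1)
        (by rwa [add_comm])) hp)

theorem hasDerivWithinAt_update (hL : ∀ i, 0 < L i) {d : ι} {w : (ι → ℝ) → ℝ}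
    (hw : ContDiffOn ℝ ((1 : ℕ) : WithTop ℕ∞) w (Set.Icc 0 L)) {p : ι → ℝ}
    (hp : p ∈ Set.Icc 0 L) {s : ℝ} (hs : s ∈ Set.Icc 0 (L d)) :
    HasDerivWithinAt (fun r => w (Function.update p d r)) (boxDeriv L d w (Function.update p d s))
      (Set.Icc 0 (L d)) s := by
  have e : ∀ r, Function.update p d s + Pi.single d (r - s) = Function.update p d r := by
    intro r
    funext i
    by_cases hi : i = d
    · subst hi; simp
    · simp [hi]
  have h2 : HasDerivWithinAt (fun r : ℝ => r - s) 1 (Set.Icc 0 (L d)) s :=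
    (hasDerivWithinAt_id _ _).sub_const s
  have h3 := HasDerivWithinAt.comp (h := fun r : ℝ => r - s) s
    (by simpa using hasDerivWithinAt_boxDeriv (d := d) hL hw (update_mem_box hp hs)) h2 (by
      intro r hr
      change _ ∈ Set.Icc 0 L
      rw [e]
      exact update_mem_box hp hr)
  refine (h3.congr_deriv (mul_one _)).congr_of_mem (fun r _ => ?_) hs
  simp only [Function.comp, e]

theorem iteratedDerivWithin_update (hL : ∀ i, 0 < L i) {d : ι} {p : ι → ℝ}
    (hp : p ∈ Set.Icc 0 L) (j : ℕ) {w : (ι → ℝ) → ℝ}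
    (hw : ContDiffOn ℝ (j : WithTop ℕ∞) w (Set.Icc 0 L)) :
    Set.EqOn (iteratedDerivWithin j (fun r => w (Function.update p d r)) (Set.Icc 0 (L d)))
      (fun s => (boxDeriv L d)^[j] w (Function.update p d s)) (Set.Icc 0 (L d)) := by
  induction j with
  | zero => intro s _; simp
  | succ j ih =>
    intro s hs
    rw [iteratedDerivWithin_succ, derivWithin_congr
      (ih (hw.of_le (by exact_mod_cast j.le_succ)))
      (ih (hw.of_le (by exact_mod_cast j.le_succ)) hs)]
    simp only [Function.iterate_succ_apply']
    exact (hasDerivWithinAt_update hL (ContDiffOn.boxDeriv_iterate hL d j (m := 1)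
        (by rwa [add_comm])) hp hs).derivWithin (uniqueDiffOn_Icc (hL d) s hs)

/-- Links the two-sided derivatives in the differential equation with the derivatives within the
box. At interior points of the line they coincide in a whole neighbourhood, so they can be
differentiated again. -/
theorem iteratedDeriv_two_update (hL : ∀ i, 0 < L i) {d : ι} {p : ι → ℝ}
    (hp : p ∈ Set.Icc 0 L) {w : (ι → ℝ) → ℝ}
    (hw : ContDiffOn ℝ ((2 : ℕ) : WithTop ℕ∞) w (Set.Icc 0 L)) {s : ℝ}
    (hs : s ∈ Set.Ioo 0 (L d)) :
    iteratedDeriv 2 (fun r => w (Function.update p d r)) s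
      = (boxDeriv L d)^[2] w (Function.update p d s) := by
  have h1 : ∀ r ∈ Set.Ioo 0 (L d), deriv (fun r => w (Function.update p d r)) r
      = boxDeriv L d w (Function.update p d r) := fun r hr =>
    ((hasDerivWithinAt_update hL (hw.of_le (by norm_num)) hp
      (Set.Ioo_subset_Icc_self hr)).hasDerivAt (Icc_mem_nhds hr.1 hr.2)).deriv
  have h2 : deriv (fun r => w (Function.update p d r)) =ᶠ[nhds s]
      fun r => boxDeriv L d w (Function.update p d r) :=
    Filter.eventually_of_mem (isOpen_Ioo.mem_nhds hs) h1
  rw [iteratedDeriv_succ, iteratedDeriv_one, h2.deriv_eq]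
  exact ((hasDerivWithinAt_update hL (ContDiffOn.boxDeriv hL d hw) hp
      (Set.Ioo_subset_Icc_self hs)).hasDerivAt (Icc_mem_nhds hs.1 hs.2)).deriv

end BoxCalculus

/-! ### The differential equation and its data on the closed box -/

section WaveData

variable {n : ℕ} {X a : Fin n → ℝ} {T : ℝ} {ρ : (Fin n → ℝ) → ℝ} {f g : (Fin n → ℝ) → ℝ → ℝ}
  {u0 u1 : (Fin n → ℝ) → ℝ} {u : (Fin n → ℝ) → ℝ → ℝ}

theorem withTime_pos (hX : ∀ i, 0 < X i) (hT : 0 < T) (d : Option (Fin n)) :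
    0 < withTime T X d := by
  cases d with
  | none => exact hT
  | some i => exact hX i

theorem withTime_mem_box_iff {x : Fin n → ℝ} {t : ℝ} :
    withTime t x ∈ Set.Icc 0 (withTime T X) ↔ x ∈ closedBox X ∧ t ∈ Set.Icc 0 T := by
  simp only [closedBox, Set.mem_Icc, Pi.le_def, Option.forall, withTime, Option.elim, Set.mem_pi,
    Set.mem_univ, true_imp_iff, Pi.zero_apply, forall_and]
  tauto

theorem withTime_eta (p : Option (Fin n) → ℝ) : withTime (p none) (fun i => p (some i)) = p := by
  funext d
  cases d <;> rfl

theorem mapsTo_box : Set.MapsTo (fun p : Option (Fin n) → ℝ => ((fun i => p (some i)), p none))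
    (Set.Icc 0 (withTime T X)) (closedBox X ×ˢ Set.Icc 0 T) := by
  intro p hp
  rw [← withTime_eta p, withTime_mem_box_iff] at hp
  exact hp

theorem contDiffOn_spaceTime {K : ℕ} (hu : SmoothInTimeSpace K X T u) :
    ContDiffOn ℝ (K : WithTop ℕ∞) (spaceTime u) (Set.Icc 0 (withTime T X)) := by
  have h1 : ContDiff ℝ (K : WithTop ℕ∞)
      (fun p : Option (Fin n) → ℝ => ((fun i => p (some i)), p none)) := by fun_prop
  exact ContDiffOn.comp (g := fun q : (Fin n → ℝ) × ℝ => u q.1 q.2) hu h1.contDiffOn mapsTo_box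

theorem contDiffOn_space {K : ℕ} (hρ : ContDiffOn ℝ (K : WithTop ℕ∞) ρ (closedBox X)) :
    ContDiffOn ℝ (K : WithTop ℕ∞) (fun p : Option (Fin n) → ℝ => ρ fun i => p (some i))
      (Set.Icc 0 (withTime T X)) := by
  have h1 : ContDiff ℝ (K : WithTop ℕ∞)
      (fun p : Option (Fin n) → ℝ => (fun i => p (some i))) := by fun_prop
  exact ContDiffOn.comp hρ h1.contDiffOn fun p hp => (mapsTo_box hp).1

theorem update_withTime_none (t s : ℝ) (x : Fin n → ℝ) :
    Function.update (withTime t x) none s = withTime s x := by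
  funext d
  cases d <;> simp [withTime]

theorem update_withTime_some (t s : ℝ) (x : Fin n → ℝ) (i : Fin n) :
    Function.update (withTime t x) (some i) s = withTime t (Function.update x i s) := by
  funext d
  cases d with
  | none => simp [withTime]
  | some j => by_cases hj : j = i <;> simp [withTime, hj]

/-- The box without its boundary is dense in the box. -/
theorem box_subset_closure {ι : Type*} {L : ι → ℝ} (hL : ∀ i, 0 < L i) :
    Set.Icc 0 L ⊆ closure (Set.univ.pi fun i => Set.Ioo 0 (L i)) := by
  rw [closure_pi_set, ← Set.pi_univ_Icc]
  exact Set.pi_mono fun i _ => by rw [closure_Ioo (hL i).ne]; rfl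

theorem contDiffOn_spaceTime_mul {K : ℕ}
    (hρ : ContDiffOn ℝ (K : WithTop ℕ∞) ρ (closedBox X)) (hu : SmoothInTimeSpace K X T u) :
    ContDiffOn ℝ (K : WithTop ℕ∞) (spaceTime fun x t => ρ x * u x t)
      (Set.Icc 0 (withTime T X)) :=
  (contDiffOn_space hρ).mul (contDiffOn_spaceTime hu)

theorem boxDeriv_time_iterate_mul (hX : ∀ i, 0 < X i) (hT : 0 < T) (j : ℕ) {K : ℕ} (hK : 1 ≤ K)
    (hj : j ≤ K) (hρ : ContDiffOn ℝ (K : WithTop ℕ∞) ρ (closedBox X))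
    (hu : SmoothInTimeSpace K X T u) {p : Option (Fin n) → ℝ}
    (hp : p ∈ Set.Icc 0 (withTime T X)) :
    (boxDeriv (withTime T X) none)^[j] (spaceTime fun x t => ρ x * u x t) p
      = ρ (fun i => p (some i)) * (boxDeriv (withTime T X) none)^[j] (spaceTime u) p :=
  boxDeriv_iterate_mul (withTime_pos hX hT)
    (contDiffOn_space (hρ.of_le (by exact_mod_cast hK)))
    (fun p s => by simp) j ((contDiffOn_spaceTime hu).of_le (by exact_mod_cast hj)) hp

theorem boxWave_contDiffOn (hX : ∀ i, 0 < X i) (hT : 0 < T) {m : ℕ}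
    (hρ : ContDiffOn ℝ ((m + 2 : ℕ) : WithTop ℕ∞) ρ (closedBox X))
    (hu : SmoothInTimeSpace (m + 2) X T u) :
    ContDiffOn ℝ (m : WithTop ℕ∞) (boxWave (withTime T X) a (spaceTime u)
      (spaceTime fun x t => ρ x * u x t)) (Set.Icc 0 (withTime T X)) :=
  (ContDiffOn.boxDeriv_iterate (withTime_pos hX hT) none 2
    (contDiffOn_spaceTime_mul hρ hu)).sub
    (ContDiffOn.sum fun l _ => contDiffOn_const.mul
      (ContDiffOn.boxDeriv_iterate (withTime_pos hX hT) (some l) 2 (contDiffOn_spaceTime hu)))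

/-- The equation holds up to the boundary. -/
theorem IsSolution.eq_boxWave (hsol : IsSolution X a T ρ f g u0 u1 u) (hX : ∀ i, 0 < X i)
    (hT : 0 < T) (hρ : ContDiffOn ℝ ((2 : ℕ) : WithTop ℕ∞) ρ (closedBox X))
    (hu : SmoothInTimeSpace 2 X T u)
    (hf : ContinuousOn (fun p : (Fin n → ℝ) × ℝ => f p.1 p.2) (closedBox X ×ˢ Set.Icc 0 T)) :
    Set.EqOn (spaceTime f) (boxWave (withTime T X) a (spaceTime u)
      (spaceTime fun x t => ρ x * u x t)) (Set.Icc 0 (withTime T X)) := by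
  have hL := withTime_pos hX hT
  have hsub : (Set.univ.pi fun i => Set.Ioo 0 (withTime T X i)) ⊆ Set.Icc 0 (withTime T X) := by
    rw [← Set.pi_univ_Icc]
    exact Set.pi_mono fun i _ => Set.Ioo_subset_Icc_self
  have hfc : ContinuousOn (spaceTime f) (Set.Icc 0 (withTime T X)) :=
    ContinuousOn.comp (g := fun q : (Fin n → ℝ) × ℝ => f q.1 q.2) hf
      (Continuous.continuousOn (by fun_prop)) mapsTo_box
  -- Both sides are continuous on the closed box and the open box is dense in it. The extension is
  -- needed because the right-hand sides of the scheme read `f` at boundary nodes and at the end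
  -- times.
  refine Set.EqOn.of_subset_closure ?_ hfc
    (boxWave_contDiffOn (m := 0) hX hT hρ hu).continuousOn hsub (box_subset_closure hL)
  intro p hp
  have hp' := hsub hp
  have hpt : p none ∈ Set.Ioo 0 T := hp none trivial
  have hpx : ∀ i, p (some i) ∈ Set.Ioo 0 (X i) := fun i => hp (some i) trivial
  have h1 := hsol.pde (fun i => p (some i)) (fun i _ => hpx i) (p none) hpt
  have h2 := iteratedDeriv_two_update hL (d := none) hp' (contDiffOn_spaceTime hu) hpt
  have h3 := fun i => iteratedDeriv_two_update hL (d := some i) hp' (contDiffOn_spaceTime hu)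
    (hpx i)
  have e := withTime_eta p
  rw [Function.update_eq_self, ← e] at h2
  simp only [update_withTime_none] at h2
  have h3' : ∀ i, iteratedDeriv 2 (fun r => u (Function.update (fun i => p (some i)) i r) (p none))
      (p (some i)) = (boxDeriv (withTime T X) (some i))^[2] (spaceTime u) p := by
    intro i
    have h4 := h3 i
    rw [Function.update_eq_self] at h4
    rw [← h4]
    congr 1
    funext r
    rw [← e, update_withTime_some]
    rfl
  change f (fun i => p (some i)) (p none) = _
  rw [← h1, boxWave, boxDeriv_time_iterate_mul hX hT 2 one_le_two le_rfl hρ hu hp']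
  simp only [h3']
  congr 2
  rw [← e, ← h2]
  rfl

theorem IsSolution.deriv_zero (hsol : IsSolution X a T ρ f g u0 u1 u) (hX : ∀ i, 0 < X i)
    (hT : 0 < T) (hu : SmoothInTimeSpace 1 X T u) {x : Fin n → ℝ} (hx : x ∈ closedBox X) :
    u1 x = boxDeriv (withTime T X) none (spaceTime u) (withTime 0 x) := by
  have hL := withTime_pos hX hT
  have hp : withTime 0 x ∈ Set.Icc 0 (withTime T X) :=
    withTime_mem_box_iff.mpr ⟨hx, le_rfl, hT.le⟩
  have h0 : (0 : ℝ) ∈ Set.Icc 0 T := ⟨le_rfl, hT.le⟩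
  have h := iteratedDerivWithin_update hL (d := none) hp 1 (contDiffOn_spaceTime hu) h0
  rw [iteratedDerivWithin_one] at h
  simp only [update_withTime_none, Function.iterate_one] at h
  rw [← hsol.initial_deriv x hx, ← h]
  rfl

/-- The value `f_d^{(0)}` in terms of derivatives of `ρ u` and `u`. -/
theorem IsSolution.fd0_eq (hsol : IsSolution X a T ρ f g u0 u1 u) (hX : ∀ i, 0 < X i)
    (hT : 0 < T) (hρ : ContDiffOn ℝ ((4 : ℕ) : WithTop ℕ∞) ρ (closedBox X))
    (hu : SmoothInTimeSpace 4 X T u)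
    (hf : ContinuousOn (fun p : (Fin n → ℝ) × ℝ => f p.1 p.2) (closedBox X ×ˢ Set.Icc 0 T))
    (τ : ℝ) {x : Fin n → ℝ} (hx : x ∈ closedBox X)
    {R : ℕ → (Option (Fin n) → ℝ) → ℝ} {W : ℕ → Fin n → (Option (Fin n) → ℝ) → ℝ}
    (hR : ∀ j, R j = (boxDeriv (withTime T X) none)^[j] (spaceTime fun x t => ρ x * u x t))
    (hW : ∀ j l, W j l = (boxDeriv (withTime T X) none)^[j]
      ((boxDeriv (withTime T X) (some l))^[2] (spaceTime u))) :
    fd0 T τ f x = R 2 (withTime 0 x) - ∑ l, a l ^ 2 * W 0 l (withTime 0 x)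
      + 1 / 3 * τ * (R 3 (withTime 0 x) - ∑ l, a l ^ 2 * W 1 l (withTime 0 x))
      + 1 / 12 * τ ^ 2 * (R 4 (withTime 0 x) - ∑ l, a l ^ 2 * W 2 l (withTime 0 x)) := by
  have hL := withTime_pos hX hT
  set L := withTime T X
  have hp : withTime 0 x ∈ Set.Icc 0 L := withTime_mem_box_iff.mpr ⟨hx, le_rfl, hT.le⟩
  have h0 : (0 : ℝ) ∈ Set.Icc 0 T := ⟨le_rfl, hT.le⟩
  have hF := hsol.eq_boxWave hX hT (hρ.of_le (by norm_num)) (hu.of_le (by norm_num)) hf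
  set G := boxWave L a (spaceTime u) (spaceTime fun x t => ρ x * u x t)
  have hG : ContDiffOn ℝ ((2 : ℕ) : WithTop ℕ∞) G (Set.Icc 0 L) := boxWave_contDiffOn hX hT hρ hu
  -- `f x` and `G` along the time line agree on all of `[0, T]`, so their one-sided derivatives at
  -- `0` agree too; the regularity of `f` in time is thus inherited from `ρ` and `u`.
  have hfx : Set.EqOn (f x) (fun r => G (Function.update (withTime 0 x) none r))
      (Set.Icc 0 T) := by
    intro r hr
    simp only [update_withTime_none]
    exact hF (withTime_mem_box_iff.mpr ⟨hx, hr⟩)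
  have e : ∀ j ≤ 2, iteratedDerivWithin j (f x) (Set.Icc 0 T) 0
      = (boxDeriv L none)^[j] G (withTime 0 x) := by
    intro j hj
    rw [iteratedDerivWithin_congr hfx h0]
    have := iteratedDerivWithin_update hL (d := none) hp j
      (hG.of_le (by exact_mod_cast hj)) h0
    simp only [update_withTime_none] at this ⊢
    exact this
  have hRs : ∀ j ≤ 1, ContDiffOn ℝ ((1 : ℕ) : WithTop ℕ∞) (R (j + 2)) (Set.Icc 0 L) := by
    intro j hj
    rw [hR]
    exact ContDiffOn.boxDeriv_iterate hL none _ ((contDiffOn_spaceTime_mul hρ hu).of_le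
      (by exact_mod_cast (by omega : 1 + (j + 2) ≤ 4)))
  have hWs : ∀ j ≤ 1, ∀ l, ContDiffOn ℝ ((1 : ℕ) : WithTop ℕ∞) (W j l) (Set.Icc 0 L) := by
    intro j hj l
    rw [hW]
    exact ContDiffOn.boxDeriv_iterate hL none _ (ContDiffOn.boxDeriv_iterate hL (some l) 2
      ((contDiffOn_spaceTime hu).of_le (by exact_mod_cast (by omega : 1 + j + 2 ≤ 4))))
  have hRn : ∀ j, boxDeriv L none (R j) = R (j + 1) := fun j => by
    rw [hR, hR, Function.iterate_succ_apply']
  have hWn : ∀ j l, boxDeriv L none (W j l) = W (j + 1) l := fun j l => by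
    rw [hW j, hW (j + 1)]
    exact (Function.iterate_succ_apply' _ _ _).symm
  have g0 : G = fun p => R 2 p - ∑ l, a l ^ 2 * W 0 l p := by
    funext p
    simp only [hR, hW]
    rfl
  have g1 : Set.EqOn (boxDeriv L none G) (fun p => R 3 p - ∑ l, a l ^ 2 * W 1 l p)
      (Set.Icc 0 L) := by
    rw [g0]
    have := boxDeriv_sub_sum hL none (fun l => a l ^ 2) (hRs 0 zero_le_one) (hWs 0 zero_le_one)
    simpa only [hRn, hWn] using this
  have g2 : Set.EqOn ((boxDeriv L none)^[2] G) (fun p => R 4 p - ∑ l, a l ^ 2 * W 2 l p)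
      (Set.Icc 0 L) := by
    have := boxDeriv_sub_sum hL none (fun l => a l ^ 2) (hRs 1 le_rfl) (hWs 1 le_rfl)
    simp only [hRn, hWn] at this
    exact fun p hp => (boxDeriv_congr g1 hp).trans (this hp)
  have e0 := e 0 (by norm_num)
  have e1 := e 1 (by norm_num)
  have e2 := e 2 le_rfl
  rw [iteratedDerivWithin_zero] at e0
  rw [iteratedDerivWithin_one] at e1
  rw [Function.iterate_one, g1 hp] at e1
  rw [fd0, e0, e1, e2, g2 hp, Function.iterate_zero, id, g0]

end WaveData

/-! ### Stability and consistency combined -/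

section Convergence

variable {n : ℕ}

theorem lamT_sub (τ : ℝ) (y v : ℕ → MeshFn n) (m : ℕ) :
    lamT τ (fun j => y j - v j) m = lamT τ y m - lamT τ v m := by
  funext k
  simp only [Pi.sub_apply, lamT]
  ring

theorem deltaFwd_sub (τ : ℝ) (y v : ℕ → MeshFn n) (m : ℕ) :
    deltaFwd τ (fun j => y j - v j) m = deltaFwd τ y m - deltaFwd τ v m := by
  funext k
  simp only [Pi.sub_apply, deltaFwd]
  ring

namespace IsMesh

variable {X h : Fin n → ℝ} {T τ : ℝ} {N : Fin n → ℕ} {M : ℕ}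

theorem node_mem_closedBox (hm : IsMesh X T h N τ M) (hT : 0 ≤ T) {k : Fin n → ℤ}
    (hk : k ∈ closedNodes N) : node h k ∈ closedBox X :=
  (withTime_mem_box_iff.mp (hm.mem_box hk le_rfl hT)).1

theorem node_notMem_openBox (hm : IsMesh X T h N τ M) {k : Fin n → ℤ}
    (hk : k ∉ innerNodes N) : node h k ∉ openBox X := by
  intro hx
  refine hk (mem_innerNodes.mpr fun i => ?_)
  obtain ⟨h1, h2⟩ := hx i trivial
  change 0 < (k i : ℝ) * h i at h1
  change (k i : ℝ) * h i < X i at h2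
  rw [← hm.h_mul] at h2
  have h3 : (0 : ℝ) < k i := pos_of_mul_pos_left h1 (hm.h_pos i).le
  have h4 : (k i : ℝ) < N i := lt_of_mul_lt_mul_right h2 (hm.h_pos i).le
  have h5 : 0 < k i := by exact_mod_cast h3
  have h6 : k i < N i := by exact_mod_cast h4
  exact ⟨by omega, by omega⟩

end IsMesh

variable {X a : Fin n → ℝ} {T : ℝ} {ρ : (Fin n → ℝ) → ℝ} {f g : (Fin n → ℝ) → ℝ → ℝ}
  {u0 u1 : (Fin n → ℝ) → ℝ} {u : (Fin n → ℝ) → ℝ → ℝ}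

/-- The fourth order error bound for sufficiently smooth solutions. -/
theorem exists_error_le (S : CompactScheme n) (hX : ∀ i, 0 < X i) (hT : 0 < T) {r : ℝ}
    (hr : 0 < r) (hρ : ∀ x ∈ closedBox X, r ≤ ρ x)
    (hρs : ContDiffOn ℝ ((6 : ℕ) : WithTop ℕ∞) ρ (closedBox X)) (hu : SmoothInTimeSpace 6 X T u)
    (hf : ContinuousOn (fun p : (Fin n → ℝ) × ℝ => f p.1 p.2) (closedBox X ×ˢ Set.Icc 0 T))
    (hsol : IsSolution X a T ρ f g u0 u1 u) {ε ν0 ν : ℝ} (Cd : ℝ) (hε : 0 < ε) (hε1 : ε < 1)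
    (hν0 : 0 < ν0) (hν : ν0 ≤ ν) :
    ∃ C : ℝ, ∀ (N : Fin n → ℕ) (M : ℕ), (∀ i, 1 ≤ N i) → 2 ≤ M →
      ∀ (h : Fin n → ℝ) (τ : ℝ), (∀ i, h i = X i / N i) → τ = T / M →
      S.Stable a h N τ ε r →
      LeOp h N (ν0 • (1 : MeshOp n)) (S.B h) → LeOp h N (S.B h) (ν • (1 : MeshOp n)) →
      ∀ fd : MeshFn n, (∀ k ∈ innerNodes N, |fd k - fd0 T τ f (node h k)| ≤ Cd * τ ^ 3) →
      ∀ v : ℕ → MeshFn n, SolvesScheme (S.B h) (S.A a h) a h N τ M ρ f g u0 u1 fd v →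
      ∀ m, 1 ≤ m → m ≤ M →
        ε * normH h N (fun k => √(ρ (node h k)) *
            deltaBar τ (fun j => sampleT h τ u j - v j) m k)
          + normOp h N (S.A a h) (sBar (fun j => sampleT h τ u j - v j) m)
        ≤ C * stepSize h τ ^ 4 := by
  have hL := withTime_pos hX hT
  obtain ⟨B1, hB1⟩ := SmoothBounded.exists_of_contDiffOn hL (contDiffOn_spaceTime hu)
  obtain ⟨B2, hB2⟩ := SmoothBounded.exists_of_contDiffOn hL (contDiffOn_spaceTime_mul hρs hu)
  set B := |B1| + |B2|
  have hB : 0 ≤ B := by positivity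
  have hU : SmoothBounded (withTime T X) (spaceTime u) B :=
    hB1.mono ((le_abs_self _).trans (le_add_of_nonneg_right (abs_nonneg _)))
  have hZ : SmoothBounded (withTime T X) (spaceTime fun x t => ρ x * u x t) B :=
    hB2.mono ((le_abs_self _).trans (le_add_of_nonneg_left (abs_nonneg _)))
  obtain ⟨C1, hC1, hmain⟩ := exists_main_error_le S a B hB
  obtain ⟨C2, hC2, hfirst⟩ := exists_first_error_le S a hB hT.le Cd
  refine ⟨(1 + √ν) * (√(∏ i, X i) * (C1 + C2) / ν0 / (ε * √r) * (1 + T)), ?_⟩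
  intro N M hN hM h τ hh hτ hst hBl hBu fd hfd v hv m hm1 hm2
  have hM0 : (0 : ℝ) < M := by exact_mod_cast (by omega : 0 < M)
  have hN0 : ∀ i, (0 : ℝ) < N i := fun i => by exact_mod_cast hN i
  have hm : IsMesh X T h N τ M := by
    refine ⟨fun i => ?_, fun i => ?_, ?_, ?_⟩
    · rw [hh]; exact div_pos (hX i) (hN0 i)
    · rw [hh]; exact mul_div_cancel₀ _ (hN0 i).ne'
    · rw [hτ]; exact div_pos hT hM0
    · rw [hτ]; exact mul_div_cancel₀ _ hM0.ne'
  -- `H` is the squared length of the vector of steps, so `H ^ 2` is the fourth power of the step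
  -- size.
  set H := ∑ i, h i ^ 2 + τ ^ 2 with hHdef
  have hsum : ∀ i, h i ^ 2 ≤ ∑ i, h i ^ 2 := fun i =>
    Finset.single_le_sum (f := fun i => h i ^ 2) (fun _ _ => sq_nonneg _) (Finset.mem_univ i)
  have hH : ∀ i, h i ^ 2 ≤ H := fun i => (hsum i).trans (le_add_of_nonneg_right (sq_nonneg _))
  have hτH : τ ^ 2 ≤ H :=
    le_add_of_nonneg_left (Finset.sum_nonneg fun _ _ => sq_nonneg _)
  have hstep : stepSize h τ ^ 4 = H ^ 2 := by
    rw [stepSize, show 4 = 2 * 2 from rfl, pow_mul,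
      Real.sq_sqrt ((sq_nonneg τ).trans hτH)]
  set e : ℕ → MeshFn n := fun j => sampleT h τ u j - v j with he
  have hF := hsol.eq_boxWave hX hT (hρs.of_le (by norm_num)) (hu.of_le (by norm_num)) hf
  -- The truncation error of `u`, with the residual of the first step stored at level `0`. By
  -- linearity it is the right-hand side of the scheme satisfied by `e`.
  set ψ : ℕ → MeshFn n := fun m k => if m = 0 then
      S.B h (sample h ρ * deltaFwd τ (sampleT h τ u) 0) k
        + 1 / 12 * τ ^ 2 * S.A a h (deltaFwd τ (sampleT h τ u) 0) k
        + 1 / 2 * τ * S.A a h (sampleT h τ u 0) k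
        - (u1N a h τ ρ u1 k + 1 / 2 * τ * fN0 h f fd k)
    else S.B h (sample h ρ * lamT τ (sampleT h τ u) m) k
        + 1 / 12 * τ ^ 2 * S.A a h (lamT τ (sampleT h τ u) m) k + S.A a h (sampleT h τ u m) k
        - fN h τ f m k with hψdef
  have hinit : ∀ k ∈ closedNodes N, e 0 k = 0 := by
    intro k hk
    simp only [he, Pi.sub_apply, hv.initial k hk, sampleT, sample, Nat.cast_zero, zero_mul,
      hsol.initial _ (hm.node_mem_closedBox hT.le hk), sub_self]
  have hψ : ∀ m < M, ∀ k ∈ innerNodes N, |ψ m k| ≤ (C1 + C2) * H ^ 2 := by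
    intro m hmM k hk
    rcases Nat.eq_zero_or_pos m with rfl | hpos
    · simp only [hψdef, if_true]
      refine (hfirst hm (by omega) hU hZ (fun _ => rfl) (fun _ _ => rfl) ?_ ?_ ?_ ?_ hH hτH k
        hk).trans (mul_le_mul_of_nonneg_right (by linarith) (sq_nonneg _))
      · exact fun k hk => hF (hm.mem_box hk le_rfl hT.le)
      · exact fun k hk => hsol.deriv_zero hX hT (hu.of_le (by norm_num))
          (hm.node_mem_closedBox hT.le hk)
      · intro k hk
        rw [boxDeriv_time_iterate_mul hX hT 1 (K := 6) (by norm_num) (by norm_num) hρs hu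
          (hm.mem_box hk le_rfl hT.le), hsol.deriv_zero hX hT (hu.of_le (by norm_num))
          (hm.node_mem_closedBox hT.le hk)]
        rfl
      · intro k hk
        have := hfd k hk
        rwa [hsol.fd0_eq hX hT (hρs.of_le (by norm_num)) (hu.of_le (by norm_num)) hf τ
          (hm.node_mem_closedBox hT.le (innerNodes_subset_closedNodes N hk)) (fun _ => rfl)
          (fun _ _ => rfl)] at this
    · simp only [hψdef, hpos.ne', if_false]
      exact (hmain hm hU hZ (fun p hp => hF hp) hH hτH m hpos (by omega) k hk).trans
        (mul_le_mul_of_nonneg_right (by linarith) (sq_nonneg _))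
  have key := mesh_stability S hX hN hh hm.t_pos hε hε1 hr hν0 (hν0.le.trans hν) hM hm.t_mul hst
    hBl hBu (q := sample h ρ) (e := e) (ψ := ψ) (Ψ := (C1 + C2) * H ^ 2)
    (fun k hk => hρ _ (hm.node_mem_closedBox hT.le (innerNodes_subset_closedNodes N hk)))
    (fun m hmM k hk => ?_) (fun k hk => hinit k (innerNodes_subset_closedNodes N hk)) ?_ ?_ hψ
    (by positivity) m hm1 hm2
  · rw [hstep]
    refine key.trans (le_of_eq ?_)
    ring
  · obtain ⟨hk1, hk2⟩ := Finset.mem_sdiff.mp hk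
    rcases Nat.eq_zero_or_pos m with rfl | hpos
    · exact hinit k hk1
    · have hb := hv.boundary m hpos hmM k hk
      have hg := hsol.boundary (node h k)
        ⟨hm.node_mem_closedBox hT.le hk1, hm.node_notMem_openBox hk2⟩ (m * τ)
        ⟨mul_nonneg (Nat.cast_nonneg _) hm.t_pos.le, hm.time_le hmM⟩
      simp only [he, Pi.sub_apply, hb, sampleT, sample, hg, sub_self]
  · intro m hpos hmM k hk
    have h1 := hv.main m hpos hmM k hk
    rw [show ψ m k = _ from if_neg (Nat.pos_iff_ne_zero.mp hpos)]
    simp only [he, lamT_sub, mul_sub, map_sub, Pi.sub_apply]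
    rw [← h1]
    ring
  · intro k hk
    have h1 := hv.first_step k hk
    rw [show ψ 0 k = _ from if_pos rfl]
    simp only [he, deltaFwd_sub, mul_sub, map_sub, Pi.sub_apply]
    rw [← h1]
    ring

end Convergence

end CompactWave

theorem theorem3 :
    -- the error bound, for all sufficiently smooth `ρ` and `u`
    (∃ K : ℕ, ∀ (n : ℕ), 1 ≤ n → ∀ (S : CompactScheme n)
      (X a : Fin n → ℝ) (T : ℝ), (∀ i, 0 < X i) → (∀ i, 0 < a i) → 0 < T →
      ∀ (ρ : (Fin n → ℝ) → ℝ) (ρlow : ℝ) (f g : (Fin n → ℝ) → ℝ → ℝ) (u0 u1 : (Fin n → ℝ) → ℝ)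
        (u : (Fin n → ℝ) → ℝ → ℝ),
      0 < ρlow → (∀ x ∈ closedBox X, ρlow ≤ ρ x) →
      ContDiffOn ℝ (K : WithTop ℕ∞) ρ (closedBox X) →
      SmoothInTimeSpace K X T u →
      ContinuousOn (fun p : (Fin n → ℝ) × ℝ => f p.1 p.2) (closedBox X ×ˢ Set.Icc 0 T) →
      IsSolution X a T ρ f g u0 u1 u →
      ∀ (ε0 ν0 ν Cd : ℝ), 0 < ε0 → ε0 < 1 → 0 < ν0 → ν0 ≤ ν →
      ∃ C : ℝ, ∀ (N : Fin n → ℕ) (M : ℕ), (∀ i, 1 ≤ N i) → 2 ≤ M →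
        ∀ (h : Fin n → ℝ) (ht : ℝ), (∀ i, h i = X i / N i) → ht = T / M →
        S.Stable a h N ht ε0 ρlow →
        LeOp h N (ν0 • (1 : MeshOp n)) (S.B h) → LeOp h N (S.B h) (ν • (1 : MeshOp n)) →
        ∀ fd : MeshFn n,
        (∀ k ∈ innerNodes N, |fd k - fd0 T ht f (node h k)| ≤ Cd * ht ^ 3) →
        ∀ v : ℕ → MeshFn n,
        SolvesScheme (S.B h) (S.A a h) a h N ht M ρ f g u0 u1 fd v →
        ∀ m, 1 ≤ m → m ≤ M →
          ε0 * normH h N (fun k => Real.sqrt (ρ (node h k)) *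
              deltaBar ht (fun j => sampleT h ht u j - v j) m k)
            + normOp h N (S.A a h) (sBar (fun j => sampleT h ht u j - v j) m)
          ≤ C * stepSize h ht ^ 4) ∧
    -- the lower bound for the norm generated by `A_h`
    (∀ (n : ℕ), 1 ≤ n → ∀ (S : CompactScheme n)
      (X a : Fin n → ℝ), (∀ i, 0 < X i) → (∀ i, 0 < a i) →
      ∀ (N : Fin n → ℕ), (∀ i, 1 ≤ N i) →
      ∀ (h : Fin n → ℝ), (∀ i, h i = X i / N i) →
      ∀ ε2 : ℝ, S.AdmissibleEps ε2 → ∀ w ∈ Hh N,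
        Real.sqrt ε2 * (⨅ i, a i) * (2 / 3 : ℝ) ^ (((n : ℝ) - 1) / 2) * normOp h N (-lapH h) w
          ≤ normOp h N (S.A a h) w) := by
  -- Three second differences in distinct directions, and the sixth order remainder in Numerov's
  -- expansion, are the most demanding terms; both use exactly six derivatives.
  refine ⟨⟨6, ?_⟩, ?_⟩
  · intro n _ S X a T hX _ hT ρ r f g u0 u1 u hr hρ hρs hu hf hsol ε0 ν0 ν Cd hε hε1 hν0 hν
    exact exists_error_le S hX hT hr hρ hρs hu hf hsol Cd hε hε1 hν0 hν
  · intro n hn S X a hX ha N hN h hh ε2 hε w hw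
    exact S.normOp_A_ge hn ha
      (fun i => by rw [hh]; exact div_pos (hX i) (by exact_mod_cast hN i)) hε hw
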